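/- Throughout, functions are real-valued. Let $p>1$, let $f,g,h\colon(0,\infty)\to\mathbb R$, and put $\rho:=f/2$ (so $f(r)=|S^{0}|\,r^{0}\rho(r)$, the dimension being $N=1$). Consider on $\mathbb R$ the equation $$(\rho(|x|)\phi')'+\rho(|x|)\bigl(-g(|x|)\phi+h(|x|)|\phi|^{p-1}\phi\bigr)=0,\qquad(\mathrm E)$$ understood in the weak sense (tested against $C_c^\infty$ functions, across $x=0$ as well); for $\phi\ge 0$ the nonlinearity is $h\phi^p$. Put $$\|v\|_{\mathcal X_\rho}=\Bigl(\int_{\mathbb R}(|v'|^2+g(|x|)|v|^2)\rho(|x|)\,dx\Bigr)^{1/2},\qquad \|v\|_{\mathcal L_\rho}=\Bigl(\int_{\mathbb R}h(|x|)|v|^{p+1}\rho(|x|)\,dx\Bigr)^{1/(p+1)},$$ let $\mathcal X_\rho,\mathcal L_\rho$ be the completions of $C_c^\infty(\mathbb R)$ in these norms, let $\mathcal X,\mathcal L$ be their subspaces of even functions (with the same norms), and let $$I_\rho(v)=\tfrac12\|v\|_{\mathcal X_\rho}^2-\tfrac1{p+1}\|v\|_{\mathcal L_\rho}^{p+1},\qquad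 v\in\mathcal X_\rho .$$ For $r>0$ put $a=f^{2(p+1)/(p+3)}h^{-2/(p+3)}$, $b=-\frac12a'+\frac{f'}{f}a$, $c=-b'+\frac{f'}{f}b$, $G=bg+\frac12c'-\frac12(ag)'$, $D=b^2-a(c-ag)$, $U(r)=\frac1{f(r)}\int_0^r f(|g|+h)\,d\tau$, $V(r)=\frac1{f(r)}\int_0^r fh\,d\tau$, and $$J(r;\phi)=\tfrac12a\phi'^2+b\phi'\phi+\tfrac12c\phi^2-\tfrac12ag\phi^2+\tfrac1{p+1}ah\phi^{p+1}.$$ Assume: 1. $f,h\in C^3(0,\infty)$ are positive and $g\in C^1(0,\infty)$. 2. For some $R>0$, the functions $f(|g|+h)$ and $\tau\mapsto f(\tau)(|g(\tau)|+h(\tau))\int_\tau^R f(\sigma)^{-1}d\sigma$ belong to $L^1(0,R)$. 3. $aUV\to0$ and $bV\to0$ as $r\searrow0$. 4. Either $bU\to0$ and $\liminf_{r\searrow0}(c-ag)\in[0,\infty]$, or $\limsup_{r\searrow0}D/a\le0$. 5. $G$ is negative somewhere, and either there is $\kappa\in[0,\infty]$ with $G\ge0$ on $(0,\kappa)$ and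 $G\le0$ on $(\kappa,\infty)$, or there is no $r>0$ with $G(r)=0$ and $D(r)>0$. 6. $\displaystyle\inf_{\psi\in\mathcal X\setminus\{0\}}\frac{\|\psi\|_{\mathcal X}}{\|\psi\|_{\mathcal L}}>0$ and $\displaystyle\inf_{\psi\in\mathcal X\setminus\{0\}}\frac{\|\psi\|_{\mathcal X}}{\bigl(\int_0^\infty(\psi'^2+|g|\psi^2)f\,dr\bigr)^{1/2}}>0$. 7. Either the embedding $\mathcal X\hookrightarrow\mathcal L$ is compact, or there is $\hat g\in C(0,\infty)$, with $\hat g\psi^2f$ integrable on $(0,\infty)$ for all $\psi\in\mathcal X$, such that $$\inf_{\psi\in\mathcal X\setminus\{0\}}\frac{\|\psi\|_{\mathcal X}^2}{\|\psi\|_{\mathcal L}^2}<\inf_{\psi\in\mathcal X\setminus\{0\}}\frac{\int_0^\infty(\psi'^2+\hat g\psi^2)f\,dr}{\|\psi\|_{\mathcal L}^2}$$ and $\int_0^\infty(\hat g-g)|\psi_j-\psi|^2f\,dr\to0$ whenever $\psi_j\rightharpoonup\psi$ weakly in $\mathcal X$. 8. If $\psi\in\mathcal X$ satisfies (E) on $\{|x|<\delta\}$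 for some $\delta>0$, then $\psi$ is continuous at $0$ and $f(r)\psi'(r)\to0$ as $r\searrow0$. 9. If $\psi\in\mathcal X\cap C^2(\mathbb R\setminus\{0\})\cap C(\mathbb R)$ is positive and satisfies (E) on $\{|x|>R\}$ for some $R>0$, then $J(r;\psi)\to0$ as $r\to\infty$. 10. $\displaystyle\inf_{v\in\mathcal X_\rho\setminus\{0\}}\frac{\|v\|_{\mathcal X_\rho}}{\|v\|_{\mathcal L_\rho}}>0$ and $\displaystyle\inf_{v\in\mathcal X_\rho\setminus\{0\}}\frac{\|v\|_{\mathcal X_\rho}}{\bigl(\int_{\mathbb R}(|v'|^2+|g(|x|)|\,|v|^2)\rho(|x|)\,dx\bigr)^{1/2}}>0$. 11. On $(0,\infty)$: $f'\ge0$, $(\log\rho)''\ge0$, $g'\ge0$, $h'\le0$, and at least one of the last three is not identically an equality. Let $\phi\in\mathcal X_\rho$ be a positive even solution of (E) on $\mathbb R$ with $\phi\in C(\mathbb R)\cap C^2(\mathbb R\setminus\{0\})$, and assume in addition: 12. Every weak solution $w\in\mathcal X_\rho$ of $w''+\frac{(\rho(|x|))'}{\rho(|x|)}w'-g(|x|)w+p\,h(|x|)\phi^{p-1}w=0$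 on $\mathbb R$ belongs to $C(\mathbb R)\cap C^1(\mathbb R\setminus\{0\})$ and satisfies $|w(x)|+|w'(x)|\to0$ as $|x|\to\infty$. 13. $\limsup_{r\to\infty}\bigl(f'|\phi'|+f|g|\phi+fh\phi^p+f|\phi'|\bigr)<\infty$. 14. $-g\phi+h\phi^p>0$ on $(0,\delta)$ for some $\delta>0$. 15. Either $\liminf_{r\searrow0}\bigl(-f'\phi'+fg\phi-fh\phi^p\bigr)>-\infty$, or $f|g|+fh=o(r^{-1})$ as $r\searrow0$ and every $w$ as in 12 belongs to $C^1(\mathbb R)$. Then $I_\rho$ is of class $C^2$ on $\mathcal X_\rho$ and $\phi$ is a nondegenerate critical point of it, that is, $$I_\rho'(\phi)=0,\qquad \ker I_\rho''(\phi)=\{w\in\mathcal X_\rho\mid I_\rho''(\phi)w=0\}=\{0\}.$$ -/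

import Mathlib

open MeasureTheory Filter Set Topology
open scoped ENNReal NNReal

noncomputable section

namespace EvenNLS

/-! ### Coefficient functions -/

/-- The weight `ρ`, normalised by `f(r) = |S⁰| r⁰ ρ(r) = 2 ρ(r)` in dimension one. -/
def rho (f : ℝ → ℝ) (r : ℝ) : ℝ := f r / 2

/-- `a = f^{2(p+1)/(p+3)} h^{-2/(p+3)}`. -/
def cA (p : ℝ) (f h : ℝ → ℝ) (r : ℝ) : ℝ :=
  f r ^ (2 * (p + 1) / (p + 3)) * h r ^ (-2 / (p + 3))

/-- `b = -a'/2 + (f'/f) a`. -/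
def cB (p : ℝ) (f h : ℝ → ℝ) (r : ℝ) : ℝ :=
  -(1 / 2) * deriv (cA p f h) r + deriv f r / f r * cA p f h r

/-- `c = -b' + (f'/f) b`. -/
def cC (p : ℝ) (f h : ℝ → ℝ) (r : ℝ) : ℝ :=
  -deriv (cB p f h) r + deriv f r / f r * cB p f h r

/-- `G = b g + c'/2 - (a g)'/2`. -/
def cG (p : ℝ) (f g h : ℝ → ℝ) (r : ℝ) : ℝ :=
  cB p f h r * g r + (1 / 2) * deriv (cC p f h) r
    - (1 / 2) * deriv (fun s => cA p f h s * g s) r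

/-- `D = b² - a (c - a g)`. -/
def cD (p : ℝ) (f g h : ℝ → ℝ) (r : ℝ) : ℝ :=
  cB p f h r ^ 2 - cA p f h r * (cC p f h r - cA p f h r * g r)

/-- `U(r) = f(r)⁻¹ ∫₀ʳ f (|g| + h)`. -/
def cU (f g h : ℝ → ℝ) (r : ℝ) : ℝ :=
  1 / f r * ∫ t in (0 : ℝ)..r, f t * (|g t| + h t)

/-- `V(r) = f(r)⁻¹ ∫₀ʳ f h`. -/
def cV (f h : ℝ → ℝ) (r : ℝ) : ℝ :=
  1 / f r * ∫ t in (0 : ℝ)..r, f t * h t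

/-- The generalized Pohozaev function `J(r; u)`. -/
def pohozaevJ (p : ℝ) (f g h u : ℝ → ℝ) (r : ℝ) : ℝ :=
  (1 / 2) * cA p f h r * deriv u r ^ 2 + cB p f h r * deriv u r * u r
    + (1 / 2) * cC p f h r * u r ^ 2 - (1 / 2) * cA p f h r * g r * u r ^ 2
    + 1 / (p + 1) * cA p f h r * h r * u r ^ (p + 1)

/-! ### The function spaces -/

/-- `η ∈ C_c^∞(ℝ)`. -/
def IsTest (η : ℝ → ℝ) : Prop :=
  ContDiff ℝ ((⊤ : ℕ∞) : WithTop ℕ∞) η ∧ HasCompactSupport η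

/-- The exponent `p + 1` (for `p ≥ 0`), written so that it is visibly at least `1`. -/
def expL (p : ℝ) : ℝ≥0∞ := 1 + ENNReal.ofReal p

instance (p : ℝ) : Fact (1 ≤ expL p) := ⟨le_self_add⟩

/-- The measure `ρ(|x|) dx` on `ℝ`. -/
def muRho (f : ℝ → ℝ) : Measure ℝ :=
  volume.withDensity fun x => ENNReal.ofReal (rho f |x|)

/-- The measure `|g(|x|)| ρ(|x|) dx` on `ℝ`. -/
def muG (f g : ℝ → ℝ) : Measure ℝ :=
  volume.withDensity fun x => ENNReal.ofReal (abs (g |x|) * rho f |x|)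

/-- The measure `h(|x|) ρ(|x|) dx` on `ℝ`. -/
def muH (f h : ℝ → ℝ) : Measure ℝ :=
  volume.withDensity fun x => ENNReal.ofReal (h |x| * rho f |x|)

/-- The space `𝓛_ρ`, i.e. `L^{p+1}` for the measure `h(|x|) ρ(|x|) dx`. -/
abbrev Lrho (p : ℝ) (f h : ℝ → ℝ) : Type := Lp ℝ (expL p) (muH f h)

/-- The Banach space in which `C_c^∞(ℝ)` is embedded by `η ↦ (η', η, η)`. -/
abbrev Ambient (p : ℝ) (f g h : ℝ → ℝ) : Type :=
  Lp ℝ 2 (muRho f) × Lp ℝ 2 (muG f g) × Lrho p f h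

/-- The image of `C_c^∞(ℝ)` under `η ↦ (η', η, η)`. -/
def testSubspace (p : ℝ) (f g h : ℝ → ℝ) : Submodule ℝ (Ambient p f g h) where
  carrier := {z | ∃ η : ℝ → ℝ, IsTest η ∧ z.1 =ᵐ[muRho f] deriv η ∧
    z.2.1 =ᵐ[muG f g] η ∧ z.2.2 =ᵐ[muH f h] η}
  zero_mem' := by
    refine ⟨0, ⟨contDiff_const, HasCompactSupport.zero⟩, ?_, ?_, ?_⟩
    · refine (Lp.coeFn_zero ℝ 2 (muRho f)).trans ?_
      filter_upwards with x
      simp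
    · exact Lp.coeFn_zero ℝ 2 (muG f g)
    · exact Lp.coeFn_zero ℝ (expL p) (muH f h)
  add_mem' := by
    rintro z w ⟨η, hη, h1, h2, h3⟩ ⟨θ, hθ, k1, k2, k3⟩
    refine ⟨η + θ, ⟨hη.1.add hθ.1, hη.2.add hθ.2⟩, ?_, ?_, ?_⟩
    · refine (Lp.coeFn_add z.1 w.1).trans ?_
      filter_upwards [h1, k1] with x e1 e2
      rw [Pi.add_apply, e1, e2, deriv_add
        (hη.1.differentiable (by simp) x) (hθ.1.differentiable (by simp) x)]
    · exact (Lp.coeFn_add z.2.1 w.2.1).trans (h2.add k2)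
    · exact (Lp.coeFn_add z.2.2 w.2.2).trans (h3.add k3)
  smul_mem' := by
    rintro c z ⟨η, hη, h1, h2, h3⟩
    refine ⟨c • η, ⟨hη.1.const_smul c, hη.2.smul_left (f := fun _ => c)⟩, ?_, ?_, ?_⟩
    · refine (Lp.coeFn_smul c z.1).trans ?_
      filter_upwards [h1] with x e1
      rw [Pi.smul_apply, e1, deriv_const_smul c (hη.1.differentiable (by simp) x)]
    · exact (Lp.coeFn_smul c z.2.1).trans (h2.const_smul c)
    · exact (Lp.coeFn_smul c z.2.2).trans (h3.const_smul c)

/-- The space `𝓧_ρ`, the completion of `C_c^∞(ℝ)`, realised as a closure.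
The norm inherited from the ambient space is
`max (‖v'‖_{L²(ρ)}) (‖v‖_{L²(|g|ρ)}) (‖v‖_{𝓛_ρ})`. As soon as `‖·‖_{𝓧_ρ}` dominates
`(∫ (|v'|² + |g| |v|²) ρ)^{1/2}` and `‖·‖_{𝓛_ρ}` (which is condition `NormBound` below), it is
equivalent to `‖·‖_{𝓧_ρ}`, so that this closure is the completion with respect to `‖·‖_{𝓧_ρ}`,
with the same bounded functionals, weak convergence, compact maps and derivatives. -/
def Xrho (p : ℝ) (f g h : ℝ → ℝ) : Submodule ℝ (Ambient p f g h) :=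
  (testSubspace p f g h).topologicalClosure

variable {p : ℝ} {f g h : ℝ → ℝ}

/-- The element of `𝓛_ρ` underlying an element of `𝓧_ρ`. -/
def toL (v : Xrho p f g h) : Lrho p f h := (v : Ambient p f g h).2.2

/-- A representative of `v ∈ 𝓧_ρ` as a function on `ℝ`. -/
def val (v : Xrho p f g h) : ℝ → ℝ := (toL v : ℝ → ℝ)

/-- A representative of the (weak) derivative of `v ∈ 𝓧_ρ`. -/
def dval (v : Xrho p f g h) : ℝ → ℝ := ((v : Ambient p f g h).1 : ℝ → ℝ)

/-- `‖v‖_{𝓧_ρ} = (∫ (|v'|² + g(|x|) |v|²) ρ(|x|) dx)^{1/2}`. -/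
def normX (v : Xrho p f g h) : ℝ :=
  Real.sqrt (∫ x, (dval v x ^ 2 + g |x| * val v x ^ 2) * rho f |x|)

/-- `‖v‖_{𝓛_ρ} = (∫ h(|x|) |v|^{p+1} ρ(|x|) dx)^{1/(p+1)}`. -/
def normL (v : Xrho p f g h) : ℝ :=
  (∫ x, h |x| * |val v x| ^ (p + 1) * rho f |x|) ^ (1 / (p + 1))

/-- The functional `I_ρ` on `𝓧_ρ`. -/
def energy (v : Xrho p f g h) : ℝ :=
  (1 / 2) * normX v ^ 2 - 1 / (p + 1) * normL v ^ (p + 1)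

variable (p f g h)

/-- The space `𝓧 = 𝓧_{ρ,rad}` of radial (even) elements of `𝓧_ρ`. -/
def Xrad : Submodule ℝ (Xrho p f g h) where
  carrier := {v | ∃ u : ℝ → ℝ, val v =ᵐ[muH f h] fun x => u |x|}
  zero_mem' := ⟨0, Lp.coeFn_zero ℝ (expL p) (muH f h)⟩
  add_mem' := by
    rintro v w ⟨u, hu⟩ ⟨t, ht⟩
    exact ⟨u + t, (Lp.coeFn_add (toL v) (toL w)).trans (hu.add ht)⟩
  smul_mem' := by
    rintro c v ⟨u, hu⟩
    exact ⟨c • u, (Lp.coeFn_smul c (toL v)).trans (hu.const_smul c)⟩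

variable {p f g h}

/-! ### The equations -/

/-- `v ∈ 𝓧_ρ` satisfies `(ρ v')' + ρ (-g v + h |v|^{p-1} v) = 0` on the open set `S ⊆ ℝ`,
in the weak sense. For `v ≥ 0` the nonlinearity is `h v^p`. -/
def SolvesOn (v : Xrho p f g h) (S : Set ℝ) : Prop :=
  ∀ η : ℝ → ℝ, IsTest η → tsupport η ⊆ S →
    ∫ x, (dval v x * deriv η x + g |x| * val v x * η x
      - h |x| * (|val v x| ^ (p - 1) * val v x) * η x) * rho f |x| = 0

/-- `w ∈ 𝓧_ρ` satisfies the linearized equation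
`w'' + (ρ'/ρ) w' - g w + p h φ^{p-1} w = 0` on `ℝ`, in the weak sense. -/
def SolvesLinearized (φ : ℝ → ℝ) (w : Xrho p f g h) : Prop :=
  ∀ η : ℝ → ℝ, IsTest η →
    ∫ x, (dval w x * deriv η x + g |x| * val w x * η x
      - p * h |x| * φ x ^ (p - 1) * val w x * η x) * rho f |x| = 0

/-- `Φ ∈ 𝓧_ρ`, with representative `φ ∈ C(ℝ) ∩ C²(ℝ ∖ {0})`, is a positive radial (even)
solution on `ℝ`. -/
structure IsPositiveRadialSolution (Φ : Xrho p f g h) (φ : ℝ → ℝ) : Prop where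
  repr : val Φ =ᵐ[volume] φ
  cont : Continuous φ
  smooth : ContDiffOn ℝ 2 φ {0}ᶜ
  pos : ∀ x, 0 < φ x
  even : ∀ x, φ (-x) = φ x
  solves : SolvesOn Φ univ

/-! ### The conditions -/

variable (p f g h)

/-- Regularity and positivity of the coefficients. -/
def CoeffReg : Prop :=
  ContDiffOn ℝ 3 f (Ioi 0) ∧ ContDiffOn ℝ 3 h (Ioi 0) ∧ ContDiffOn ℝ 1 g (Ioi 0) ∧
    ∀ r, 0 < r → 0 < f r ∧ 0 < h r

/-- Integrability of the coefficients at the origin. -/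
def OriginIntegrable : Prop :=
  ∃ R : ℝ, 0 < R ∧
    IntegrableOn (fun t => f t * (|g t| + h t)) (Ioo 0 R) ∧
    IntegrableOn (fun t => f t * (|g t| + h t) * ∫ s in t..R, (f s)⁻¹) (Ioo 0 R)

/-- `a U V → 0` and `b V → 0` at the origin. -/
def OriginUV : Prop :=
  Tendsto (fun r => cA p f h r * cU f g h r * cV f h r) (𝓝[>] 0) (𝓝 0) ∧
    Tendsto (fun r => cB p f h r * cV f h r) (𝓝[>] 0) (𝓝 0)

/-- Behaviour at the origin that bounds the Pohozaev function from below. -/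
def OriginJ : Prop :=
  (Tendsto (fun r => cB p f h r * cU f g h r) (𝓝[>] 0) (𝓝 0) ∧
    0 ≤ liminf (fun r => ((cC p f h r - cA p f h r * g r : ℝ) : EReal)) (𝓝[>] 0)) ∨
  limsup (fun r => ((cD p f g h r / cA p f h r : ℝ) : EReal)) (𝓝[>] 0) ≤ 0

/-- Sign condition on `G`. -/
def SignG : Prop :=
  (∃ r, 0 < r ∧ cG p f g h r < 0) ∧
  ((∃ κ : ℝ≥0∞, ∀ r, 0 < r →
      (ENNReal.ofReal r < κ → 0 ≤ cG p f g h r) ∧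
      (κ < ENNReal.ofReal r → cG p f g h r ≤ 0)) ∨
    {r | 0 < r ∧ cG p f g h r = 0 ∧ 0 < cD p f g h r} = ∅)

/-- Relations of norms on the radial space `𝓧`. -/
def NormBoundRad : Prop :=
  (0 < ⨅ ψ : {ψ : Xrad p f g h // ψ ≠ 0}, normX ψ.1.1 / normL ψ.1.1) ∧
  (0 < ⨅ ψ : {ψ : Xrad p f g h // ψ ≠ 0}, normX ψ.1.1 /
    Real.sqrt (∫ r in Ioi (0 : ℝ), (dval ψ.1.1 r ^ 2 + |g r| * val ψ.1.1 r ^ 2) * f r))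

/-- The embedding `𝓧 → 𝓛` is compact. -/
def CompactEmbedding : Prop :=
  IsCompactOperator (fun ψ : Xrad p f g h => toL ψ.1)

/-- There is a comparison potential with strictly larger best constant, the difference of the
potentials being weakly continuous on `𝓧`. -/
def ComparisonPotential : Prop :=
  ∃ g' : ℝ → ℝ, ContinuousOn g' (Ioi 0) ∧
    (∀ ψ : Xrad p f g h, IntegrableOn (fun r => g' r * val ψ.1 r ^ 2 * f r) (Ioi 0)) ∧
    (⨅ ψ : {ψ : Xrad p f g h // ψ ≠ 0}, ((normX ψ.1.1 ^ 2 / normL ψ.1.1 ^ 2 : ℝ) : EReal)) <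
      (⨅ ψ : {ψ : Xrad p f g h // ψ ≠ 0},
        (((∫ r in Ioi (0 : ℝ), (dval ψ.1.1 r ^ 2 + g' r * val ψ.1.1 r ^ 2) * f r)
          / normL ψ.1.1 ^ 2 : ℝ) : EReal)) ∧
    ∀ (s : ℕ → Xrad p f g h) (ψ : Xrad p f g h),
      (∀ l : Xrad p f g h →L[ℝ] ℝ, Tendsto (fun j => l (s j)) atTop (𝓝 (l ψ))) →
      Tendsto (fun j => ∫ r in Ioi (0 : ℝ), (g' r - g r) * val (s j - ψ).1 r ^ 2 * f r)
        atTop (𝓝 0)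

/-- Radial functions that solve the equation near the origin are continuous at the origin, and
`f(r) ψ'(r) → 0` as `r → 0+`. -/
def RegularAtOrigin : Prop :=
  ∀ (ψ : Xrad p f g h) (δ : ℝ), 0 < δ → SolvesOn ψ.1 {x | |x| < δ} →
    ∃ u : ℝ → ℝ, val ψ.1 =ᵐ[volume] u ∧ ContinuousAt u 0 ∧
      (∀ᶠ r in 𝓝[>] (0 : ℝ), DifferentiableAt ℝ u r) ∧
      Tendsto (fun r => f r * deriv u r) (𝓝[>] 0) (𝓝 0)

/-- `J(r; u) → 0` as `r → ∞` for positive radial functions that solve the equation near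
infinity. -/
def PohozaevAtInfinity : Prop :=
  ∀ (ψ : Xrad p f g h) (u : ℝ → ℝ) (R : ℝ), 0 < R →
    val ψ.1 =ᵐ[volume] u → Continuous u → ContDiffOn ℝ 2 u {0}ᶜ → (∀ x, 0 < u x) →
    SolvesOn ψ.1 {x | R < |x|} →
    Tendsto (pohozaevJ p f g h u) atTop (𝓝 0)

/-- Relations of norms on `𝓧_ρ`. -/
def NormBound : Prop :=
  (0 < ⨅ v : {v : Xrho p f g h // v ≠ 0}, normX v.1 / normL v.1) ∧
  (0 < ⨅ v : {v : Xrho p f g h // v ≠ 0}, normX v.1 /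
    Real.sqrt (∫ x, (dval v.1 x ^ 2 + abs (g |x|) * val v.1 x ^ 2) * rho f |x|))

/-- Monotonicity of the coefficients. -/
def CoeffMono : Prop :=
  (∀ r, 0 < r → 0 ≤ deriv f r) ∧
  (∀ r, 0 < r → 0 ≤ deriv (deriv fun s => Real.log (rho f s)) r) ∧
  (∀ r, 0 < r → 0 ≤ deriv g r) ∧
  (∀ r, 0 < r → deriv h r ≤ 0) ∧
  ∃ r, 0 < r ∧
    (deriv (deriv fun s => Real.log (rho f s)) r ≠ 0 ∨ deriv g r ≠ 0 ∨ deriv h r ≠ 0)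

variable (φ : ℝ → ℝ)

/-- Regularity and decay of the solutions in `𝓧_ρ` of the linearized equation. -/
def LinearizedRegular : Prop :=
  ∀ w : Xrho p f g h, SolvesLinearized φ w →
    ∃ u : ℝ → ℝ, val w =ᵐ[volume] u ∧ Continuous u ∧ ContDiffOn ℝ 1 u {0}ᶜ ∧
      Tendsto (fun x => |u x| + |deriv u x|) (cocompact ℝ) (𝓝 0)

/-- Boundedness at infinity. -/
def BoundedAtInfinity : Prop :=
  limsup (fun r => ((deriv f r * |deriv φ r| + f r * |g r| * φ r + f r * h r * φ r ^ p
    + f r * |deriv φ r| : ℝ) : EReal)) atTop < ⊤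

/-- `-g φ + h φ^p > 0` near the origin. -/
def PositiveNearOrigin : Prop :=
  ∃ δ : ℝ, 0 < δ ∧ ∀ r ∈ Ioo 0 δ, 0 < -g r * φ r + h r * φ r ^ p

/-- The alternative at the origin used for the odd part. -/
def OriginAlternative : Prop :=
  ⊥ < liminf (fun r => ((-deriv f r * deriv φ r + f r * g r * φ r
      - f r * h r * φ r ^ p : ℝ) : EReal)) (𝓝[>] 0) ∨
  ((fun r => f r * |g r| + f r * h r) =o[𝓝[>] 0] (fun r : ℝ => r⁻¹) ∧
    ∀ w : Xrho p f g h, SolvesLinearized φ w →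
      ∃ u : ℝ → ℝ, val w =ᵐ[volume] u ∧ ContDiff ℝ 1 u)

end EvenNLS

end

open EvenNLS

noncomputable section
namespace EvenNLS

/-! ### The power functional on `L^{p+1}` -/

/-! The energy is a bounded quadratic form minus the power functional $\int |v|^{p+1}/(p+1)$ on a
weighted $L^{p+1}$. The power functional is $C^2$ because the pointwise Taylor remainders have
homogeneous bounds that Hölder's inequality integrates (`hasFDerivAt_powInt`, `hasFDerivAt_powD`,
`continuous_powD2`). By density of test functions, weak solutions are critical points, and kernel
elements of the second derivative solve the linearized equation weakly.

Nondegeneracy rests on comparing a solution $y$ of the linearized equation on $(0,\infty)$ with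
$\phi'$. Differentiating the equation of $\phi$ shows that $\phi'$ solves the linearized equation up
to the defect $-(\log\rho)''\phi'+g'\phi-h'\phi^p$. Since $\phi'<0$ (`HalfLineSolution.deriv_neg`),
monotonicity of the coefficients makes the defect nonnegative, and positive somewhere. Hence
$W=f(y\phi''-y'\phi')$ satisfies $W'=yf\cdot\text{defect}$ (`hasDerivAt_wronskian`), and $W\to0$ at
infinity by the decay assumptions.

If $y$ crossed zero upwards, $W$ would be positive there. It would stay so, since $y$ could not
return to zero, which contradicts $W\to0$. With the same argument for $-y$ and uniqueness for the
ODE, $y$ vanishes identically or has a constant sign (`eq_zero_or_sign`).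

For a kernel element with representative $u$, this applies to $u(r)+u(-r)$ and to $u(r)-u(-r)$. The
first cannot have a sign: testing the equation of $\phi$ with $w$ and the linearized equation with
$\phi$ gives $\int h\phi^p w\rho=0$ (`not_even_part_sign`). The second vanishes at the origin. If it
were positive, $W$ would be increasing to $0$, hence bounded above by a negative constant near the
origin, whereas the conditions at the origin keep $W$ from staying below a negative constant there
(`not_pos_of_tendsto_zero`). So both parts vanish, and $u=0$ off the origin. -/

lemma expL_eq_ofReal {p : ℝ} (hp : 0 ≤ p) : expL p = ENNReal.ofReal (p + 1) := by
  rw [expL, add_comm, ENNReal.ofReal_add hp zero_le_one, ENNReal.ofReal_one]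

lemma expL_toReal {p : ℝ} (hp : 0 ≤ p) : (expL p).toReal = p + 1 := by
  rw [expL_eq_ofReal hp, ENNReal.toReal_ofReal (by linarith)]

lemma expL_ne_top (p : ℝ) : expL p ≠ ∞ := by simp [expL]

lemma expL_ne_zero (p : ℝ) : expL p ≠ 0 := by simp [expL]

section Power

variable {α : Type*} [MeasurableSpace α] {μ : Measure α} {p : ℝ}

lemma lintegral_enorm_rpow_Lp (hp : 0 ≤ p) (v : Lp ℝ (expL p) μ) :
    ∫⁻ x, ‖v x‖ₑ ^ (p + 1) ∂μ = ‖v‖ₑ ^ (p + 1) := by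
  rw [Lp.enorm_def, eLpNorm_eq_lintegral_rpow_enorm_toReal (expL_ne_zero p) (expL_ne_top p),
    expL_toReal hp, ← ENNReal.rpow_mul, one_div_mul_cancel (by linarith), ENNReal.rpow_one]

lemma lintegral_rpow_mul_three_le (hp : 0 ≤ p) {s t r : ℝ} (hs : 0 ≤ s) (ht : 0 ≤ t) (hr : 0 ≤ r)
    (hsum : s + t + r = p + 1) (a b c : Lp ℝ (expL p) μ) :
    ∫⁻ x, ‖a x‖ₑ ^ s * ‖b x‖ₑ ^ t * ‖c x‖ₑ ^ r ∂μ ≤ ‖a‖ₑ ^ s * ‖b‖ₑ ^ t * ‖c‖ₑ ^ r := by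
  have hp1 : 0 < p + 1 := by linarith
  have key (y : ℝ≥0∞) (s : ℝ) : (y ^ (p + 1)) ^ (s / (p + 1)) = y ^ s := by
    rw [← ENNReal.rpow_mul, mul_div_cancel₀ _ hp1.ne']
  have h := ENNReal.lintegral_prod_norm_pow_le (μ := μ) (Finset.univ : Finset (Fin 3))
    (f := ![fun x => ‖a x‖ₑ ^ (p + 1), fun x => ‖b x‖ₑ ^ (p + 1), fun x => ‖c x‖ₑ ^ (p + 1)])
    (by
      intro i _
      fin_cases i
      · exact (Lp.aestronglyMeasurable a).enorm.pow_const _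
      · exact (Lp.aestronglyMeasurable b).enorm.pow_const _
      · exact (Lp.aestronglyMeasurable c).enorm.pow_const _)
    (p := ![s / (p + 1), t / (p + 1), r / (p + 1)])
    (by simp [Fin.sum_univ_three, ← add_div, hsum, hp1.ne'])
    (by
      intro i _
      fin_cases i <;> simp <;> positivity)
  simpa [Fin.prod_univ_three, key, lintegral_enorm_rpow_Lp hp] using h

/-- Hölder's inequality for three factors with total exponent `p + 1`. -/
lemma integrable_and_integral_rpow_mul_three_le (hp : 0 ≤ p) {s t r : ℝ} (hs : 0 ≤ s) (ht : 0 ≤ t)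
    (hr : 0 ≤ r) (hsum : s + t + r = p + 1) (a b c : Lp ℝ (expL p) μ) :
    Integrable (fun x => |a x| ^ s * |b x| ^ t * |c x| ^ r) μ ∧
      ∫ x, |a x| ^ s * |b x| ^ t * |c x| ^ r ∂μ ≤ ‖a‖ ^ s * ‖b‖ ^ t * ‖c‖ ^ r := by
  have hof (x y z : ℝ) (hx : 0 ≤ x) (hy : 0 ≤ y) (hz : 0 ≤ z) : ENNReal.ofReal (x ^ s * y ^ t * z ^ r) =
      ENNReal.ofReal x ^ s * ENNReal.ofReal y ^ t * ENNReal.ofReal z ^ r := by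
    rw [ENNReal.ofReal_mul (by positivity), ENNReal.ofReal_mul (by positivity),
      ENNReal.ofReal_rpow_of_nonneg hx hs, ENNReal.ofReal_rpow_of_nonneg hy ht,
      ENNReal.ofReal_rpow_of_nonneg hz hr]
  have hle := lintegral_rpow_mul_three_le hp hs ht hr hsum a b c
  have hL : ∫⁻ x, ENNReal.ofReal (|a x| ^ s * |b x| ^ t * |c x| ^ r) ∂μ ≤
      ENNReal.ofReal (‖a‖ ^ s * ‖b‖ ^ t * ‖c‖ ^ r) := by
    rw [hof _ _ _ (norm_nonneg _) (norm_nonneg _) (norm_nonneg _)]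
    simp only [hof _ _ _ (abs_nonneg _) (abs_nonneg _) (abs_nonneg _),
      ← Real.enorm_eq_ofReal_abs, ofReal_norm]
    exact hle
  have hm : AEStronglyMeasurable (fun x => |a x| ^ s * |b x| ^ t * |c x| ^ r) μ := by
    have ha := (Lp.aestronglyMeasurable a).aemeasurable
    have hb := (Lp.aestronglyMeasurable b).aemeasurable
    have hc := (Lp.aestronglyMeasurable c).aemeasurable
    exact ((ha.abs.pow_const _).mul (hb.abs.pow_const _)).mul (hc.abs.pow_const _)
      |>.aestronglyMeasurable
  have h0 : 0 ≤ᵐ[μ] fun x => |a x| ^ s * |b x| ^ t * |c x| ^ r :=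
    Eventually.of_forall fun x => by positivity
  refine ⟨⟨hm, ?_⟩, ?_⟩
  · rw [hasFiniteIntegral_iff_ofReal h0]
    exact hL.trans_lt ENNReal.ofReal_lt_top
  · rw [integral_eq_lintegral_of_nonneg_ae h0 hm]
    exact ENNReal.toReal_le_of_le_ofReal (by positivity) hL

/-- The signed power `|x|^{p-1} x`. -/
def sgnPow (p x : ℝ) : ℝ := |x| ^ (p - 1) * x

lemma abs_sgnPow (hp : 0 < p) (x : ℝ) : |sgnPow p x| = |x| ^ p := by
  rcases eq_or_ne x 0 with rfl | hx
  · simp [sgnPow, Real.zero_rpow hp.ne']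
  · rw [sgnPow, abs_mul, abs_of_nonneg (by positivity), ← Real.rpow_add_one (abs_ne_zero.2 hx)]
    simp

lemma sgnPow_of_pos {x : ℝ} (hx : 0 < x) : sgnPow p x = x ^ p := by
  rw [sgnPow, abs_of_pos hx, ← Real.rpow_add_one hx.ne']
  simp

lemma sgnPow_mul (x y : ℝ) : sgnPow p (x * y) = sgnPow p x * sgnPow p y := by
  rw [sgnPow, sgnPow, sgnPow, abs_mul, Real.mul_rpow (abs_nonneg _) (abs_nonneg _)]
  ring

lemma continuous_abs_rpow {s : ℝ} (hs : 0 ≤ s) : Continuous fun x : ℝ => |x| ^ s :=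
  continuous_abs.rpow_const fun _ => Or.inr hs

lemma continuous_sgnPow (hp : 1 ≤ p) : Continuous (sgnPow p) :=
  (continuous_abs_rpow (by linarith)).mul continuous_id

/-- At the origin the difference quotient is $|y|^{p-1}$, which tends to $0$ because $p>1$.
Elsewhere it is the product rule. -/
lemma hasDerivAt_sgnPow (hp : 1 < p) (x : ℝ) :
    HasDerivAt (sgnPow p) (p * |x| ^ (p - 1)) x := by
  rcases eq_or_ne x 0 with rfl | hx
  · rw [abs_zero, Real.zero_rpow (by linarith), mul_zero, hasDerivAt_iff_tendsto_slope]
    have h : Tendsto (fun y : ℝ => |y| ^ (p - 1)) (𝓝[≠] 0) (𝓝 0) := by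
      have := (continuous_abs_rpow (s := p - 1) (by linarith)).tendsto 0
      rw [abs_zero, Real.zero_rpow (by linarith)] at this
      exact this.mono_left nhdsWithin_le_nhds
    refine h.congr' ?_
    filter_upwards [self_mem_nhdsWithin] with y hy
    rw [slope_def_field, sgnPow, sgnPow, mul_zero, sub_zero, sub_zero, mul_div_cancel_right₀ _ hy]
  · have h1 : HasDerivAt (fun y : ℝ => |y|) (SignType.sign x : ℝ) x := hasDerivAt_abs hx
    have h2 := (h1.rpow_const (p := p - 1) (Or.inl (abs_ne_zero.2 hx))).mul (hasDerivAt_id x)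
    refine h2.congr_deriv ?_
    have h3 : |x| ^ (p - 1) = |x| ^ (p - 1 - 1) * |x| := by
      rw [← Real.rpow_add_one (abs_ne_zero.2 hx)]; simp
    have h4 : (SignType.sign x : ℝ) * x = |x| := sign_mul_self x
    simp only [id]
    rw [h3]
    linear_combination (p - 1) * |x| ^ (p - 1 - 1) * h4

lemma hasDerivAt_abs_rpow_div (hp : 1 < p) (x : ℝ) :
    HasDerivAt (fun x => |x| ^ (p + 1) / (p + 1)) (sgnPow p x) x := by
  refine ((hasDerivAt_abs_rpow x (by linarith : 1 < p + 1)).div_const (p + 1)).congr_deriv ?_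
  rw [sgnPow, show p + 1 - 2 = p - 1 by ring]
  field_simp

/-- Continuity of homogeneous multiplicative functions, with explicit growth. -/
lemma exists_abs_sub_le_of_mul {θ : ℝ → ℝ} {s : ℝ} (hs : 0 ≤ s) (hmul : ∀ x y, θ (x * y) = θ x * θ y)
    (habs : ∀ x, |θ x| = |x| ^ s) (h1 : θ 1 = 1) (hc : ContinuousAt θ 1) {ε : ℝ} (hε : 0 < ε) :
    ∃ C, 0 ≤ C ∧ ∀ x z, |θ (x + z) - θ x| ≤ ε * |x| ^ s + C * |z| ^ s := by
  obtain ⟨δ, hδ, h⟩ := Metric.continuousAt_iff.1 hc ε hε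
  have hδ' : 0 < δ / 2 := by positivity
  -- Two regimes. If $|z|\le\frac\delta2|x|$, factoring out $x$ reduces to continuity of $\theta$ at
  -- $1$. Otherwise $|x|$ and $|x+z|$ are bounded by multiples of $|z|$, and $C$ collects the $s$-th
  -- powers of these multiples.
  refine ⟨(1 / (δ / 2) + 1) ^ s + (1 / (δ / 2)) ^ s, by positivity, fun x z => ?_⟩
  rcases le_or_gt |z| (δ / 2 * |x|) with hz | hz
  · rcases eq_or_ne x 0 with rfl | hx
    · have : z = 0 := by simpa using hz
      subst this
      simp only [add_zero, sub_self, abs_zero]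
      positivity
    · have hx' := abs_pos.2 hx
      have e : x + z = x * (1 + z / x) := by field_simp
      have hd : |θ (1 + z / x) - 1| ≤ ε := by
        have := h (x := 1 + z / x) (by
          rw [Real.dist_eq, add_sub_cancel_left, abs_div, div_lt_iff₀ hx']
          nlinarith)
        rw [Real.dist_eq, h1] at this
        exact this.le
      have : θ (x + z) - θ x = θ x * (θ (1 + z / x) - 1) := by
        rw [e, hmul]; ring
      rw [this, abs_mul, habs, mul_comm]
      have : ε * |x| ^ s ≤ ε * |x| ^ s + ((1 / (δ / 2) + 1) ^ s + (1 / (δ / 2)) ^ s) * |z| ^ s :=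
        le_add_of_nonneg_right (by positivity)
      exact (mul_le_mul_of_nonneg_right hd (by positivity)).trans this
  · have hx : |x| ≤ 1 / (δ / 2) * |z| := by
      rw [one_div, inv_mul_eq_div, le_div_iff₀ hδ']
      linarith
    have hxz : |x + z| ≤ (1 / (δ / 2) + 1) * |z| := by
      have := abs_add_le x z
      linarith
    calc |θ (x + z) - θ x| ≤ |x + z| ^ s + |x| ^ s := by
          rw [← habs, ← habs]; exact abs_sub _ _
      _ ≤ ((1 / (δ / 2) + 1) * |z|) ^ s + (1 / (δ / 2) * |z|) ^ s := by gcongr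
      _ = ((1 / (δ / 2) + 1) ^ s + (1 / (δ / 2)) ^ s) * |z| ^ s := by
          rw [Real.mul_rpow (by positivity) (abs_nonneg _),
            Real.mul_rpow (by positivity) (abs_nonneg _)]
          ring
      _ ≤ _ := le_add_of_nonneg_left (by positivity)

/-- First order Taylor estimate from a growth estimate for the derivative. -/
lemma abs_taylor_le {Θ θ : ℝ → ℝ} {s ε C : ℝ} (hs : 0 ≤ s) (hC : 0 ≤ C)
    (hd : ∀ x, HasDerivAt Θ (θ x) x)
    (h : ∀ x z, |θ (x + z) - θ x| ≤ ε * |x| ^ s + C * |z| ^ s) (x y : ℝ) :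
    |Θ (x + y) - Θ x - θ x * y| ≤ ε * (|x| ^ s * |y|) + C * (|y| ^ s * |y|) := by
  -- The mean value inequality is applied on $[0,1]$ to the segment function with its linear part at
  -- $x$ removed.
  have hD (t : ℝ) : HasDerivAt (fun t : ℝ => Θ (x + t * y) - t * (θ x * y))
      ((θ (x + t * y) - θ x) * y) t := by
    have h1 : HasDerivAt (fun t : ℝ => x + t * y) y t := by
      simpa using ((hasDerivAt_id t).mul_const y).const_add x
    have h2 := ((hd (x + t * y)).comp t h1).sub ((hasDerivAt_id t).mul_const (θ x * y))
    exact h2.congr_deriv (by ring)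
  have hb : ∀ t ∈ Icc (0 : ℝ) 1, ‖(θ (x + t * y) - θ x) * y‖ ≤
      ε * (|x| ^ s * |y|) + C * (|y| ^ s * |y|) := by
    intro t ht
    rw [norm_mul, Real.norm_eq_abs, Real.norm_eq_abs]
    have h3 : |t * y| ^ s ≤ |y| ^ s := by
      refine Real.rpow_le_rpow (abs_nonneg _) ?_ hs
      rw [abs_mul, abs_of_nonneg ht.1]
      exact mul_le_of_le_one_left (abs_nonneg _) ht.2
    have h4 := h x (t * y)
    have h5 : |θ (x + t * y) - θ x| ≤ ε * |x| ^ s + C * |y| ^ s :=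
      h4.trans (by gcongr)
    calc _ ≤ (ε * |x| ^ s + C * |y| ^ s) * |y| := by gcongr
      _ = _ := by ring
  have := Convex.norm_image_sub_le_of_norm_hasDerivWithin_le
    (fun t _ => (hD t).hasDerivWithinAt) hb (convex_Icc 0 1)
    (left_mem_Icc.2 zero_le_one) (right_mem_Icc.2 zero_le_one)
  simp only [one_mul, zero_mul, add_zero, sub_zero, norm_one, mul_one, Real.norm_eq_abs] at this
  calc _ = |Θ (x + y) - θ x * y - Θ x| := by congr 1; ring
    _ ≤ _ := this

/-- This is the form in which the Hölder estimates arrive: a term small relative to the base point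
plus a term of higher order in the increment, with `C` depending on `ε`. -/
lemma hasFDerivAt_of_remainder_le {E F : Type*} [NormedAddCommGroup E] [NormedSpace ℝ E]
    [NormedAddCommGroup F] [NormedSpace ℝ F] {Ψ : E → F} {A : E →L[ℝ] F} {v : E} {s M : ℝ}
    (hs : 0 < s) (hM : 0 ≤ M)
    (h : ∀ ε > 0, ∃ C, 0 ≤ C ∧ ∀ w, ‖Ψ (v + w) - Ψ v - A w‖ ≤ (ε * M + C * ‖w‖ ^ s) * ‖w‖) :
    HasFDerivAt Ψ A v := by
  rw [hasFDerivAt_iff_isLittleO_nhds_zero, Asymptotics.isLittleO_iff]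
  intro c hc
  -- This `ε` makes $\varepsilon M\le c/2$; adding one covers $M=0$.
  obtain ⟨C, hC, hw⟩ := h (c / (2 * (M + 1))) (by positivity)
  have ht : Tendsto (fun w : E => C * ‖w‖ ^ s) (𝓝 0) (𝓝 0) := by
    have := ((continuous_norm (E := E)).rpow_const (p := s) fun _ => Or.inr hs.le).tendsto 0
    rw [norm_zero, Real.zero_rpow hs.ne'] at this
    simpa using this.const_mul C
  filter_upwards [ht.eventually (gt_mem_nhds (by positivity : 0 < c / 2))] with w hw'
  refine (hw w).trans ?_
  gcongr
  have : c / (2 * (M + 1)) * M ≤ c / 2 := by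
    rw [div_mul_eq_mul_div, div_le_div_iff₀ (by positivity) (by positivity)]
    nlinarith
  linarith

lemma integrable_and_integral_rpow_mul_le (hp : 0 ≤ p) (a b : Lp ℝ (expL p) μ) :
    Integrable (fun x => |a x| ^ p * |b x|) μ ∧ ∫ x, |a x| ^ p * |b x| ∂μ ≤ ‖a‖ ^ p * ‖b‖ := by
  simpa using integrable_and_integral_rpow_mul_three_le hp hp zero_le_one le_rfl (by ring) a b b

lemma integrable_and_integral_rpow_sub_one_mul_le (hp : 1 ≤ p) (a b c : Lp ℝ (expL p) μ) :
    Integrable (fun x => |a x| ^ (p - 1) * |b x| * |c x|) μ ∧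
      ∫ x, |a x| ^ (p - 1) * |b x| * |c x| ∂μ ≤ ‖a‖ ^ (p - 1) * ‖b‖ * ‖c‖ := by
  simpa using integrable_and_integral_rpow_mul_three_le (by linarith : 0 ≤ p)
    (by linarith : 0 ≤ p - 1) zero_le_one zero_le_one (by ring) a b c

lemma integrable_abs_rpow_Lp (hp : 0 ≤ p) (a : Lp ℝ (expL p) μ) :
    Integrable (fun x => |a x| ^ (p + 1)) μ := by
  simpa using (integrable_and_integral_rpow_mul_three_le hp (by linarith : 0 ≤ p + 1) le_rfl le_rfl
    (by ring) a a a).1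

lemma aemeasurable_Lp (a : Lp ℝ (expL p) μ) : AEMeasurable a μ :=
  (Lp.aestronglyMeasurable a).aemeasurable

lemma integrable_sgnPow_mul (hp : 1 < p) (a b : Lp ℝ (expL p) μ) :
    Integrable (fun x => sgnPow p (a x) * b x) μ := by
  refine (integrable_and_integral_rpow_mul_le (by linarith) a b).1.mono' ?_ ?_
  · exact (((continuous_sgnPow hp.le).measurable.comp_aemeasurable (aemeasurable_Lp a)).mul
      (aemeasurable_Lp b)).aestronglyMeasurable
  · refine Eventually.of_forall fun x => ?_
    rw [norm_mul, Real.norm_eq_abs, Real.norm_eq_abs, abs_sgnPow (by linarith)]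

lemma integrable_rpow_mul_mul (hp : 1 < p) (a b c : Lp ℝ (expL p) μ) :
    Integrable (fun x => |a x| ^ (p - 1) * b x * c x) μ := by
  refine (integrable_and_integral_rpow_sub_one_mul_le hp.le a b c).1.mono' ?_ ?_
  · exact ((((aemeasurable_Lp a).abs.pow_const _).mul (aemeasurable_Lp b)).mul
      (aemeasurable_Lp c)).aestronglyMeasurable
  · refine Eventually.of_forall fun x => ?_
    rw [norm_mul, norm_mul, Real.norm_eq_abs, Real.norm_eq_abs, Real.norm_eq_abs,
      abs_of_nonneg (Real.rpow_nonneg (abs_nonneg _) _)]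

/-- The first derivative of `v ↦ ∫ |v|^{p+1} / (p+1)`. -/
def powD (hp : 1 < p) (v : Lp ℝ (expL p) μ) : Lp ℝ (expL p) μ →L[ℝ] ℝ :=
  LinearMap.mkContinuous
    { toFun := fun k => ∫ x, sgnPow p (v x) * k x ∂μ
      map_add' := fun k l => by
        rw [← integral_add (integrable_sgnPow_mul hp v k) (integrable_sgnPow_mul hp v l)]
        refine integral_congr_ae ?_
        filter_upwards [Lp.coeFn_add k l] with x hx
        rw [hx, Pi.add_apply, mul_add]
      map_smul' := fun c k => by
        rw [RingHom.id_apply, smul_eq_mul, ← integral_const_mul]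
        refine integral_congr_ae ?_
        filter_upwards [Lp.coeFn_smul c k] with x hx
        rw [hx, Pi.smul_apply, smul_eq_mul]
        ring } (‖v‖ ^ p) fun k => by
      refine (norm_integral_le_integral_norm _).trans ?_
      simp only [norm_mul, Real.norm_eq_abs, abs_sgnPow (zero_lt_one.trans hp)]
      exact (integrable_and_integral_rpow_mul_le (by linarith) v k).2

lemma powD_apply (hp : 1 < p) (v k : Lp ℝ (expL p) μ) :
    powD hp v k = ∫ x, sgnPow p (v x) * k x ∂μ := rfl

/-- The second derivative of `v ↦ ∫ |v|^{p+1} / (p+1)`. -/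
def powD2 (hp : 1 < p) (v : Lp ℝ (expL p) μ) : Lp ℝ (expL p) μ →L[ℝ] Lp ℝ (expL p) μ →L[ℝ] ℝ :=
  LinearMap.mkContinuous₂
    (LinearMap.mk₂ ℝ (fun w k : Lp ℝ (expL p) μ => p * ∫ x, |v x| ^ (p - 1) * w x * k x ∂μ)
      (fun w w' k => by
        rw [← mul_add, ← integral_add (integrable_rpow_mul_mul hp v w k)
          (integrable_rpow_mul_mul hp v w' k)]
        congr 1
        refine integral_congr_ae ?_
        filter_upwards [Lp.coeFn_add w w'] with x hx
        rw [hx, Pi.add_apply]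
        ring)
      (fun c w k => by
        rw [smul_eq_mul, mul_left_comm c p, ← integral_const_mul c]
        congr 1
        refine integral_congr_ae ?_
        filter_upwards [Lp.coeFn_smul c w] with x hx
        rw [hx, Pi.smul_apply, smul_eq_mul]
        ring)
      (fun w k k' => by
        rw [← mul_add, ← integral_add (integrable_rpow_mul_mul hp v w k)
          (integrable_rpow_mul_mul hp v w k')]
        congr 1
        refine integral_congr_ae ?_
        filter_upwards [Lp.coeFn_add k k'] with x hx
        rw [hx, Pi.add_apply]
        ring)
      (fun c w k => by
        rw [smul_eq_mul, mul_left_comm c p, ← integral_const_mul c]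
        congr 1
        refine integral_congr_ae ?_
        filter_upwards [Lp.coeFn_smul c k] with x hx
        rw [hx, Pi.smul_apply, smul_eq_mul]
        ring))
    (p * ‖v‖ ^ (p - 1)) fun w k => by
      rw [LinearMap.mk₂_apply, norm_mul, Real.norm_of_nonneg (by linarith : 0 ≤ p), mul_assoc,
        mul_assoc, ← mul_assoc (‖v‖ ^ (p - 1))]
      gcongr
      refine (norm_integral_le_integral_norm _).trans ?_
      simp only [norm_mul, Real.norm_eq_abs, abs_of_nonneg (Real.rpow_nonneg (abs_nonneg _) _)]
      exact (integrable_and_integral_rpow_sub_one_mul_le hp.le v w k).2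

lemma powD2_apply (hp : 1 < p) (v w k : Lp ℝ (expL p) μ) :
    powD2 hp v w k = p * ∫ x, |v x| ^ (p - 1) * w x * k x ∂μ := rfl

/-- The function $|x|^{p-1}$ is multiplicative and continuous at $1$, so the homogeneous estimate
applies with $\varepsilon/p$ to absorb the factor $p$. -/
lemma exists_abs_rpow_sub_le (hp : 1 < p) {ε : ℝ} (hε : 0 < ε) :
    ∃ C, 0 ≤ C ∧ ∀ x z : ℝ, |(p * |x + z| ^ (p - 1)) - p * |x| ^ (p - 1)| ≤
      ε * |x| ^ (p - 1) + C * |z| ^ (p - 1) := by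
  have hp1 : 0 ≤ p - 1 := by linarith
  have hp0 : 0 < p := by linarith
  obtain ⟨C, hC, h⟩ := exists_abs_sub_le_of_mul (θ := fun x => |x| ^ (p - 1)) hp1
    (fun x y => by rw [abs_mul, Real.mul_rpow (abs_nonneg _) (abs_nonneg _)])
    (fun x => abs_of_nonneg (by positivity)) (by simp)
    (continuous_abs_rpow hp1).continuousAt (div_pos hε hp0)
  refine ⟨p * C, by positivity, fun x z => ?_⟩
  rw [← mul_sub, abs_mul, abs_of_pos hp0]
  calc _ ≤ p * (ε / p * |x| ^ (p - 1) + C * |z| ^ (p - 1)) := by gcongr; exact h x z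
    _ = _ := by field_simp

lemma exists_abs_sgnPow_sub_le (hp : 1 < p) {ε : ℝ} (hε : 0 < ε) :
    ∃ C, 0 ≤ C ∧ ∀ x z : ℝ, |sgnPow p (x + z) - sgnPow p x| ≤ ε * |x| ^ p + C * |z| ^ p :=
  exists_abs_sub_le_of_mul (by linarith) sgnPow_mul (abs_sgnPow (by linarith))
    (by simp [sgnPow]) (continuous_sgnPow hp.le).continuousAt hε

/-- The pointwise remainder is at most $\varepsilon|v|^p|w|+C|w|^p|w|$, and Hölder's inequality
turns the two terms into $\varepsilon\|v\|^p\|w\|$ and $C\|w\|^p\|w\|$. -/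
lemma hasFDerivAt_powInt (hp : 1 < p) (v : Lp ℝ (expL p) μ) :
    HasFDerivAt (fun v : Lp ℝ (expL p) μ => ∫ x, |v x| ^ (p + 1) / (p + 1) ∂μ) (powD hp v) v := by
  have hp0 : 0 ≤ p := by linarith
  refine hasFDerivAt_of_remainder_le (s := p) (M := ‖v‖ ^ p) (by linarith) (by positivity)
    fun ε hε => ?_
  obtain ⟨C, hC, h⟩ := exists_abs_sgnPow_sub_le hp hε
  refine ⟨C, hC, fun w => ?_⟩
  have h' := abs_taylor_le hp0 hC (hasDerivAt_abs_rpow_div hp) h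
  have i1 := integrable_and_integral_rpow_mul_le hp0 v w
  have i2 := integrable_and_integral_rpow_mul_le hp0 w w
  have hi (u : Lp ℝ (expL p) μ) := (integrable_abs_rpow_Lp hp0 u).div_const (p + 1)
  have his : Integrable (fun x => |(v + w) x| ^ (p + 1) / (p + 1) - |v x| ^ (p + 1) / (p + 1)) μ :=
    (hi _).sub (hi _)
  rw [powD_apply, ← integral_sub (hi _) (hi _), ← integral_sub his (integrable_sgnPow_mul hp v w)]
  refine (norm_integral_le_of_norm_le ((i1.1.const_mul ε).add (i2.1.const_mul C)) ?_).trans ?_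
  · filter_upwards [Lp.coeFn_add v w] with x hx
    rw [hx]
    exact h' (v x) (w x)
  · simp only [Pi.add_apply]
    rw [integral_add (i1.1.const_mul ε) (i2.1.const_mul C), integral_const_mul, integral_const_mul]
    have := mul_le_mul_of_nonneg_left i1.2 hε.le
    have := mul_le_mul_of_nonneg_left i2.2 hC
    linarith

/-- Same scheme one order higher. The direction $k$ enters linearly, so the bound is for the
operator norm, and the remainder exponent $p-1>0$ is where $p>1$ matters. -/
lemma hasFDerivAt_powD (hp : 1 < p) (v : Lp ℝ (expL p) μ) :
    HasFDerivAt (powD hp) (powD2 hp v) v := by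
  refine hasFDerivAt_of_remainder_le (s := p - 1) (M := ‖v‖ ^ (p - 1)) (by linarith)
    (by positivity) fun ε hε => ?_
  obtain ⟨C, hC, h⟩ := exists_abs_rpow_sub_le hp hε
  refine ⟨C, hC, fun w => ?_⟩
  have h' := abs_taylor_le (by linarith) hC (hasDerivAt_sgnPow hp) h
  refine ContinuousLinearMap.opNorm_le_bound _ (by positivity) fun k => ?_
  have i1 := integrable_and_integral_rpow_sub_one_mul_le hp.le v w k
  have i2 := integrable_and_integral_rpow_sub_one_mul_le hp.le w w k
  have his : Integrable (fun x => sgnPow p ((v + w) x) * k x - sgnPow p (v x) * k x) μ :=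
    (integrable_sgnPow_mul hp _ k).sub (integrable_sgnPow_mul hp _ k)
  rw [sub_apply, sub_apply, powD_apply, powD_apply,
    powD2_apply, ← integral_const_mul, ← integral_sub (integrable_sgnPow_mul hp _ k)
    (integrable_sgnPow_mul hp _ k), ← integral_sub his ((integrable_rpow_mul_mul hp v w k).const_mul p)]
  refine (norm_integral_le_of_norm_le ((i1.1.const_mul ε).add (i2.1.const_mul C)) ?_).trans ?_
  · filter_upwards [Lp.coeFn_add v w] with x hx
    rw [hx, Pi.add_apply, Real.norm_eq_abs]
    calc _ = |sgnPow p (v x + w x) - sgnPow p (v x) - p * |v x| ^ (p - 1) * w x| * |k x| := by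
          rw [← abs_mul]; congr 1; ring
      _ ≤ (ε * (|v x| ^ (p - 1) * |w x|) + C * (|w x| ^ (p - 1) * |w x|)) * |k x| := by
          gcongr
          exact h' (v x) (w x)
      _ = _ := by simp only [Pi.add_apply]; ring
  · simp only [Pi.add_apply]
    rw [integral_add (i1.1.const_mul ε) (i2.1.const_mul C), integral_const_mul, integral_const_mul]
    have := mul_le_mul_of_nonneg_left i1.2 hε.le
    have := mul_le_mul_of_nonneg_left i2.2 hC
    linarith

/-- The difference of the second derivatives at $u$ and $v$ is at most
$\varepsilon\|v\|^{p-1}+C\|u-v\|^{p-1}$ in norm. No Lipschitz bound is needed, so $p<2$ is covered.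
-/
lemma continuous_powD2 (hp : 1 < p) :
    Continuous (powD2 hp : Lp ℝ (expL p) μ → Lp ℝ (expL p) μ →L[ℝ] Lp ℝ (expL p) μ →L[ℝ] ℝ) := by
  rw [continuous_iff_continuousAt]
  intro v
  refine (tendsto_iff_norm_sub_tendsto_zero
    (E := Lp ℝ (expL p) μ →L[ℝ] Lp ℝ (expL p) μ →L[ℝ] ℝ)).2 ?_
  have hp1 : 0 < p - 1 := by linarith
  rw [Metric.tendsto_nhds]
  intro η hη
  obtain ⟨C, hC, h⟩ := exists_abs_rpow_sub_le hp
    (ε := η / (2 * (‖v‖ ^ (p - 1) + 1))) (by positivity)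
  have ht : Tendsto (fun u => C * ‖u - v‖ ^ (p - 1)) (𝓝 v) (𝓝 0) := by
    have := (((continuous_id.sub continuous_const).norm.rpow_const (p := p - 1)
      fun _ => Or.inr hp1.le).tendsto v : Tendsto (fun u => ‖u - v‖ ^ (p - 1)) (𝓝 v) _)
    rw [Pi.sub_apply, id, sub_self, norm_zero, Real.zero_rpow hp1.ne'] at this
    simpa using this.const_mul C
  filter_upwards [ht.eventually (gt_mem_nhds (by positivity : 0 < η / 2))] with u hu
  rw [Real.dist_eq, sub_zero]
  refine (abs_of_nonneg (ContinuousLinearMap.opNorm_nonneg _)).trans_lt ?_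
  set ε := η / (2 * (‖v‖ ^ (p - 1) + 1)) with hεdef
  have hε : 0 ≤ ε := by positivity
  have hb : ‖powD2 hp u - powD2 hp v‖ ≤ ε * ‖v‖ ^ (p - 1) + C * ‖u - v‖ ^ (p - 1) := by
    refine ContinuousLinearMap.opNorm_le_bound _ (by positivity) fun w => ?_
    refine ContinuousLinearMap.opNorm_le_bound _ (by positivity) fun k => ?_
    have i1 := integrable_and_integral_rpow_sub_one_mul_le hp.le v w k
    have i2 := integrable_and_integral_rpow_sub_one_mul_le hp.le (u - v) w k
    rw [sub_apply, sub_apply, powD2_apply, powD2_apply,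
      ← integral_const_mul, ← integral_const_mul,
      ← integral_sub ((integrable_rpow_mul_mul hp _ w k).const_mul p)
      ((integrable_rpow_mul_mul hp _ w k).const_mul p)]
    refine (norm_integral_le_of_norm_le ((i1.1.const_mul ε).add (i2.1.const_mul C)) ?_).trans ?_
    · filter_upwards [Lp.coeFn_sub u v] with x hx
      have h2 := h (v x) (u x - v x)
      rw [add_sub_cancel] at h2
      simp only [Pi.add_apply, hx, Pi.sub_apply, Real.norm_eq_abs]
      calc _ = |p * |u x| ^ (p - 1) - p * |v x| ^ (p - 1)| * (|w x| * |k x|) := by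
            rw [← abs_mul (w x), ← abs_mul]; congr 1; ring
        _ ≤ (ε * |v x| ^ (p - 1) + C * |u x - v x| ^ (p - 1)) * (|w x| * |k x|) := by gcongr
        _ = _ := by ring
    · simp only [Pi.add_apply]
      rw [integral_add (i1.1.const_mul ε) (i2.1.const_mul C), integral_const_mul,
        integral_const_mul]
      have := mul_le_mul_of_nonneg_left i1.2 hε
      have := mul_le_mul_of_nonneg_left i2.2 hC
      linarith
  have : ε * ‖v‖ ^ (p - 1) ≤ η / 2 := by
    rw [hεdef, div_mul_eq_mul_div, div_le_div_iff₀ (by positivity) (by positivity)]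
    nlinarith [Real.rpow_nonneg (norm_nonneg v) (p - 1)]
  linarith

lemma contDiff_one_powD (hp : 1 < p) :
    ContDiff ℝ 1 (powD hp : Lp ℝ (expL p) μ → Lp ℝ (expL p) μ →L[ℝ] ℝ) := by
  refine contDiff_one_iff_fderiv.2 ⟨fun v => (hasFDerivAt_powD hp v).differentiableAt, ?_⟩
  rw [show fderiv ℝ (powD hp : Lp ℝ (expL p) μ → _) = powD2 hp from
    funext fun v => (hasFDerivAt_powD hp v).fderiv]
  exact continuous_powD2 hp

end Power

/-! ### Densities on the line -/

section Density

variable {d : ℝ → ℝ}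

lemma integrable_withDensity_ofReal_iff (hm : Measurable d) (h0 : ∀ᵐ x, 0 ≤ d x) {F : ℝ → ℝ} :
    Integrable F (volume.withDensity fun x => ENNReal.ofReal (d x)) ↔
      Integrable fun x => d x * F x := by
  rw [integrable_withDensity_iff_integrable_smul' hm.ennreal_ofReal
    (Eventually.of_forall fun _ => ENNReal.ofReal_lt_top)]
  refine integrable_congr ?_
  filter_upwards [h0] with x hx
  rw [ENNReal.toReal_ofReal hx, smul_eq_mul]

lemma integral_withDensity_ofReal (hm : Measurable d) (h0 : ∀ᵐ x, 0 ≤ d x) (F : ℝ → ℝ) :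
    ∫ x, F x ∂(volume.withDensity fun x => ENNReal.ofReal (d x)) = ∫ x, d x * F x := by
  rw [integral_withDensity_eq_integral_toReal_smul hm.ennreal_ofReal
    (Eventually.of_forall fun _ => ENNReal.ofReal_lt_top)]
  refine integral_congr_ae ?_
  filter_upwards [h0] with x hx
  rw [ENNReal.toReal_ofReal hx, smul_eq_mul]

lemma isLocallyFiniteMeasure_withDensity_ofReal (hl : LocallyIntegrable d) :
    IsLocallyFiniteMeasure (volume.withDensity fun x => ENNReal.ofReal (d x)) := by
  refine ⟨fun x => ?_⟩
  obtain ⟨s, hs, hi⟩ := hl x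
  obtain ⟨t, hts, ht, hxt⟩ := mem_nhds_iff.1 hs
  refine ⟨t, ht.mem_nhds hxt, ?_⟩
  rw [withDensity_apply _ ht.measurableSet]
  exact (hi.mono_set hts).lintegral_lt_top

/-- Pairing with a compactly supported continuous function is continuous on a weighted `L^q`. -/
lemma exists_clm_integral_mul {q : ℝ≥0∞} [Fact (1 ≤ q)] (hm : Measurable d) (h0 : ∀ᵐ x, 0 ≤ d x)
    (hl : LocallyIntegrable d) (hlow : ∀ M : ℝ, ∃ c > 0, ∀ᵐ x, |x| ≤ M → c ≤ d x) {η : ℝ → ℝ}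
    (hη : Continuous η) (hηc : HasCompactSupport η) :
    ∃ T : Lp ℝ q (volume.withDensity fun x => ENNReal.ofReal (d x)) →L[ℝ] ℝ,
      ∀ v, Integrable (fun x => v x * η x) ∧ T v = ∫ x, v x * η x := by
  set ν := volume.withDensity fun x => ENNReal.ofReal (d x) with hν
  have := isLocallyFiniteMeasure_withDensity_ofReal hl
  obtain ⟨M, hM⟩ := hηc.isCompact.isBounded.exists_norm_le
  obtain ⟨c, hc, hcd⟩ := hlow M
  obtain ⟨C, hC⟩ := hη.bounded_above_of_compact_support hηc
  have hsupp (x : ℝ) (hx : η x ≠ 0) : |x| ≤ M := hM x (subset_tsupport _ hx)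
  -- Integrating against Lebesgue measure is pairing with $\eta/d$ in the weighted measure. This
  -- quotient lies in the conjugate space because $d$ is bounded below on the support of $\eta$.
  have hmem : MemLp (fun x => η x / d x) (ENNReal.conjExponent q) ν := by
    refine MemLp.mono' (g := (Icc (-M) M).indicator fun _ => C / c)
      (memLp_indicator_const _ measurableSet_Icc _
        (Or.inr isCompact_Icc.measure_lt_top.ne)) ?_ ?_
    · exact (hη.measurable.div hm).aestronglyMeasurable
    · refine (withDensity_absolutelyContinuous volume _).ae_le ?_
      filter_upwards [hcd] with x hx
      by_cases hηx : η x = 0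
      · rw [hηx, zero_div, norm_zero]
        refine indicator_nonneg (fun _ _ => ?_) _
        exact div_nonneg ((norm_nonneg _).trans (hC 0)) hc.le
      · have hxM := hsupp x hηx
        rw [indicator_of_mem (mem_Icc.2 (abs_le.1 hxM)), norm_div]
        have := hx hxM
        rw [Real.norm_of_nonneg (hc.le.trans this)]
        exact div_le_div₀ ((norm_nonneg _).trans (hC 0)) (hC x) hc this
  have hcongr (v : ℝ → ℝ) : (fun x => d x * (v x * (η x / d x))) =ᵐ[volume] fun x => v x * η x := by
    filter_upwards [hcd] with x hx
    by_cases hηx : η x = 0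
    · simp [hηx]
    · have := (hc.trans_le (hx (hsupp x hηx))).ne'
      field_simp
  have : Fact (1 ≤ q.conjExponent) := ⟨by rw [ENNReal.conjExponent]; exact le_self_add⟩
  refine ⟨((ContinuousLinearMap.mul ℝ ℝ).lpPairing ν q (ENNReal.conjExponent q)).flip hmem.toLp,
    fun v => ⟨?_, ?_⟩⟩
  · rw [← integrable_congr (hcongr v), ← integrable_withDensity_ofReal_iff hm h0]
    exact (Lp.memLp v).integrable_mul hmem
  · rw [ContinuousLinearMap.flip_apply, ContinuousLinearMap.lpPairing_eq_integral,
      ← integral_congr_ae (hcongr v), ← integral_withDensity_ofReal hm h0]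
    refine integral_congr_ae ?_
    filter_upwards [hmem.coeFn_toLp] with x hx
    rw [ContinuousLinearMap.mul_apply', hx]

lemma locallyIntegrable_of_forall_integrable_mul {v : ℝ → ℝ}
    (h : ∀ η : ℝ → ℝ, IsTest η → Integrable fun x => v x * η x) : LocallyIntegrable v := by
  intro x
  let b : ContDiffBump x := ⟨1, 2, one_pos, one_lt_two⟩
  refine ⟨Metric.closedBall x 1, Metric.closedBall_mem_nhds x one_pos, ?_⟩
  refine (h b ⟨b.contDiff, b.hasCompactSupport⟩).integrableOn.congr_fun (fun y hy => ?_)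
    Metric.isClosed_closedBall.measurableSet
  simp only [b.one_of_mem_closedBall hy, mul_one]

/-- Integrability near the origin and continuity away from it give integrability on $(0,M]$;
reflection gives the negative side. -/
lemma integrableOn_comp_abs {k : ℝ → ℝ} (hk : ContinuousOn k (Ioi 0)) {R : ℝ} (hR : 0 < R)
    (hi : IntegrableOn k (Ioo 0 R)) (M : ℝ) : IntegrableOn (fun x => k |x|) (Icc (-M) M) := by
  rcases lt_or_ge M 0 with hM | hM
  · rw [Icc_eq_empty (by linarith)]; exact integrableOn_empty
  have h1 : IntegrableOn k (Ioc 0 M) := by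
    refine IntegrableOn.mono_set (hi.union ((hk.mono ?_).integrableOn_Icc (a := R) (b := M))) ?_
    · exact fun x hx => hR.trans_le hx.1
    · intro x hx
      rcases lt_or_ge x R with h | h
      · exact Or.inl ⟨hx.1, h⟩
      · exact Or.inr ⟨h, hx.2⟩
  have h2 : IntegrableOn (fun x => k |x|) (Icc 0 M) := by
    rw [integrableOn_Icc_iff_integrableOn_Ioc]
    exact h1.congr_fun (fun x hx => by simp only [abs_of_pos hx.1]) measurableSet_Ioc
  have h3 : IntegrableOn (fun x => k |x|) (Icc (-M) 0) := by
    rw [← Measure.map_neg_eq_self (volume : Measure ℝ),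
      show Measure.map Neg.neg (volume : Measure ℝ) = Measure.map (Homeomorph.neg ℝ) volume from rfl,
      (Homeomorph.neg ℝ).measurableEmbedding.integrableOn_map_iff]
    refine (h2.congr_fun (fun x _ => ?_) measurableSet_Icc).mono_set ?_
    · simp
    · intro x hx
      simp only [Homeomorph.coe_neg, mem_preimage, mem_Icc] at hx
      constructor <;> linarith [hx.1, hx.2]
  refine (h3.union h2).mono_set fun x hx => ?_
  rcases le_total x 0 with h | h
  · exact Or.inl ⟨hx.1, h⟩
  · exact Or.inr ⟨h, hx.2⟩

lemma locallyIntegrable_of_integrableOn_Icc {k : ℝ → ℝ}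
    (h : ∀ M, IntegrableOn k (Icc (-M) M)) : LocallyIntegrable k := by
  rw [locallyIntegrable_iff]
  intro K hK
  obtain ⟨M, hM⟩ := hK.isBounded.exists_norm_le
  exact (h M).mono_set fun x hx => abs_le.1 (hM x hx)

lemma continuousOn_comp_abs {k : ℝ → ℝ} (hk : ContinuousOn k (Ioi 0)) :
    ContinuousOn (fun x => k |x|) {0}ᶜ :=
  hk.comp continuous_abs.continuousOn fun _ hx => abs_pos.2 hx

lemma measurable_comp_abs {k : ℝ → ℝ} (hk : ContinuousOn k (Ioi 0)) :
    Measurable fun x => k |x| :=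
  measurable_of_continuousOn_compl_singleton 0 (continuousOn_comp_abs hk)

lemma ae_ne_zero : ∀ᵐ x : ℝ, x ≠ 0 := Measure.ae_ne volume 0

end Density

/-! ### Consequences of the assumptions on the coefficients -/

/-- The properties of the coefficients that are used to set up the function spaces. -/
structure CoeffFacts (f g h : ℝ → ℝ) : Prop where
  f_pos : ∀ r, 0 < r → 0 < f r
  h_pos : ∀ r, 0 < r → 0 < h r
  f_cont : ContinuousOn f (Ioi 0)
  g_cont : ContinuousOn g (Ioi 0)
  h_cont : ContinuousOn h (Ioi 0)
  f_mono : MonotoneOn f (Ioi 0)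
  g_mono : MonotoneOn g (Ioi 0)
  h_anti : AntitoneOn h (Ioi 0)
  f_low : ∃ m, 0 < m ∧ ∀ r, 0 < r → m ≤ f r
  int_g : ∀ M : ℝ, IntegrableOn (fun x => |g (|x|)| * rho f |x|) (Icc (-M) M)
  int_h : ∀ M : ℝ, IntegrableOn (fun x => h |x| * rho f |x|) (Icc (-M) M)

lemma CoeffReg.differentiableAt {f g h : ℝ → ℝ} (h1 : CoeffReg f g h) {r : ℝ} (hr : 0 < r) :
    DifferentiableAt ℝ f r ∧ DifferentiableAt ℝ (deriv f) r ∧ DifferentiableAt ℝ g r ∧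
      DifferentiableAt ℝ h r := by
  have hn : Ioi (0 : ℝ) ∈ 𝓝 r := Ioi_mem_nhds hr
  refine ⟨(h1.1.contDiffAt hn).differentiableAt (by norm_num), ?_,
    (h1.2.2.1.contDiffAt hn).differentiableAt (by norm_num),
    (h1.2.1.contDiffAt hn).differentiableAt (by norm_num)⟩
  have h2 : ContDiffOn ℝ 2 (deriv f) (Ioi 0) :=
    ((contDiffOn_succ_iff_deriv_of_isOpen (n := 2) isOpen_Ioi).1 (by
      have := h1.1; norm_num; exact this)).2.2
  exact (h2.contDiffAt hn).differentiableAt (by norm_num)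

lemma deriv_log_rho {f g h : ℝ → ℝ} (h1 : CoeffReg f g h) {r : ℝ} (hr : 0 < r) :
    deriv (fun s => Real.log (rho f s)) r = deriv f r / f r := by
  have hf := ((h1.differentiableAt hr).1.hasDerivAt.div_const 2).log
    (div_pos (h1.2.2.2 r hr).1 two_pos).ne'
  refine (HasDerivAt.deriv hf).trans ?_
  field_simp

lemma deriv_deriv_log_rho {f g h : ℝ → ℝ} (h1 : CoeffReg f g h) {r : ℝ} (hr : 0 < r) :
    deriv (deriv fun s => Real.log (rho f s)) r =
      (deriv (deriv f) r * f r - deriv f r * deriv f r) / f r ^ 2 := by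
  have e : (deriv fun s => Real.log (rho f s)) =ᶠ[𝓝 r] fun s => deriv f s / f s := by
    filter_upwards [Ioi_mem_nhds hr] with s hs using deriv_log_rho h1 hs
  rw [e.deriv_eq]
  exact ((h1.differentiableAt hr).2.1.hasDerivAt.div (h1.differentiableAt hr).1.hasDerivAt
    (h1.2.2.2 r hr).1.ne').deriv

/-- Log-convexity of $\rho$ in the form used below: the logarithmic derivative $f'/f$ is
nondecreasing. -/
lemma monotoneOn_deriv_div {f g h : ℝ → ℝ} (h1 : CoeffReg f g h) (h11 : CoeffMono f g h) :
    MonotoneOn (fun r => deriv f r / f r) (Ioi 0) := by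
  have hd (r : ℝ) (hr : 0 < r) := (h1.differentiableAt hr).2.1.hasDerivAt.div
    (h1.differentiableAt hr).1.hasDerivAt (h1.2.2.2 r hr).1.ne'
  refine monotoneOn_of_deriv_nonneg (convex_Ioi 0)
    (fun r hr => (hd r hr).continuousAt.continuousWithinAt)
    (fun r hr => (hd r (by simpa using hr)).differentiableAt.differentiableWithinAt) ?_
  intro r hr
  rw [interior_Ioi] at hr
  have := h11.2.1 r hr
  rw [deriv_deriv_log_rho h1 hr] at this
  exact (hd r hr).deriv ▸ this

lemma monotoneOn_Ioi_of_deriv {k : ℝ → ℝ} (hd : ∀ r, 0 < r → DifferentiableAt ℝ k r)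
    (h : ∀ r, 0 < r → 0 ≤ deriv k r) : MonotoneOn k (Ioi 0) :=
  monotoneOn_of_deriv_nonneg (convex_Ioi 0) (fun r hr => (hd r hr).continuousAt.continuousWithinAt)
    (fun r hr => (hd r (by simpa using hr)).differentiableWithinAt)
    (fun r hr => h r (by simpa using hr))

/-- Log-convexity keeps $f$ away from $0$ at the origin: on $(0,1]$, $f'/f\le K:=f'(1)/f(1)$, so
$f(s)e^{-Ks}$ is nonincreasing there and $f(r)\ge f(1)e^{-K}$. Beyond $1$, $f$ is nondecreasing. -/
lemma exists_pos_le_of_log_convex {f g h : ℝ → ℝ} (h1 : CoeffReg f g h) (h11 : CoeffMono f g h) :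
    ∃ m, 0 < m ∧ ∀ r, 0 < r → m ≤ f r := by
  have hmono := monotoneOn_Ioi_of_deriv (fun r hr => (h1.differentiableAt hr).1) h11.1
  have hf1 := (h1.2.2.2 1 one_pos).1
  set K := deriv f 1 / f 1 with hK
  refine ⟨f 1 * Real.exp (-K), by positivity, fun r hr => ?_⟩
  have hK0 : 0 ≤ K := div_nonneg (h11.1 1 one_pos) hf1.le
  rcases le_or_gt 1 r with h | h
  · have h2 := hmono (mem_Ioi.2 one_pos) hr h
    have h3 : Real.exp (-K) ≤ 1 := Real.exp_le_one_iff.2 (by linarith)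
    nlinarith
  · have hd (s : ℝ) (hs : 0 < s) : HasDerivAt (fun s => f s * Real.exp (-(K * s)))
        (deriv f s * Real.exp (-(K * s)) + f s * (Real.exp (-(K * s)) * -K)) s := by
      have h4 : HasDerivAt (fun s => -(K * s)) (-K) s :=
        ((hasDerivAt_id' s).const_mul K).fun_neg.congr_deriv (by simp)
      exact (h1.differentiableAt hs).1.hasDerivAt.mul h4.exp
    have hanti : AntitoneOn (fun s => f s * Real.exp (-(K * s))) (Icc r 1) := by
      refine antitoneOn_of_deriv_nonpos (convex_Icc r 1)
        (fun s hs => (hd s (hr.trans_le hs.1)).continuousAt.continuousWithinAt) ?_ ?_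
      · intro s hs
        rw [interior_Icc] at hs
        exact (hd s (hr.trans hs.1)).differentiableAt.differentiableWithinAt
      · intro s hs
        rw [interior_Icc] at hs
        have hs0 := hr.trans hs.1
        rw [(hd s hs0).deriv]
        have h5 : deriv f s / f s ≤ K :=
          monotoneOn_deriv_div h1 h11 hs0 (mem_Ioi.2 one_pos) hs.2.le
        rw [div_le_iff₀ (h1.2.2.2 s hs0).1] at h5
        have := Real.exp_pos (-(K * s))
        nlinarith
    have h6 := hanti (left_mem_Icc.2 h.le) (right_mem_Icc.2 h.le) h.le
    simp only [mul_one] at h6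
    refine h6.trans (mul_le_of_le_one_right (h1.2.2.2 r hr).1.le ?_)
    exact Real.exp_le_one_iff.2 (by nlinarith)

lemma coeffFacts {f g h : ℝ → ℝ} (h1 : CoeffReg f g h) (h2 : OriginIntegrable f g h)
    (h11 : CoeffMono f g h) : CoeffFacts f g h := by
  have hfc : ContinuousOn f (Ioi 0) := h1.1.continuousOn
  have hhc : ContinuousOn h (Ioi 0) := h1.2.1.continuousOn
  have hgc : ContinuousOn g (Ioi 0) := h1.2.2.1.continuousOn
  obtain ⟨R, hR, hi, -⟩ := h2
  have hρ : ContinuousOn (rho f) (Ioi 0) := hfc.div_const 2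
  refine ⟨fun r hr => (h1.2.2.2 r hr).1, fun r hr => (h1.2.2.2 r hr).2, hfc, hgc, hhc,
    monotoneOn_Ioi_of_deriv (fun r hr => (h1.differentiableAt hr).1) h11.1,
    monotoneOn_Ioi_of_deriv (fun r hr => (h1.differentiableAt hr).2.2.1) h11.2.2.1, ?_,
    exists_pos_le_of_log_convex h1 h11, ?_, ?_⟩
  · have := monotoneOn_Ioi_of_deriv (k := -h)
      (fun r hr => (h1.differentiableAt hr).2.2.2.neg) (fun r hr => by
        rw [deriv.neg]; simpa using h11.2.2.2.1 r hr)
    simpa using this.neg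
  · refine integrableOn_comp_abs (k := fun r => |g r| * rho f r) (hgc.abs.mul hρ) hR ?_
    refine Integrable.mono' hi (((hgc.abs.mul hρ).mono fun x hx => hx.1).aestronglyMeasurable
      measurableSet_Ioo) ?_
    filter_upwards [ae_restrict_mem measurableSet_Ioo] with r hr
    obtain ⟨a, b⟩ := h1.2.2.2 r hr.1
    rw [norm_mul, norm_abs_eq_norm, Real.norm_eq_abs, Real.norm_eq_abs, rho,
      abs_of_pos (half_pos a)]
    nlinarith [abs_nonneg (g r), mul_nonneg a.le (abs_nonneg (g r)), mul_pos a b]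
  · refine integrableOn_comp_abs (k := fun r => h r * rho f r) (hhc.mul hρ) hR ?_
    refine Integrable.mono' hi (((hhc.mul hρ).mono fun x hx => hx.1).aestronglyMeasurable
      measurableSet_Ioo) ?_
    filter_upwards [ae_restrict_mem measurableSet_Ioo] with r hr
    obtain ⟨a, b⟩ := h1.2.2.2 r hr.1
    rw [norm_mul, Real.norm_eq_abs, Real.norm_eq_abs, rho, abs_of_pos b,
      abs_of_pos (half_pos a)]
    nlinarith [abs_nonneg (g r), mul_nonneg a.le (abs_nonneg (g r)), mul_pos a b]

/-! ### Elements of $\mathcal X_\rho$ as weakly differentiable functions. -/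

variable {p : ℝ} {f g h : ℝ → ℝ}

lemma IsTest.deriv {η : ℝ → ℝ} (hη : IsTest η) : IsTest (deriv η) :=
  ⟨(contDiff_infty_iff_deriv.1 hη.1).2, hη.2.deriv⟩

lemma IsTest.differentiable {η : ℝ → ℝ} (hη : IsTest η) : Differentiable ℝ η :=
  hη.1.differentiable (by simp)

namespace CoeffFacts

variable (cf : CoeffFacts f g h)
include cf

lemma rho_pos {r : ℝ} (hr : 0 < r) : 0 < rho f r := half_pos (cf.f_pos r hr)

lemma measurable_rho : Measurable fun x => rho f |x| :=
  measurable_comp_abs (cf.f_cont.div_const 2)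

lemma measurable_g : Measurable fun x => g |x| := measurable_comp_abs cf.g_cont

lemma measurable_h : Measurable fun x => h |x| := measurable_comp_abs cf.h_cont

lemma measurable_dG : Measurable fun x => |g (|x|)| * rho f |x| :=
  (measurable_norm.comp cf.measurable_g).mul cf.measurable_rho

lemma measurable_dH : Measurable fun x => h |x| * rho f |x| :=
  cf.measurable_h.mul cf.measurable_rho

lemma ae_rho_pos : ∀ᵐ x : ℝ, 0 < rho f |x| := by
  filter_upwards [ae_ne_zero] with x hx using cf.rho_pos (abs_pos.2 hx)

lemma ae_h_pos : ∀ᵐ x : ℝ, 0 < h |x| := by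
  filter_upwards [ae_ne_zero] with x hx using cf.h_pos _ (abs_pos.2 hx)

lemma ae_rho_nonneg : ∀ᵐ x : ℝ, 0 ≤ rho f |x| := cf.ae_rho_pos.mono fun _ hx => hx.le

lemma ae_dG_nonneg : ∀ᵐ x : ℝ, 0 ≤ |g (|x|)| * rho f |x| :=
  cf.ae_rho_pos.mono fun _ hx => mul_nonneg (abs_nonneg _) hx.le

lemma ae_dH_pos : ∀ᵐ x : ℝ, 0 < h |x| * rho f |x| := by
  filter_upwards [cf.ae_rho_pos, cf.ae_h_pos] with x h1 h2 using mul_pos h2 h1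

lemma ae_dH_nonneg : ∀ᵐ x : ℝ, 0 ≤ h |x| * rho f |x| := cf.ae_dH_pos.mono fun _ hx => hx.le

lemma int_rho (M : ℝ) : IntegrableOn (fun x => rho f |x|) (Icc (-M) M) := by
  refine Integrable.mono' (g := fun _ => rho f (max M 1)) (integrable_const _)
    cf.measurable_rho.aestronglyMeasurable ?_
  filter_upwards [ae_restrict_mem measurableSet_Icc, ae_restrict_of_ae ae_ne_zero] with x hx hx0
  rw [Real.norm_of_nonneg (cf.rho_pos (abs_pos.2 hx0)).le]
  exact div_le_div_of_nonneg_right (cf.f_mono (abs_pos.2 hx0) (by simp)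
    ((abs_le.2 hx).trans (le_max_left _ _))) two_pos.le

lemma rho_low : ∃ c, 0 < c ∧ ∀ x : ℝ, x ≠ 0 → c ≤ rho f |x| := by
  obtain ⟨m, hm, h⟩ := cf.f_low
  exact ⟨m / 2, half_pos hm, fun x hx =>
    div_le_div_of_nonneg_right (h _ (abs_pos.2 hx)) two_pos.le⟩

lemma rho_low' (M : ℝ) : ∃ c > 0, ∀ᵐ x : ℝ, |x| ≤ M → c ≤ rho f |x| := by
  obtain ⟨c, hc, h⟩ := cf.rho_low
  exact ⟨c, hc, ae_ne_zero.mono fun x hx _ => h x hx⟩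

lemma dH_low (M : ℝ) : ∃ c > 0, ∀ᵐ x : ℝ, |x| ≤ M → c ≤ h |x| * rho f |x| := by
  obtain ⟨c, hc, h1⟩ := cf.rho_low
  -- Since $h$ is nonincreasing, it is smallest at the outer radius; the maximum with $1$ keeps that
  -- radius positive when $M\le0$.
  have hM : (0 : ℝ) < max M 1 := by simp
  refine ⟨h (max M 1) * c, mul_pos (cf.h_pos _ hM) hc, ae_ne_zero.mono fun x hx hxM => ?_⟩
  have := cf.h_anti (abs_pos.2 hx) hM (hxM.trans (le_max_left _ _))
  exact mul_le_mul this (h1 x hx) hc.le (cf.h_pos _ (abs_pos.2 hx)).le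

lemma isLocallyFinite_muRho : IsLocallyFiniteMeasure (muRho f) :=
  isLocallyFiniteMeasure_withDensity_ofReal (locallyIntegrable_of_integrableOn_Icc cf.int_rho)

lemma isLocallyFinite_muG : IsLocallyFiniteMeasure (muG f g) :=
  isLocallyFiniteMeasure_withDensity_ofReal (locallyIntegrable_of_integrableOn_Icc cf.int_g)

lemma isLocallyFinite_muH : IsLocallyFiniteMeasure (muH f h) :=
  isLocallyFiniteMeasure_withDensity_ofReal (locallyIntegrable_of_integrableOn_Icc cf.int_h)

lemma volume_ac_muRho : volume ≪ muRho f :=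
  withDensity_absolutelyContinuous' cf.measurable_rho.ennreal_ofReal.aemeasurable
    (cf.ae_rho_pos.mono fun _ hx => (ENNReal.ofReal_pos.2 hx).ne')

lemma volume_ac_muH : volume ≪ muH f h :=
  withDensity_absolutelyContinuous' cf.measurable_dH.ennreal_ofReal.aemeasurable
    (cf.ae_dH_pos.mono fun _ hx => (ENNReal.ofReal_pos.2 hx).ne')

omit cf in
lemma muG_ac_volume : muG f g ≪ volume := withDensity_absolutelyContinuous _ _

/-- The potential may vanish on a set of positive measure, where `muG` carries no information; hence
the restriction to $g\ne0$. -/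
lemma ae_of_ae_muG {P : ℝ → Prop} (hP : ∀ᵐ x ∂(muG f g), P x) : ∀ᵐ x, g |x| ≠ 0 → P x := by
  rw [muG, ae_withDensity_iff cf.measurable_dG.ennreal_ofReal] at hP
  filter_upwards [hP, cf.ae_rho_pos] with x hx h1 h2
  exact hx (ENNReal.ofReal_pos.2 (mul_pos (abs_pos.2 h2) h1)).ne'

/-- Every test function has an associated element of `𝓧_ρ`. -/
lemma exists_testElem {η : ℝ → ℝ} (hη : IsTest η) : ∃ z : Xrho p f g h,
    (z : Ambient p f g h) ∈ testSubspace p f g h ∧ dval z =ᵐ[volume] deriv η ∧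
      val z =ᵐ[volume] η := by
  have := cf.isLocallyFinite_muRho
  have := cf.isLocallyFinite_muG
  have := cf.isLocallyFinite_muH
  have m1 : MemLp (_root_.deriv η) 2 (muRho f) :=
    hη.deriv.1.continuous.memLp_of_hasCompactSupport hη.deriv.2
  have m2 : MemLp η 2 (muG f g) := hη.1.continuous.memLp_of_hasCompactSupport hη.2
  have m3 : MemLp η (expL p) (muH f h) := hη.1.continuous.memLp_of_hasCompactSupport hη.2
  have hz : (m1.toLp, m2.toLp, m3.toLp) ∈ testSubspace p f g h :=
    ⟨η, hη, m1.coeFn_toLp, m2.coeFn_toLp, m3.coeFn_toLp⟩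
  exact ⟨⟨_, (testSubspace p f g h).le_topologicalClosure hz⟩, hz,
    cf.volume_ac_muRho.ae_le m1.coeFn_toLp, cf.volume_ac_muH.ae_le m3.coeFn_toLp⟩

lemma exists_test_of_mem {z : Xrho p f g h}
    (hz : (z : Ambient p f g h) ∈ testSubspace p f g h) :
    ∃ η, IsTest η ∧ dval z =ᵐ[volume] deriv η ∧ val z =ᵐ[volume] η := by
  obtain ⟨η, hη, h1, -, h3⟩ := hz
  exact ⟨η, hη, cf.volume_ac_muRho.ae_le h1, cf.volume_ac_muH.ae_le h3⟩

end CoeffFacts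

/-- Test functions are dense by construction, so closed conditions need only be checked on them. -/
lemma Xrho_induction {P : Xrho p f g h → Prop} (hP : IsClosed {v | P v})
    (ht : ∀ z : Xrho p f g h, (z : Ambient p f g h) ∈ testSubspace p f g h → P z)
    (v : Xrho p f g h) : P v := by
  have hd : Dense {z : Xrho p f g h | (z : Ambient p f g h) ∈ testSubspace p f g h} := by
    rw [Subtype.dense_iff]
    intro x hx
    refine closure_mono ?_ (show x ∈ closure (testSubspace p f g h : Set (Ambient p f g h)) from hx)
    intro y hy
    exact ⟨⟨y, (testSubspace p f g h).le_topologicalClosure hy⟩, hy, rfl⟩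
  have : closure {z : Xrho p f g h | (z : Ambient p f g h) ∈ testSubspace p f g h} ⊆ {v | P v} :=
    closure_minimal ht hP
  exact this (hd v)

/-- The weak derivative as a continuous linear map. -/
def derivCLM : Xrho p f g h →L[ℝ] Lp ℝ 2 (muRho f) :=
  (ContinuousLinearMap.fst ℝ _ _).comp (Xrho p f g h).subtypeL

/-- The component in `L²(|g| ρ)` as a continuous linear map. -/
def gCLM : Xrho p f g h →L[ℝ] Lp ℝ 2 (muG f g) :=
  ((ContinuousLinearMap.fst ℝ _ _).comp (ContinuousLinearMap.snd ℝ _ _)).comp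
    (Xrho p f g h).subtypeL

/-- The component in `𝓛_ρ` as a continuous linear map. -/
def toLCLM : Xrho p f g h →L[ℝ] Lrho p f h :=
  ((ContinuousLinearMap.snd ℝ _ _).comp (ContinuousLinearMap.snd ℝ _ _)).comp
    (Xrho p f g h).subtypeL

lemma toLCLM_apply (v : Xrho p f g h) : toLCLM v = toL v := rfl

lemma derivCLM_coe (v : Xrho p f g h) : (derivCLM v : ℝ → ℝ) = dval v := rfl

namespace CoeffFacts

variable (cf : CoeffFacts f g h)
include cf

/-- The $L^2(|g|\rho)$ and $\mathcal L_\rho$ components of an element of the closure are the same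
function. Agreement is a closed condition: pass to a subsequence along which both components
converge almost everywhere. -/
lemma gCLM_ae (v : Xrho p f g h) : gCLM v =ᵐ[muG f g] val v := by
  refine Xrho_induction (P := fun v => gCLM v =ᵐ[muG f g] val v) ?_ ?_ v
  · refine IsSeqClosed.isClosed fun s z hs hz => ?_
    have h1 : Tendsto (fun n => gCLM (s n)) atTop (𝓝 (gCLM z)) := (gCLM.continuous.tendsto z).comp hz
    have h2 : Tendsto (fun n => toLCLM (s n)) atTop (𝓝 (toLCLM z)) :=
      (toLCLM.continuous.tendsto z).comp hz
    obtain ⟨ns, hns, hae⟩ := (tendstoInMeasure_of_tendsto_Lp h1).exists_seq_tendsto_ae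
    have h3 := h2.comp hns.tendsto_atTop
    obtain ⟨ms, hms, hae'⟩ := (tendstoInMeasure_of_tendsto_Lp h3).exists_seq_tendsto_ae
    have hac : muG f g ≪ muH f h := muG_ac_volume.trans cf.volume_ac_muH
    have hs' : ∀ᵐ x ∂(muG f g), ∀ n, gCLM (s n) x = val (s n) x := ae_all_iff.2 hs
    filter_upwards [hae, hac.ae_le hae', hs'] with x a b c
    refine tendsto_nhds_unique (a.comp hms.tendsto_atTop) (b.congr fun n => ?_)
    exact (c _).symm
  · rintro z ⟨η, -, -, h2, h3⟩
    exact EventuallyEq.trans h2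
      (EventuallyEq.symm ((muG_ac_volume.trans cf.volume_ac_muH).ae_le h3))

lemma gCLM_ae_volume (v : Xrho p f g h) : ∀ᵐ x, g |x| ≠ 0 → gCLM v x = val v x :=
  cf.ae_of_ae_muG (cf.gCLM_ae v)

/-- Continuity of the unweighted pairings makes the weak derivative identity a closed condition. -/
lemma exists_clm_dval {η : ℝ → ℝ} (hη : IsTest η) : ∃ T : Xrho p f g h →L[ℝ] ℝ, ∀ v,
    Integrable (fun x => dval v x * η x) ∧ T v = ∫ x, dval v x * η x := by
  obtain ⟨T, hT⟩ := exists_clm_integral_mul (q := 2) cf.measurable_rho cf.ae_rho_nonneg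
    (locallyIntegrable_of_integrableOn_Icc cf.int_rho) cf.rho_low' hη.1.continuous hη.2
  exact ⟨T.comp derivCLM, fun v => hT (derivCLM v)⟩

lemma exists_clm_val {η : ℝ → ℝ} (hη : IsTest η) : ∃ T : Xrho p f g h →L[ℝ] ℝ, ∀ v,
    Integrable (fun x => val v x * η x) ∧ T v = ∫ x, val v x * η x := by
  obtain ⟨T, hT⟩ := exists_clm_integral_mul (q := expL p) cf.measurable_dH cf.ae_dH_nonneg
    (locallyIntegrable_of_integrableOn_Icc cf.int_h) cf.dH_low hη.1.continuous hη.2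
  exact ⟨T.comp toLCLM, fun v => hT (toLCLM v)⟩

lemma locallyIntegrable_dval (v : Xrho p f g h) : LocallyIntegrable (dval v) :=
  locallyIntegrable_of_forall_integrable_mul fun _ hη =>
    ((cf.exists_clm_dval hη).choose_spec v).1

/-- `dval v` is the weak derivative of `val v`. -/
lemma integral_dval_mul (v : Xrho p f g h) {η : ℝ → ℝ} (hη : IsTest η) :
    ∫ x, dval v x * η x = -∫ x, val v x * deriv η x := by
  obtain ⟨S, hS⟩ := cf.exists_clm_dval (p := p) hη
  obtain ⟨T, hT⟩ := cf.exists_clm_val (p := p) hη.deriv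
  rw [← (hS v).2, ← (hT v).2]
  refine Xrho_induction (P := fun v => S v = -T v) (isClosed_eq S.continuous T.continuous.neg) ?_ v
  intro z hz
  obtain ⟨θ, hθ, h1, h2⟩ := cf.exists_test_of_mem hz
  rw [(hS z).2, (hT z).2]
  have e1 : ∫ x, dval z x * η x = ∫ x, deriv θ x * η x :=
    integral_congr_ae (h1.mono fun x hx => by simp only [hx])
  have e2 : ∫ x, val z x * deriv η x = ∫ x, θ x * deriv η x :=
    integral_congr_ae (h2.mono fun x hx => by simp only [hx])
  have i1 : Integrable (fun x => θ x * deriv η x) :=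
    (hθ.1.continuous.mul hη.deriv.1.continuous).integrable_of_hasCompactSupport hη.deriv.2.mul_left
  have i2 : Integrable (fun x => deriv θ x * η x) :=
    (hθ.deriv.1.continuous.mul hη.1.continuous).integrable_of_hasCompactSupport hη.2.mul_left
  have i3 : Integrable (fun x => θ x * η x) :=
    (hθ.1.continuous.mul hη.1.continuous).integrable_of_hasCompactSupport hη.2.mul_left
  rw [e1, e2, integral_mul_deriv_eq_deriv_mul_of_integrable
    (fun x _ => (hθ.differentiable x).hasDerivAt) (fun x _ => (hη.differentiable x).hasDerivAt)
    i1 i2 i3, neg_neg]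

/-- The three components are determined by the function: the first is its weak derivative, the
others are the function itself. -/
lemma eq_zero_of_val_ae {v : Xrho p f g h} (hv : val v =ᵐ[volume] 0) : v = 0 := by
  have h1 : dval v =ᵐ[volume] 0 := by
    refine ae_eq_zero_of_integral_contDiff_smul_eq_zero (cf.locallyIntegrable_dval v) ?_
    intro η h1 h2
    have : ∫ x, val v x * deriv η x = 0 :=
      integral_eq_zero_of_ae (hv.mono fun x hx => by simp [hx])
    simp only [smul_eq_mul, mul_comm (η _)]
    rw [cf.integral_dval_mul v ⟨h1, h2⟩, this, neg_zero]
  have a1 : derivCLM v = 0 := Lp.ext (EventuallyEq.trans ((withDensity_absolutelyContinuous _ _).ae_le h1)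
    (Lp.coeFn_zero _ _ _).symm)
  have a2 : gCLM v = 0 := Lp.ext (((cf.gCLM_ae v).trans (muG_ac_volume.ae_le hv)).trans
    (Lp.coeFn_zero _ _ _).symm)
  have a3 : toLCLM v = 0 := Lp.ext (EventuallyEq.trans ((withDensity_absolutelyContinuous _ _).ae_le hv)
    (Lp.coeFn_zero _ _ _).symm)
  exact Subtype.ext (Prod.ext a1 (Prod.ext a2 a3))

end CoeffFacts

/-! ### The energy functional and its first two derivatives. -/

section Abstract

variable {E F : Type*} [NormedAddCommGroup E] [NormedSpace ℝ E] [NormedAddCommGroup F]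
  [NormedSpace ℝ F]

lemma hasFDerivAt_half_form_sub {B : E →L[ℝ] E →L[ℝ] ℝ} (hB : ∀ v w, B v w = B w v)
    {T : E →L[ℝ] F} {N : F → ℝ} {N' : F →L[ℝ] ℝ} {v : E} (hN : HasFDerivAt N N' (T v)) :
    HasFDerivAt (fun v => 1 / 2 * B v v - N (T v)) (B v - N'.comp T) v := by
  have h1 : HasFDerivAt (fun v => B v v) (2 • B v) v := by
    refine (B.hasFDerivAt_of_bilinear (hasFDerivAt_id v) (hasFDerivAt_id v)).congr_fderiv ?_
    ext w
    simp [hB w v, two_mul]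
  refine ((h1.const_mul (1 / 2)).sub (hN.comp v T.hasFDerivAt)).congr_fderiv ?_
  ext w
  simp

lemma hasFDerivAt_form_sub_comp {B : E →L[ℝ] E →L[ℝ] ℝ}
    {T : E →L[ℝ] F} {D : F → F →L[ℝ] ℝ} {D' : F →L[ℝ] F →L[ℝ] ℝ} {v : E}
    (hD : HasFDerivAt D D' (T v)) :
    HasFDerivAt (fun v => B v - (D (T v)).comp T)
      (B - ((ContinuousLinearMap.compL ℝ E F ℝ).flip T).comp (D'.comp T)) v :=
  B.hasFDerivAt.sub (((ContinuousLinearMap.compL ℝ E F ℝ).flip T).hasFDerivAt.comp v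
    (hD.comp v T.hasFDerivAt))

lemma contDiff_form_sub_comp {B : E →L[ℝ] E →L[ℝ] ℝ}
    {T : E →L[ℝ] F} {D : F → F →L[ℝ] ℝ} (hD : ContDiff ℝ 1 D) :
    ContDiff ℝ 1 (fun v => B v - (D (T v)).comp T) :=
  B.contDiff.sub (((ContinuousLinearMap.compL ℝ E F ℝ).flip T).contDiff.comp
    (hD.comp T.contDiff))

end Abstract

/-- The sign of the potential, with values in `{-1, 1}`. -/
def gSign (g : ℝ → ℝ) (x : ℝ) : ℝ := if 0 ≤ g |x| then 1 else -1

lemma abs_mul_gSign (g : ℝ → ℝ) (x : ℝ) : |g (|x|)| * gSign g x = g |x| := by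
  rw [gSign]
  split_ifs with hx
  · rw [abs_of_nonneg hx, mul_one]
  · rw [abs_of_neg (not_le.1 hx)]; ring

namespace CoeffFacts

variable (cf : CoeffFacts f g h)
include cf

/-- A bounded sign acts as a multiplier on $L^2(|g|\rho)$; it recovers the possibly indefinite
weight $g$ from the positive measure `muG`. -/
lemma memLp_gSign : MemLp (gSign g) ∞ (muG f g) := by
  refine memLp_top_of_bound
    (Measurable.ite (measurableSet_le measurable_const cf.measurable_g) measurable_const
      measurable_const).aestronglyMeasurable 1 (Eventually.of_forall fun x => ?_)
  rw [gSign]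
  split_ifs <;> simp

/-- The bilinear form of `‖·‖_{𝓧_ρ}²`. -/
def formX (p : ℝ) : Xrho p f g h →L[ℝ] Xrho p f g h →L[ℝ] ℝ :=
  ((ContinuousLinearMap.mul ℝ ℝ).lpPairing (muRho f) 2 2).bilinearComp derivCLM derivCLM +
    ((ContinuousLinearMap.mul ℝ ℝ).lpPairing (muG f g) 2 2).bilinearComp gCLM
      (((ContinuousLinearMap.mul ℝ ℝ).holderL (muG f g) ∞ 2 2 cf.memLp_gSign.toLp).comp gCLM)

lemma integrable_dval_mul_dval (v w : Xrho p f g h) :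
    Integrable fun x => dval v x * dval w x * rho f |x| := by
  have := (integrable_withDensity_ofReal_iff cf.measurable_rho cf.ae_rho_nonneg).1
    ((Lp.memLp (derivCLM v)).integrable_mul (Lp.memLp (derivCLM w)))
  refine this.congr (Eventually.of_forall fun x => ?_)
  simp only [Pi.mul_apply, derivCLM_coe]
  ring

lemma integrable_abs_g_val_mul_val (v w : Xrho p f g h) :
    Integrable fun x => |g (|x|)| * val v x * val w x * rho f |x| := by
  have := (integrable_withDensity_ofReal_iff cf.measurable_dG cf.ae_dG_nonneg).1
    ((Lp.memLp (gCLM v)).integrable_mul (Lp.memLp (gCLM w)))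
  refine this.congr ?_
  filter_upwards [cf.gCLM_ae_volume v, cf.gCLM_ae_volume w] with x h1 h2
  by_cases hg : g |x| = 0
  · simp [hg]
  · rw [Pi.mul_apply, h1 hg, h2 hg]
    ring

lemma integrable_g_val_mul_val (v w : Xrho p f g h) :
    Integrable fun x => g |x| * val v x * val w x * rho f |x| := by
  refine (cf.integrable_abs_g_val_mul_val v w).mono ?_ (Eventually.of_forall fun x => ?_)
  · have hv (v : Xrho p f g h) : AEMeasurable (val v) :=
      (aemeasurable_Lp (toL v)).mono_ac cf.volume_ac_muH
    exact (((cf.measurable_g.aemeasurable.mul (hv v)).mul (hv w)).mul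
      cf.measurable_rho.aemeasurable).aestronglyMeasurable
  · simp only [norm_mul, norm_abs_eq_norm, le_refl]

lemma formX_apply (v w : Xrho p f g h) : cf.formX p v w =
    ∫ x, (dval v x * dval w x + g |x| * val v x * val w x) * rho f |x| := by
  have e1 : (ContinuousLinearMap.mul ℝ ℝ).lpPairing (muRho f) 2 2 (derivCLM v) (derivCLM w) = ∫ x, dval v x * dval w x * rho f |x| := by
    rw [ContinuousLinearMap.lpPairing_eq_integral]
    refine (integral_withDensity_ofReal cf.measurable_rho cf.ae_rho_nonneg _).trans ?_
    refine integral_congr_ae (Eventually.of_forall fun x => ?_)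
    simp only [derivCLM_coe, ContinuousLinearMap.mul_apply']
    ring
  have e2 : (ContinuousLinearMap.mul ℝ ℝ).lpPairing (muG f g) 2 2 (gCLM v) ((ContinuousLinearMap.mul ℝ ℝ).holderL (muG f g) ∞ 2 2
      cf.memLp_gSign.toLp (gCLM w)) = ∫ x, g |x| * val v x * val w x * rho f |x| := by
    rw [ContinuousLinearMap.lpPairing_eq_integral]
    have hc : (fun x => ContinuousLinearMap.mul ℝ ℝ (gCLM v x) ((ContinuousLinearMap.mul ℝ ℝ).holderL (muG f g) ∞ 2 2
        cf.memLp_gSign.toLp (gCLM w) x)) =ᵐ[muG f g] fun x => val v x * (gSign g x * val w x) := by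
      filter_upwards [(ContinuousLinearMap.mul ℝ ℝ).coeFn_holder (r := 2) cf.memLp_gSign.toLp
        (gCLM w), cf.memLp_gSign.coeFn_toLp, cf.gCLM_ae v, cf.gCLM_ae w] with x h1 h2 h3 h4
      rw [ContinuousLinearMap.mul_apply', h3]
      have : ((ContinuousLinearMap.mul ℝ ℝ).holderL (muG f g) ∞ 2 2
        cf.memLp_gSign.toLp (gCLM w) : ℝ → ℝ) x = gSign g x * val w x := by
        refine h1.trans ?_
        rw [ContinuousLinearMap.mul_apply', h2, h4]
      rw [this]
    rw [integral_congr_ae hc]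
    refine (integral_withDensity_ofReal cf.measurable_dG cf.ae_dG_nonneg _).trans ?_
    refine integral_congr_ae (Eventually.of_forall fun x => ?_)
    simp only
    linear_combination (rho f |x| * val v x * val w x) * abs_mul_gSign g x
  simp only [add_mul]
  rw [integral_add (cf.integrable_dval_mul_dval v w) (cf.integrable_g_val_mul_val v w), ← e1, ← e2]
  rfl

lemma formX_symm (v w : Xrho p f g h) : cf.formX p v w = cf.formX p w v := by
  rw [formX_apply, formX_apply]
  congr 1 with x
  ring

lemma integrable_sgnPow_val (hp : 1 < p) (v w : Xrho p f g h) :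
    Integrable fun x => h |x| * sgnPow p (val v x) * val w x * rho f |x| := by
  refine ((integrable_withDensity_ofReal_iff cf.measurable_dH cf.ae_dH_nonneg).1
    (integrable_sgnPow_mul hp (toL v) (toL w))).congr (Eventually.of_forall fun x => ?_)
  simp only [val]
  ring

lemma powD_toL (hp : 1 < p) (v w : Xrho p f g h) : powD hp (toL v) (toL w) =
    ∫ x, h |x| * sgnPow p (val v x) * val w x * rho f |x| := by
  rw [powD_apply]
  refine (integral_withDensity_ofReal cf.measurable_dH cf.ae_dH_nonneg _).trans ?_
  refine integral_congr_ae (Eventually.of_forall fun x => ?_)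
  simp only [val]
  ring

lemma integrable_rpow_val (hp : 1 < p) (v w k : Xrho p f g h) :
    Integrable fun x => p * h |x| * |val v x| ^ (p - 1) * val w x * val k x * rho f |x| := by
  refine (((integrable_withDensity_ofReal_iff cf.measurable_dH cf.ae_dH_nonneg).1
    (integrable_rpow_mul_mul hp (toL v) (toL w) (toL k))).const_mul p).congr
      (Eventually.of_forall fun x => ?_)
  simp only [val]
  ring

lemma powD2_toL (hp : 1 < p) (v w k : Xrho p f g h) : powD2 hp (toL v) (toL w) (toL k) =
    ∫ x, p * h |x| * |val v x| ^ (p - 1) * val w x * val k x * rho f |x| := by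
  rw [powD2_apply]
  rw [show ∫ x, |toL v x| ^ (p - 1) * toL w x * toL k x ∂(muH f h) = _ from
    integral_withDensity_ofReal cf.measurable_dH cf.ae_dH_nonneg _, ← integral_const_mul]
  refine integral_congr_ae (Eventually.of_forall fun x => ?_)
  simp only [val]
  ring

/-- The real square root is $0$ at negative arguments, so a negative value of the form would give
`normX v = 0`, which the positive infimum excludes for $v\ne0$. This is what makes `normX v ^ 2`
equal to the form. -/
lemma formX_self_nonneg (h10 : NormBound p f g h) (v : Xrho p f g h) : 0 ≤ cf.formX p v v := by
  rcases eq_or_ne v 0 with rfl | hv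
  · simp
  · have hb : BddBelow (range fun v : {v : Xrho p f g h // v ≠ 0} => normX v.1 / normL v.1) := by
      refine ⟨0, ?_⟩
      rintro _ ⟨w, rfl⟩
      refine div_nonneg (Real.sqrt_nonneg _) ?_
      refine Real.rpow_nonneg (integral_nonneg_of_ae ?_) _
      filter_upwards [cf.ae_dH_nonneg] with x hx
      have : 0 ≤ (h |x| * rho f |x|) * |val w.1 x| ^ (p + 1) := by positivity
      simpa [mul_right_comm] using this
    have h1 : 0 < normX v / normL v := h10.1.trans_le (ciInf_le hb ⟨v, hv⟩)
    have h2 : normX v ≠ 0 := fun h0 => by simp [h0] at h1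
    by_contra hneg
    refine h2 (Real.sqrt_eq_zero_of_nonpos ?_)
    rw [formX_apply] at hneg
    refine (not_le.1 hneg).le.trans_eq' ?_
    congr 1 with x
    ring

lemma energy_eq (hp : 1 < p) (h10 : NormBound p f g h) (v : Xrho p f g h) :
    energy v = 1 / 2 * cf.formX p v v - ∫ x, |toLCLM v x| ^ (p + 1) / (p + 1) ∂(muH f h) := by
  have e1 : normX v ^ 2 = cf.formX p v v := by
    have : cf.formX p v v = ∫ x, (dval v x ^ 2 + g |x| * val v x ^ 2) * rho f |x| := by
      rw [formX_apply]
      congr 1 with x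
      ring
    rw [normX, ← this, Real.sq_sqrt (cf.formX_self_nonneg h10 v)]
  have e2 : normL v ^ (p + 1) = ∫ x, |toLCLM v x| ^ (p + 1) ∂(muH f h) := by
    have : ∫ x, |toLCLM v x| ^ (p + 1) ∂(muH f h) =
        ∫ x, h |x| * |val v x| ^ (p + 1) * rho f |x| := by
      refine (integral_withDensity_ofReal cf.measurable_dH cf.ae_dH_nonneg _).trans ?_
      refine integral_congr_ae (Eventually.of_forall fun x => ?_)
      simp only [val, toLCLM_apply]
      ring
    rw [normL, ← this, ← Real.rpow_mul (integral_nonneg fun x => by positivity),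
      one_div_mul_cancel (by linarith), Real.rpow_one]
  rw [energy, e1, e2, integral_div]
  ring

/-- The derivative of the energy. -/
def energyD (hp : 1 < p) (v : Xrho p f g h) : Xrho p f g h →L[ℝ] ℝ :=
  cf.formX p v - (powD hp (toLCLM v)).comp toLCLM

lemma hasFDerivAt_energy (hp : 1 < p) (h10 : NormBound p f g h) (v : Xrho p f g h) :
    HasFDerivAt (energy : Xrho p f g h → ℝ) (cf.energyD hp v) v := by
  rw [show (energy : Xrho p f g h → ℝ) = _ from funext (cf.energy_eq hp h10)]
  exact hasFDerivAt_half_form_sub cf.formX_symm (hasFDerivAt_powInt hp (toLCLM v))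

lemma fderiv_energy (hp : 1 < p) (h10 : NormBound p f g h) :
    fderiv ℝ (energy : Xrho p f g h → ℝ) = cf.energyD hp :=
  funext fun v => (cf.hasFDerivAt_energy hp h10 v).fderiv

lemma contDiff_energy (hp : 1 < p) (h10 : NormBound p f g h) :
    ContDiff ℝ 2 (energy : Xrho p f g h → ℝ) :=
  (contDiff_succ_iff_hasFDerivAt (n := 1)).2
    ⟨_, contDiff_form_sub_comp (contDiff_one_powD hp), fun v => cf.hasFDerivAt_energy hp h10 v⟩

lemma fderiv_energyD_apply (hp : 1 < p) (v w k : Xrho p f g h) :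
    fderiv ℝ (cf.energyD hp) v w k = cf.formX p w k - powD2 hp (toL v) (toL w) (toL k) := by
  rw [show fderiv ℝ (cf.energyD hp) v = _ from
    (hasFDerivAt_form_sub_comp (hasFDerivAt_powD hp (toLCLM v))).fderiv]
  rfl

lemma energyD_apply (hp : 1 < p) (v w : Xrho p f g h) :
    cf.energyD hp v w = cf.formX p v w - powD hp (toL v) (toL w) := rfl

/-- The weak equation says that the continuous functional `energyD` vanishes at $v$ on test
functions, hence everywhere. -/
lemma energyD_eq_zero (hp : 1 < p) {v : Xrho p f g h} (hv : SolvesOn v univ) :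
    cf.energyD hp v = 0 := by
  ext w
  refine Xrho_induction (P := fun w => cf.energyD hp v w = 0)
    (isClosed_eq (cf.energyD hp v).continuous continuous_const) (fun z hz => ?_) w
  obtain ⟨η, hη, h1, h2⟩ := cf.exists_test_of_mem hz
  rw [energyD_apply, formX_apply, cf.powD_toL hp, ← integral_sub _ (cf.integrable_sgnPow_val hp v z),
    ← hv η hη (subset_univ _)]
  · refine integral_congr_ae ?_
    filter_upwards [h1, h2] with x e1 e2
    rw [e1, e2, sgnPow]
    ring
  · simp only [add_mul]
    exact (cf.integrable_dval_mul_dval v z).add (cf.integrable_g_val_mul_val v z)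

lemma solvesLinearized_of_fderiv (hp : 1 < p) {Φ w : Xrho p f g h} {φ : ℝ → ℝ}
    (hφ : val Φ =ᵐ[volume] φ) (hpos : ∀ x, 0 < φ x) (hw : fderiv ℝ (cf.energyD hp) Φ w = 0) :
    SolvesLinearized φ w := by
  intro η hη
  obtain ⟨z, -, h1, h2⟩ := cf.exists_testElem (p := p) hη
  have hz : fderiv ℝ (cf.energyD hp) Φ w z = 0 := by rw [hw]; rfl
  rw [fderiv_energyD_apply, formX_apply, cf.powD2_toL hp,
    ← integral_sub _ (cf.integrable_rpow_val hp Φ w z)] at hz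
  · rw [← hz]
    refine integral_congr_ae ?_
    filter_upwards [h1, h2, hφ] with x e1 e2 e3
    rw [e1, e2, e3, abs_of_pos (hpos x)]
    ring
  · simp only [add_mul]
    exact (cf.integrable_dval_mul_dval w z).add (cf.integrable_g_val_mul_val w z)

/-- An element of the kernel is orthogonal to `h φ^p`. -/
lemma integral_rpow_mul_eq_zero (hp : 1 < p) {Φ w : Xrho p f g h} {φ : ℝ → ℝ}
    (hφ : val Φ =ᵐ[volume] φ) (hpos : ∀ x, 0 < φ x) (hsol : SolvesOn Φ univ)
    (hw : fderiv ℝ (cf.energyD hp) Φ w = 0) :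
    Integrable (fun x => h |x| * φ x ^ p * val w x * rho f |x|) ∧
      ∫ x, h |x| * φ x ^ p * val w x * rho f |x| = 0 := by
  have e1 : cf.energyD hp Φ w = 0 := by rw [cf.energyD_eq_zero hp hsol]; rfl
  have e2 : fderiv ℝ (cf.energyD hp) Φ w Φ = 0 := by rw [hw]; rfl
  have hae : (fun x => h |x| * sgnPow p (val Φ x) * val w x * rho f |x|) =ᵐ[volume]
      fun x => h |x| * φ x ^ p * val w x * rho f |x| := by
    filter_upwards [hφ] with x hx
    rw [hx, sgnPow_of_pos (hpos x)]
  have e3 : powD2 hp (toL Φ) (toL w) (toL Φ) = p * powD hp (toL Φ) (toL w) := by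
    rw [powD2_apply, powD_apply]
    congr 2 with x
    rw [sgnPow]
    ring
  rw [energyD_apply] at e1
  rw [fderiv_energyD_apply, e3, cf.formX_symm w Φ] at e2
  -- The form is symmetric, so both identities contain the same form value; they differ only by the
  -- factor $p$ that homogeneity puts in front of the power term.
  have e4 : (p - 1) * powD hp (toL Φ) (toL w) = 0 := by linarith
  have e5 := (mul_eq_zero.1 e4).resolve_left (by linarith)
  rw [powD_toL cf, integral_congr_ae hae] at e5
  exact ⟨(cf.integrable_sgnPow_val hp Φ w).congr hae, e5⟩

end CoeffFacts

/-! ### From weak to classical equations -/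

/-- The primitive started left of the support vanishes to the left of it, and to the right because
the total integral is zero. -/
lemma exists_test_primitive {ψ : ℝ → ℝ} (hψ : IsTest ψ) (h0 : ∫ x, ψ x = 0) :
    ∃ Ψ, IsTest Ψ ∧ deriv Ψ = ψ := by
  obtain ⟨M, hM⟩ := hψ.2.isCompact.isBounded.exists_norm_le
  have hz (x : ℝ) (hx : M < |x|) : ψ x = 0 := by
    by_contra hne
    exact absurd (hM x (subset_tsupport _ hne)) (not_le.2 hx)
  have hc := hψ.1.continuous
  have hd (x : ℝ) : HasDerivAt (fun x => ∫ t in (-M)..x, ψ t) (ψ x) x :=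
    hc.integral_hasStrictDerivAt (-M) x |>.hasDerivAt
  have hder : deriv (fun x => ∫ t in (-M)..x, ψ t) = ψ := funext fun x => (hd x).deriv
  refine ⟨_, ⟨contDiff_infty_iff_deriv.2 ⟨fun x => (hd x).differentiableAt, ?_⟩, ?_⟩, hder⟩
  · rw [hder]; exact hψ.1
  · refine HasCompactSupport.of_support_subset_isCompact (isCompact_Icc (a := -|M|) (b := |M|)) ?_
    intro x hx
    by_contra hxM
    rw [mem_Icc, ← abs_le, not_le] at hxM
    refine hx ?_
    have hxM' : M < |x| := (le_abs_self M).trans_lt hxM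
    rcases lt_or_ge x 0 with hx0 | hx0
    · rw [abs_of_neg hx0] at hxM'
      simp only
      rw [intervalIntegral.integral_symm, intervalIntegral.integral_zero_ae, neg_zero]
      refine Measure.ae_ne volume (-M) |>.mono fun t ht htm => ?_
      rw [uIoc_of_le (by linarith)] at htm
      have : t < -M := lt_of_le_of_ne htm.2 ht
      refine hz t ?_
      have := neg_le_abs t
      linarith
    · rw [abs_of_nonneg hx0] at hxM'
      have hle : -M ≤ x := by
        rcases le_total 0 M with h | h
        · linarith
        · by_contra hlt
          rw [abs_of_nonpos h, abs_of_nonneg hx0] at hxM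
          exact hlt hxM.le
      simp only
      rw [intervalIntegral.integral_of_le hle, setIntegral_eq_integral_of_ae_compl_eq_zero, h0]
      refine Measure.ae_ne volume (-M) |>.mono fun t ht htm => ?_
      rw [mem_Ioc, not_and_or, not_lt, not_le] at htm
      refine hz t ?_
      rcases htm with h | h
      · have : t < -M := lt_of_le_of_ne h ht
        have := neg_le_abs t
        linarith
      · have := le_abs_self t
        linarith

lemma LocallyIntegrable.integrable_mul_test {B η : ℝ → ℝ} (hB : LocallyIntegrable B)
    (hη : IsTest η) : Integrable fun x => B x * η x := by
  simpa [smul_eq_mul, mul_comm] using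
    hB.integrable_smul_left_of_hasCompactSupport hη.1.continuous hη.2

/-- The du Bois-Reymond lemma: subtracting a multiple of a normalized bump from a test function
leaves zero mean, hence a derivative of a test function. The constant is the pairing of $B$ with the
bump. -/
lemma exists_ae_eq_const {B : ℝ → ℝ} (hB : LocallyIntegrable B)
    (h : ∀ η, IsTest η → ∫ x, B x * deriv η x = 0) : ∃ c : ℝ, B =ᵐ[volume] fun _ => c := by
  let b : ContDiffBump (0 : ℝ) := ⟨1, 2, one_pos, one_lt_two⟩
  set χ : ℝ → ℝ := b.normed volume with hχ
  have hχt : IsTest χ := ⟨b.contDiff_normed, b.hasCompactSupport_normed⟩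
  have hχ1 : ∫ x, χ x = 1 := b.integral_normed
  refine ⟨∫ x, B x * χ x, ?_⟩
  set c := ∫ x, B x * χ x with hc
  have : ∀ᵐ x, B x - c = 0 := by
    refine ae_eq_zero_of_integral_contDiff_smul_eq_zero (hB.sub (locallyIntegrable_const c)) ?_
    intro η h1 h2
    have hη : IsTest η := ⟨h1, h2⟩
    have iη : Integrable η := hη.1.continuous.integrable_of_hasCompactSupport hη.2
    have iχ : Integrable χ := hχt.1.continuous.integrable_of_hasCompactSupport hχt.2
    have hψ : IsTest (fun x => η x - (∫ y, η y) * χ x) :=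
      ⟨hη.1.sub (contDiff_const.mul hχt.1), hη.2.sub hχt.2.mul_left⟩
    obtain ⟨Ψ, hΨ, hd⟩ := exists_test_primitive hψ (by
      rw [integral_sub iη (iχ.const_mul _), integral_const_mul, hχ1, mul_one, sub_self])
    have h3 := h Ψ hΨ
    have i1 := LocallyIntegrable.integrable_mul_test hB hη
    have i2 := LocallyIntegrable.integrable_mul_test hB hχt
    rw [hd, show (fun x => B x * (η x - (∫ y, η y) * χ x)) =
      fun x => B x * η x - (∫ y, η y) * (B x * χ x) by ext x; ring,
      integral_sub i1 (i2.const_mul _), integral_const_mul, ← hc] at h3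
    simp only [smul_eq_mul]
    rw [show (fun x => η x * (B x - c)) = fun x => B x * η x - c * η x by ext x; ring,
      integral_sub i1 (iη.const_mul _), integral_const_mul]
    linarith
  exact this.mono fun x hx => sub_eq_zero.1 hx

/-- A function with a weak derivative that is continuous off the origin. -/
lemma exists_continuous_of_weak_deriv {A m : ℝ → ℝ} (hA : LocallyIntegrable A)
    (hm : LocallyIntegrable m) (hmc : ContinuousOn m {0}ᶜ)
    (h : ∀ η, IsTest η → ∫ x, (A x * deriv η x + m x * η x) = 0) :
    ∃ F : ℝ → ℝ, Continuous F ∧ (∀ x, x ≠ 0 → HasDerivAt F (m x) x) ∧ A =ᵐ[volume] F := by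
  have hi (a b : ℝ) : IntervalIntegrable m volume a b :=
    (hm.integrableOn_isCompact isCompact_uIcc).intervalIntegrable
  set K : ℝ → ℝ := fun x => ∫ t in (0 : ℝ)..x, m t with hK
  have hKc : Continuous K := intervalIntegral.continuous_primitive hi 0
  have hKd (x : ℝ) (hx : x ≠ 0) : HasDerivAt K (m x) x := by
    have hn : ({0}ᶜ : Set ℝ) ∈ 𝓝 x := isOpen_compl_singleton.mem_nhds hx
    exact intervalIntegral.integral_hasDerivAt_right (hi 0 x)
      (hmc.stronglyMeasurableAtFilter isOpen_compl_singleton x hx) (hmc.continuousAt hn)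
  -- The primitive $K$ of $m$ satisfies the same weak identity as $A$, by integrating $(K\eta)'$.
  -- The possible failure of differentiability at $0$ is harmless because $K$ is continuous. So
  -- $A-K$ has zero weak derivative.
  obtain ⟨c, hc⟩ := exists_ae_eq_const (B := fun x => A x - K x)
    (hA.sub hKc.locallyIntegrable) (by
      intro η hη
      have i1 := LocallyIntegrable.integrable_mul_test hA hη.deriv
      have i2 := LocallyIntegrable.integrable_mul_test hm hη
      have i3 := LocallyIntegrable.integrable_mul_test hKc.locallyIntegrable hη.deriv
      have h1 := h η hη
      rw [integral_add i1 i2] at h1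
      obtain ⟨M, hM⟩ := hη.2.isCompact.isBounded.exists_norm_le
      have hz (x : ℝ) (hx : M < |x|) : η x = 0 := by
        by_contra hne
        exact absurd (hM x (subset_tsupport _ hne)) (not_le.2 hx)
      set N := |M| + 1
      have hN : M < |N| := by
        rw [abs_of_nonneg (by positivity)]
        have := le_abs_self M
        linarith
      have i5 : Integrable fun x => K x * deriv η x + m x * η x := i3.add i2
      have h2 : ∫ x in (-N)..N, (K x * deriv η x + m x * η x) = 0 := by
        rw [integral_eq_of_hasDerivAt_off_countable (fun x => K x * η x) _ (s := {0})
          (countable_singleton 0) (hKc.mul hη.1.continuous).continuousOn _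
          i5.intervalIntegrable]
        · rw [hz N hN, hz (-N) (by rwa [abs_neg])]; simp
        · intro x hx
          refine ((hKd x hx.2).mul (hη.differentiable x).hasDerivAt).congr_deriv ?_
          ring
      have h3 : ∫ x, (K x * deriv η x + m x * η x) = 0 := by
        rw [← h2, intervalIntegral.integral_of_le
          (by simp only [N]; linarith [abs_nonneg M]),
          setIntegral_eq_integral_of_forall_compl_eq_zero]
        intro x hx
        have hx' : x ∉ tsupport η := by
          intro hxt
          have := abs_le.1 ((hM x hxt).trans (le_abs_self M))
          exact hx ⟨by simp only [N]; linarith [this.1], by simp only [N]; linarith [this.2]⟩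
        rw [image_eq_zero_of_notMem_tsupport hx', image_eq_zero_of_notMem_tsupport
          (fun hh => hx' (tsupport_deriv_subset hh))]
        simp
      rw [integral_add i3 i2] at h3
      simp only [sub_mul]
      rw [integral_sub i1 i3]
      linarith)
  refine ⟨fun x => K x + c, hKc.add continuous_const, fun x hx => (hKd x hx).add_const c, ?_⟩
  exact hc.mono fun x hx => by simp only at hx; linarith

lemma ContDiffOn.continuousOn_deriv_off_zero {u : ℝ → ℝ} (hu : ContDiffOn ℝ 1 u {0}ᶜ) :
    ContinuousOn (deriv u) {0}ᶜ :=
  hu.continuousOn_deriv_of_isOpen isOpen_compl_singleton le_rfl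

lemma ContDiffOn.hasDerivAt_off_zero {u : ℝ → ℝ} (hu : ContDiffOn ℝ 1 u {0}ᶜ) {x : ℝ}
    (hx : x ≠ 0) : HasDerivAt u (deriv u x) x :=
  ((hu.contDiffAt (isOpen_compl_singleton.mem_nhds hx)).differentiableAt one_ne_zero).hasDerivAt

namespace CoeffFacts

variable (cf : CoeffFacts f g h)
include cf

/-- Weak and classical derivatives agree when tested with functions supported off the origin, and
the origin is a null set. -/
lemma dval_ae_eq_deriv {v : Xrho p f g h} {u : ℝ → ℝ} (hv : val v =ᵐ[volume] u)
    (hu : ContDiffOn ℝ 1 u {0}ᶜ) : dval v =ᵐ[volume] deriv u := by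
  have hu' := ContDiffOn.continuousOn_deriv_off_zero hu
  have hae : ∀ᵐ x, x ∈ ({0}ᶜ : Set ℝ) → dval v x - deriv u x = 0 := by
    refine isOpen_compl_singleton.ae_eq_zero_of_integral_contDiff_smul_eq_zero
      (((cf.locallyIntegrable_dval v).locallyIntegrableOn _).sub
        (hu'.locallyIntegrableOn (measurableSet_singleton 0).compl)) ?_
    intro η h1 h2 h3
    have hη : IsTest η := ⟨h1, h2⟩
    have i1 := LocallyIntegrable.integrable_mul_test (cf.locallyIntegrable_dval v) hη
    have hK (k : ℝ → ℝ) (hk : ContinuousOn k {0}ᶜ) (θ : ℝ → ℝ) (hθ : Continuous θ)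
        (hs : Function.support θ ⊆ tsupport η) : Integrable fun x => k x * θ x := by
      rw [← integrableOn_iff_integrable_of_support_subset (s := tsupport η)]
      · exact ((hk.mono h3).mul hθ.continuousOn).integrableOn_compact h2.isCompact
      · exact fun x hx => hs (right_ne_zero_of_mul hx)
    have i2 := hK _ hu' η hη.1.continuous (subset_tsupport _)
    have i3 := hK _ hu.continuousOn _ hη.deriv.1.continuous
      ((subset_tsupport _).trans tsupport_deriv_subset)
    have i4 := hK _ hu.continuousOn η hη.1.continuous (subset_tsupport _)
    have hd (x : ℝ) : HasDerivAt (fun x => u x * η x) (deriv u x * η x + u x * deriv η x) x := by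
      by_cases hx : x = 0
      · have hx' : x ∉ tsupport η := fun hh => h3 hh hx
        have e : (fun x => u x * η x) =ᶠ[𝓝 x] fun _ => 0 := by
          filter_upwards [notMem_tsupport_iff_eventuallyEq.1 hx'] with y hy
          rw [hy]; simp
        rw [image_eq_zero_of_notMem_tsupport hx', image_eq_zero_of_notMem_tsupport
          (fun hh => hx' (tsupport_deriv_subset hh)), mul_zero, mul_zero, add_zero]
        exact (hasDerivAt_const x (0 : ℝ)).congr_of_eventuallyEq e
      · exact (ContDiffOn.hasDerivAt_off_zero hu hx).mul (hη.differentiable x).hasDerivAt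
    have h4 := integral_eq_zero_of_hasDerivAt_of_integrable hd (i2.add i3) i4
    rw [integral_add i2 i3] at h4
    have h5 := cf.integral_dval_mul v hη
    rw [show ∫ x, val v x * deriv η x = ∫ x, u x * deriv η x from
      integral_congr_ae (hv.mono fun x hx => by simp only [hx])] at h5
    rw [show (fun x => η x • (dval v x - deriv u x)) =
      fun x => dval v x * η x - deriv u x * η x by ext x; rw [smul_eq_mul]; ring,
      integral_sub i1 i2]
    linarith
  filter_upwards [hae, ae_ne_zero] with x h1 h2
  exact sub_eq_zero.1 (h1 h2)

/-- The flux `ρ u'` of a weak solution extends continuously across the origin. -/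
lemma exists_flux {v : Xrho p f g h} {u α β : ℝ → ℝ} (hv : val v =ᵐ[volume] u)
    (hu : ContDiffOn ℝ 1 u {0}ᶜ) (hα : Continuous α) (hβ : Continuous β)
    (hsol : ∀ η, IsTest η → ∫ x, (dval v x * deriv η x + g |x| * α x * η x
      + h |x| * β x * η x) * rho f |x| = 0) :
    ∃ F : ℝ → ℝ, Continuous F ∧ ∀ x, x ≠ 0 → F x = rho f |x| * deriv u x ∧
      HasDerivAt F ((g |x| * α x + h |x| * β x) * rho f |x|) x := by
  have hρc := continuousOn_comp_abs (cf.f_cont.div_const 2)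
  have := cf.isLocallyFinite_muRho
  have hA : LocallyIntegrable fun x => rho f |x| * dval v x := by
    refine locallyIntegrable_of_forall_integrable_mul fun η hη => ?_
    have := (integrable_withDensity_ofReal_iff cf.measurable_rho cf.ae_rho_nonneg).1
      ((Lp.memLp (derivCLM v)).integrable_mul
        (hη.1.continuous.memLp_of_hasCompactSupport hη.2 : MemLp η 2 (muRho f)))
    simpa [mul_assoc, derivCLM_coe] using this
  have hm : LocallyIntegrable fun x => (g |x| * α x + h |x| * β x) * rho f |x| := by
    refine locallyIntegrable_of_integrableOn_Icc fun M => ?_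
    have hg : IntegrableOn (fun x => g |x| * rho f |x|) (Icc (-M) M) := by
      refine Integrable.mono (cf.int_g M)
        (cf.measurable_g.mul cf.measurable_rho).aestronglyMeasurable
        (Eventually.of_forall fun x => ?_)
      simp
    have := (hg.mul_continuousOn hα.continuousOn isCompact_Icc).add
      ((cf.int_h M).mul_continuousOn hβ.continuousOn isCompact_Icc)
    refine this.congr (Eventually.of_forall fun x => ?_)
    simp only [Pi.add_apply]
    ring
  have hmc : ContinuousOn (fun x => (g |x| * α x + h |x| * β x) * rho f |x|) {0}ᶜ :=
    (((continuousOn_comp_abs cf.g_cont).mul hα.continuousOn).add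
      ((continuousOn_comp_abs cf.h_cont).mul hβ.continuousOn)).mul hρc
  obtain ⟨F, hF, hFd, hFA⟩ := exists_continuous_of_weak_deriv hA hm hmc (by
    intro η hη
    rw [← hsol η hη]
    congr 1 with x
    ring)
  refine ⟨F, hF, fun x hx => ⟨?_, hFd x hx⟩⟩
  have hd := cf.dval_ae_eq_deriv hv hu
  have hae : F =ᵐ[volume.restrict {0}ᶜ] fun x => rho f |x| * deriv u x := by
    refine ae_restrict_of_ae ?_
    filter_upwards [hd, hFA] with x h1 h2
    rw [← h2, h1]
  -- Both sides are continuous off the origin, so equality almost everywhere is equality at every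
  -- such point.
  exact Measure.eqOn_open_of_ae_eq hae isOpen_compl_singleton hF.continuousOn
    (hρc.mul (ContDiffOn.continuousOn_deriv_off_zero hu)) hx

end CoeffFacts

variable {φ : ℝ → ℝ}

/-! ### The equations on the half-line -/

/-- `φ` is a positive solution of `(f φ')' = f (g φ - h φ^p)` on `(0, ∞)`. -/
structure HalfLineSolution (p : ℝ) (f g h φ : ℝ → ℝ) : Prop where
  pos : ∀ r, 0 < r → 0 < φ r
  hasDerivAt : ∀ r, 0 < r → HasDerivAt φ (deriv φ r) r
  flux : ∀ r, 0 < r →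
    HasDerivAt (fun r => f r * deriv φ r) (f r * (g r * φ r - h r * φ r ^ p)) r
  flux_zero : Tendsto (fun r => f r * deriv φ r) (𝓝[>] 0) (𝓝 0)

lemma eventually_lt_of_hasDerivAt_pos {y : ℝ → ℝ} {d r : ℝ} (hy : HasDerivAt y d r) (hd : 0 < d) :
    (∀ᶠ s in 𝓝[>] r, y r < y s) ∧ ∀ᶠ s in 𝓝[<] r, y s < y r := by
  have h := (hasDerivAt_iff_tendsto_slope.1 hy).eventually (lt_mem_nhds hd)
  constructor
  · filter_upwards [h.filter_mono (nhdsGT_le_nhdsNE r), self_mem_nhdsWithin] with s h1 h2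
    rw [slope_def_field, div_pos_iff_of_pos_right (sub_pos.2 h2)] at h1
    linarith
  · filter_upwards [h.filter_mono (nhdsLT_le_nhdsNE r), self_mem_nhdsWithin] with s h1 h2
    rw [slope_def_field, ← neg_div_neg_eq, neg_sub, neg_sub,
      div_pos_iff_of_pos_right (sub_pos.2 h2)] at h1
    linarith

namespace HalfLineSolution

variable (hs : HalfLineSolution p f g h φ) (h1 : CoeffReg f g h)
include hs h1

lemma hasDerivAt_deriv {r : ℝ} (hr : 0 < r) :
    HasDerivAt (deriv φ)
      ((-deriv f r * deriv φ r + f r * (g r * φ r - h r * φ r ^ p)) / f r) r := by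
  have hf := (h1.2.2.2 r hr).1
  have h2 := (hs.flux r hr).div (h1.differentiableAt hr).1.hasDerivAt hf.ne'
  have e : deriv φ =ᶠ[𝓝 r] fun s => f s * deriv φ s / f s := by
    filter_upwards [Ioi_mem_nhds hr] with s hs'
    rw [mul_div_cancel_left₀ _ (h1.2.2.2 s hs').1.ne']
  refine (h2.congr_of_eventuallyEq e).congr_deriv ?_
  field_simp
  ring

/-- The energy `φ'²/2 - g φ²/2 + h φ^{p+1}/(p+1)` is nonincreasing. -/
lemma antitoneOn_energy (hp : 1 < p) (h11 : CoeffMono f g h) :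
    AntitoneOn (fun r => deriv φ r ^ 2 / 2 - g r * φ r ^ 2 / 2 + h r * φ r ^ (p + 1) / (p + 1))
      (Ioi 0) := by
  have hd (r : ℝ) (hr : 0 < r) : HasDerivAt
      (fun r => deriv φ r ^ 2 / 2 - g r * φ r ^ 2 / 2 + h r * φ r ^ (p + 1) / (p + 1))
      (-(deriv f r / f r) * deriv φ r ^ 2 - deriv g r * φ r ^ 2 / 2
        + deriv h r * φ r ^ (p + 1) / (p + 1)) r := by
    have d1 := hs.hasDerivAt_deriv h1 hr
    have d2 := hs.hasDerivAt r hr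
    have d3 := (h1.differentiableAt hr).2.2.1.hasDerivAt
    have d4 := (h1.differentiableAt hr).2.2.2.hasDerivAt
    have d5 := d2.rpow_const (p := p + 1) (Or.inl (hs.pos r hr).ne')
    refine ((((d1.pow 2).div_const 2).sub ((d3.mul (d2.pow 2)).div_const 2)).add
      ((d4.mul d5).div_const (p + 1))).congr_deriv ?_
    have hf := (h1.2.2.2 r hr).1.ne'
    have hp1 : p + 1 ≠ 0 := by linarith
    simp only [add_sub_cancel_right, Pi.pow_apply]
    field_simp
    ring
  refine antitoneOn_of_deriv_nonpos (convex_Ioi 0)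
    (fun r hr => (hd r hr).continuousAt.continuousWithinAt)
    (fun r hr => (hd r (by simpa using hr)).differentiableAt.differentiableWithinAt) ?_
  intro r hr
  rw [interior_Ioi] at hr
  have hr : 0 < r := hr
  rw [(hd r hr).deriv]
  have hφ := hs.pos r hr
  have a1 : 0 ≤ deriv f r / f r * deriv φ r ^ 2 :=
    mul_nonneg (div_nonneg (h11.1 r hr) (h1.2.2.2 r hr).1.le) (sq_nonneg _)
  have a2 : 0 ≤ deriv g r * φ r ^ 2 / 2 := by
    have := h11.2.2.1 r hr
    positivity
  have a3 : deriv h r * φ r ^ (p + 1) / (p + 1) ≤ 0 :=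
    div_nonpos_of_nonpos_of_nonneg (mul_nonpos_of_nonpos_of_nonneg (h11.2.2.2.1 r hr)
      (by positivity)) (by linarith)
  linarith

/-- The flux $f\phi'$ is negative near the origin. At a first zero $r_1$ of it, $g$ must exceed
$h\phi^{p-1}$, so the nonincreasing energy is negative from $r_1$ on. This forces $|g|\phi^2\rho$ to
stay above a positive constant, against its integrability. -/
lemma deriv_neg (cf : CoeffFacts f g h) (hp : 1 < p) (h11 : CoeffMono f g h)
    (h14 : PositiveNearOrigin p g h φ)
    (hint : IntegrableOn (fun r => |g r| * φ r * φ r * rho f r) (Ioi 0)) :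
    ∀ r, 0 < r → deriv φ r < 0 := by
  set Q : ℝ → ℝ := fun r => f r * deriv φ r with hQ
  have hQd (r : ℝ) (hr : 0 < r) : HasDerivAt Q (f r * (g r * φ r - h r * φ r ^ p)) r := hs.flux r hr
  have hpow (r : ℝ) (hr : 0 < r) : φ r ^ p = φ r ^ (p - 1) * φ r := by
    rw [← Real.rpow_add_one (hs.pos r hr).ne', sub_add_cancel]
  suffices hQn : ∀ r, 0 < r → Q r < 0 by
    intro r hr
    have := hQn r hr
    have hf := cf.f_pos r hr
    by_contra hc
    exact absurd this (not_lt.2 (mul_nonneg hf.le (not_lt.1 hc)))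
  obtain ⟨δ, hδ, h14⟩ := h14
  have hsmall : ∀ r ∈ Ioo 0 δ, Q r < 0 := by
    have hanti : StrictAntiOn Q (Ioo 0 δ) := by
      refine strictAntiOn_of_deriv_neg (convex_Ioo 0 δ)
        (fun r hr => (hQd r hr.1).continuousAt.continuousWithinAt) fun r hr => ?_
      rw [interior_Ioo] at hr
      rw [(hQd r hr.1).deriv]
      refine mul_neg_of_pos_of_neg (cf.f_pos r hr.1) ?_
      linarith [h14 r hr]
    intro r hr
    have hr2 : r / 2 ∈ Ioo 0 δ := ⟨half_pos hr.1, by linarith [hr.1, hr.2]⟩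
    -- The flux tends to $0$ at the origin and decreases from there; passing through $r/2$ gives the
    -- strict inequality at $r$.
    have h3 : Q (r / 2) ≤ 0 := by
      refine ge_of_tendsto hs.flux_zero ?_
      filter_upwards [Ioo_mem_nhdsGT hr2.1] with s hs'
      exact (hanti ⟨hs'.1, hs'.2.trans hr2.2⟩ hr2 hs'.2).le
    exact (hanti hr2 hr (by linarith [hr.1])).trans_le h3
  by_contra hcon
  push Not at hcon
  obtain ⟨r', hr', hQr'⟩ := hcon
  have hcl : IsClosed (Ici δ ∩ Q ⁻¹' Ici 0) :=
    ContinuousOn.preimage_isClosed_of_isClosed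
      (fun r hr => (hQd r (hδ.trans_le hr)).continuousAt.continuousWithinAt) isClosed_Ici isClosed_Ici
  have hge (r : ℝ) (hr : 0 < r) (hQr : 0 ≤ Q r) : δ ≤ r := by
    by_contra hlt
    exact absurd (hsmall r ⟨hr, not_le.1 hlt⟩) (not_lt.2 hQr)
  have hne : (Ici δ ∩ Q ⁻¹' Ici 0).Nonempty := ⟨r', hge r' hr' hQr', hQr'⟩
  have hbdd : BddBelow (Ici δ ∩ Q ⁻¹' Ici 0) := ⟨δ, fun r hr => hr.1⟩
  set r₁ := sInf (Ici δ ∩ Q ⁻¹' Ici 0) with hr₁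
  have hmem := hcl.csInf_mem hne hbdd
  rw [← hr₁] at hmem
  have hr₁0 : 0 < r₁ := hδ.trans_le hmem.1
  have hbefore (r : ℝ) (hr : 0 < r) (hlt : r < r₁) : Q r < 0 := by
    by_contra hc
    exact absurd (csInf_le hbdd ⟨hge r hr (not_lt.1 hc), not_lt.1 hc⟩) (not_le.2 hlt)
  have hQr₁ : Q r₁ = 0 := by
    refine le_antisymm ?_ hmem.2
    refine le_of_tendsto ((hQd r₁ hr₁0).continuousAt.tendsto.mono_left
      (nhdsWithin_le_nhds (s := Iio r₁))) ?_
    filter_upwards [Ioo_mem_nhdsLT hr₁0] with s hs' using (hbefore s hs'.1 hs'.2).le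
  have hφ' : deriv φ r₁ = 0 := (mul_eq_zero.1 hQr₁).resolve_left (cf.f_pos _ hr₁0).ne'
  have hφanti : AntitoneOn φ (Ioc 0 r₁) := by
    refine antitoneOn_of_deriv_nonpos (convex_Ioc 0 r₁)
      (fun r hr => (hs.hasDerivAt r hr.1).continuousAt.continuousWithinAt)
      (fun r hr => (hs.hasDerivAt r (interior_subset hr).1).differentiableAt.differentiableWithinAt)
      fun r hr => ?_
    rw [interior_Ioc] at hr
    by_contra hc
    exact absurd (hbefore r hr.1 hr.2)
      (not_lt.2 (mul_nonneg (cf.f_pos r hr.1).le (not_le.1 hc).le))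
  -- As $\phi$ decreases up to $r_1$, $g-h\phi^{p-1}$ is nondecreasing there. Were it nonpositive at
  -- $r_1$, the flux would be nonincreasing on $(0,r_1]$ and could not climb from a negative value
  -- to $0$.
  have hk : h r₁ * φ r₁ ^ (p - 1) < g r₁ := by
    by_contra hc
    have hQanti : AntitoneOn Q (Ioc 0 r₁) := by
      refine antitoneOn_of_deriv_nonpos (convex_Ioc 0 r₁)
        (fun r hr => (hQd r hr.1).continuousAt.continuousWithinAt)
        (fun r hr => (hQd r (interior_subset hr).1).differentiableAt.differentiableWithinAt)
        fun r hr => ?_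
      rw [interior_Ioc] at hr
      rw [(hQd r hr.1).deriv, hpow r hr.1]
      have hle : φ r₁ ≤ φ r := hφanti ⟨hr.1, hr.2.le⟩ (right_mem_Ioc.2 hr₁0) hr.2.le
      have hg := cf.g_mono hr.1 (mem_Ioi.2 hr₁0) hr.2.le
      have hh := cf.h_anti hr.1 (mem_Ioi.2 hr₁0) hr.2.le
      have h4 : φ r₁ ^ (p - 1) ≤ φ r ^ (p - 1) :=
        Real.rpow_le_rpow (hs.pos _ hr₁0).le hle (by linarith)
      have h5 : h r₁ * φ r₁ ^ (p - 1) ≤ h r * φ r ^ (p - 1) :=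
        mul_le_mul hh h4 (Real.rpow_nonneg (hs.pos _ hr₁0).le _) (cf.h_pos r hr.1).le
      have h6 : (g r - h r * φ r ^ (p - 1)) * φ r ≤ 0 :=
        mul_nonpos_of_nonpos_of_nonneg (by linarith) (hs.pos r hr.1).le
      refine mul_nonpos_of_nonneg_of_nonpos (cf.f_pos r hr.1).le ?_
      linarith
    have h7 := hQanti ⟨half_pos hr₁0, by linarith⟩ (right_mem_Ioc.2 hr₁0) (by linarith : r₁ / 2 ≤ r₁)
    have h8 := hbefore (r₁ / 2) (half_pos hr₁0) (by linarith)
    linarith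
  have hE := hs.antitoneOn_energy h1 hp h11
  set E : ℝ → ℝ :=
    fun r => deriv φ r ^ 2 / 2 - g r * φ r ^ 2 / 2 + h r * φ r ^ (p + 1) / (p + 1) with hEdef
  -- Here $\phi'(r_1)=0$, and $p+1>2$ gives $h\phi^{p-1}/(p+1)\le h\phi^{p-1}/2<g/2$ at $r_1$.
  have hE1 : E r₁ < 0 := by
    have hφ1 := hs.pos _ hr₁0
    have hh1 := cf.h_pos _ hr₁0
    have e : E r₁ = φ r₁ ^ 2 * (h r₁ * φ r₁ ^ (p - 1) / (p + 1) - g r₁ / 2) := by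
      simp only [hEdef]
      rw [hφ', show p + 1 = (p - 1) + 1 + 1 by ring, Real.rpow_add_one hφ1.ne',
        Real.rpow_add_one hφ1.ne']
      ring
    rw [e]
    refine mul_neg_of_pos_of_neg (by positivity) ?_
    have h9 : h r₁ * φ r₁ ^ (p - 1) / (p + 1) ≤ h r₁ * φ r₁ ^ (p - 1) / 2 :=
      div_le_div_of_nonneg_left (by positivity) two_pos (by linarith)
    linarith
  have hlow (r : ℝ) (hr : r₁ < r) : -E r₁ * 2 * rho f r₁ ≤ |g r| * φ r * φ r * rho f r := by
    have hr0 := hr₁0.trans hr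
    have h10 := hE (mem_Ioi.2 hr₁0) (mem_Ioi.2 hr0) hr.le
    have hφr := hs.pos _ hr0
    have hh := cf.h_pos _ hr0
    have h11 : -E r₁ * 2 ≤ |g r| * φ r * φ r := by
      have h12 : 0 ≤ h r * φ r ^ (p + 1) / (p + 1) :=
        div_nonneg (by positivity) (by linarith)
      have h13 : E r = deriv φ r ^ 2 / 2 - g r * φ r ^ 2 / 2 + h r * φ r ^ (p + 1) / (p + 1) := rfl
      have h14 : g r * φ r ^ 2 ≤ |g r| * φ r ^ 2 :=
        mul_le_mul_of_nonneg_right (le_abs_self _) (sq_nonneg _)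
      have h15 : E r ≤ E r₁ := h10
      nlinarith [sq_nonneg (deriv φ r)]
    have hρ : rho f r₁ ≤ rho f r :=
      div_le_div_of_nonneg_right (cf.f_mono (mem_Ioi.2 hr₁0) (mem_Ioi.2 hr0) hr.le) two_pos.le
    exact mul_le_mul h11 hρ (cf.rho_pos hr₁0).le (by positivity)
  have hcpos : 0 < -E r₁ * 2 * rho f r₁ := by
    have := cf.rho_pos hr₁0
    have : 0 < -E r₁ := by linarith
    positivity
  have hconst : IntegrableOn (fun _ : ℝ => -E r₁ * 2 * rho f r₁) (Ioi r₁) := by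
    refine Integrable.mono' (hint.mono_set (Ioi_subset_Ioi hr₁0.le)) aestronglyMeasurable_const ?_
    filter_upwards [ae_restrict_mem measurableSet_Ioi] with r hr
    rw [Real.norm_of_nonneg hcpos.le]
    exact hlow r hr
  rw [integrableOn_const_iff] at hconst
  rcases (by simpa using hconst : E r₁ = 0 ∨ rho f r₁ = 0) with e | e <;> simp [e] at hcpos

end HalfLineSolution

/-! ### The linearized equation on the half-line and the Wronskian with $\phi'$. -/

variable {y Y : ℝ → ℝ}

/-- `y` solves the linearized equation `(f y')' = f (g - p h φ^{p-1}) y` on `(0, ∞)`, with flux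
`Y = f y'`. -/
structure HalfLineLinearized (p : ℝ) (f g h φ y Y : ℝ → ℝ) : Prop where
  hasDerivAt : ∀ r, 0 < r → HasDerivAt y (Y r / f r) r
  flux : ∀ r, 0 < r → HasDerivAt Y (f r * (g r - p * h r * φ r ^ (p - 1)) * y r) r

lemma HalfLineLinearized.neg (hy : HalfLineLinearized p f g h φ y Y) :
    HalfLineLinearized p f g h φ (-y) (-Y) :=
  ⟨fun r hr => (hy.hasDerivAt r hr).neg.congr_deriv (by rw [Pi.neg_apply, neg_div]),
    fun r hr => (hy.flux r hr).neg.congr_deriv (by rw [Pi.neg_apply]; ring)⟩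

/-- The Wronskian `f (y φ'' - y' φ')`. -/
def wronskian (p : ℝ) (f g h φ y Y : ℝ → ℝ) (r : ℝ) : ℝ :=
  y r * (-deriv f r * deriv φ r + f r * (g r * φ r - h r * φ r ^ p)) - Y r * deriv φ r

/-- The defect `-(log ρ)'' φ' + g' φ - h' φ^p` in the equation for `φ'`. -/
def defect (p : ℝ) (f g h φ : ℝ → ℝ) (r : ℝ) : ℝ :=
  -deriv (deriv fun s => Real.log (rho f s)) r * deriv φ r + deriv g r * φ r - deriv h r * φ r ^ p

lemma wronskian_neg (r : ℝ) : wronskian p f g h φ (-y) (-Y) r = -wronskian p f g h φ y Y r := by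
  simp only [wronskian, Pi.neg_apply]
  ring

/-- Differentiating the equation of $\phi$ gives the linearized equation for $\phi'$ with the defect
on the right, so all other terms cancel. In `wronskian`, $f\phi''$ is replaced by its value from the
equation, so no third derivative of $\phi$ is needed. -/
lemma hasDerivAt_wronskian (hs : HalfLineSolution p f g h φ) (h1 : CoeffReg f g h)
    (hy : HalfLineLinearized p f g h φ y Y) {r : ℝ} (hr : 0 < r) :
    HasDerivAt (wronskian p f g h φ y Y) (y r * f r * defect p f g h φ r) r := by
  obtain ⟨f1, f2, g1, g2⟩ := h1.differentiableAt hr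
  have d1 := hs.hasDerivAt_deriv h1 hr
  have d2 := hs.hasDerivAt r hr
  have d5 := d2.rpow_const (p := p) (Or.inl (hs.pos r hr).ne')
  have hQ := (f2.hasDerivAt.neg.mul d1).add
    (f1.hasDerivAt.mul ((g1.hasDerivAt.mul d2).sub (g2.hasDerivAt.mul d5)))
  refine (((hy.hasDerivAt r hr).mul hQ).sub ((hy.flux r hr).mul d1)).congr_deriv ?_
  have hf := (h1.2.2.2 r hr).1.ne'
  simp only [defect, deriv_deriv_log_rho h1 hr, Pi.add_apply, Pi.mul_apply, Pi.sub_apply,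
    Pi.neg_apply]
  field_simp
  ring

lemma defect_nonneg (hs : HalfLineSolution p f g h φ) (h11 : CoeffMono f g h)
    (hneg : ∀ r, 0 < r → deriv φ r < 0) {r : ℝ} (hr : 0 < r) : 0 ≤ defect p f g h φ r := by
  have a1 := mul_nonneg (h11.2.1 r hr) (neg_nonneg.2 (hneg r hr).le)
  have a2 := mul_nonneg (h11.2.2.1 r hr) (hs.pos r hr).le
  have a3 := mul_nonneg (neg_nonneg.2 (h11.2.2.2.1 r hr)) (Real.rpow_nonneg (hs.pos r hr).le p)
  rw [defect]
  linarith

/-- Strictness of $\phi'<0<\phi$ transfers a strict inequality in the coefficients to the defect;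
the other summands are nonnegative. -/
lemma exists_defect_pos (hs : HalfLineSolution p f g h φ) (h11 : CoeffMono f g h)
    (hneg : ∀ r, 0 < r → deriv φ r < 0) : ∃ r, 0 < r ∧ 0 < defect p f g h φ r := by
  obtain ⟨r, hr, hne⟩ := h11.2.2.2.2
  refine ⟨r, hr, ?_⟩
  have a1 := mul_nonneg (h11.2.1 r hr) (neg_nonneg.2 (hneg r hr).le)
  have a2 := mul_nonneg (h11.2.2.1 r hr) (hs.pos r hr).le
  have a3 := mul_nonneg (neg_nonneg.2 (h11.2.2.2.1 r hr)) (Real.rpow_nonneg (hs.pos r hr).le p)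
  rw [defect]
  rcases hne with h | h | h
  · have := mul_pos ((h11.2.1 r hr).lt_of_ne' h) (neg_pos.2 (hneg r hr))
    linarith
  · have := mul_pos ((h11.2.2.1 r hr).lt_of_ne' h) (hs.pos r hr)
    linarith
  · have := mul_pos (neg_pos.2 ((h11.2.2.2.1 r hr).lt_of_ne h)) (Real.rpow_pos_of_pos (hs.pos r hr) p)
    linarith

lemma monotoneOn_wronskian (hs : HalfLineSolution p f g h φ) (h1 : CoeffReg f g h)
    (h11 : CoeffMono f g h) (hneg : ∀ r, 0 < r → deriv φ r < 0)
    (hy : HalfLineLinearized p f g h φ y Y) {S : Set ℝ} (hS : Convex ℝ S) (hS0 : ∀ r ∈ S, 0 < r)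
    (hpos : ∀ r ∈ interior S, 0 ≤ y r) : MonotoneOn (wronskian p f g h φ y Y) S := by
  refine monotoneOn_of_deriv_nonneg hS
    (fun r hr => (hasDerivAt_wronskian hs h1 hy (hS0 r hr)).continuousAt.continuousWithinAt)
    (fun r hr => (hasDerivAt_wronskian hs h1 hy
      (hS0 r (interior_subset hr))).differentiableAt.differentiableWithinAt) fun r hr => ?_
  have hr0 := hS0 r (interior_subset hr)
  rw [(hasDerivAt_wronskian hs h1 hy hr0).deriv]
  exact mul_nonneg (mul_nonneg (hpos r hr) (h1.2.2.2 r hr0).1.le) (defect_nonneg hs h11 hneg hr0)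

/-- A solution cannot vanish with positive slope. -/
lemma flux_nonpos_of_eq_zero (hs : HalfLineSolution p f g h φ) (h1 : CoeffReg f g h)
    (h11 : CoeffMono f g h) (hneg : ∀ r, 0 < r → deriv φ r < 0)
    (hy : HalfLineLinearized p f g h φ y Y)
    (hlim : Tendsto (wronskian p f g h φ y Y) atTop (𝓝 0)) {r₀ : ℝ} (hr₀ : 0 < r₀)
    (h0 : y r₀ = 0) : Y r₀ ≤ 0 := by
  by_contra hY
  rw [not_le] at hY
  have hW0 : 0 < wronskian p f g h φ y Y r₀ := by
    rw [wronskian, h0]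
    have := mul_pos hY (neg_pos.2 (hneg r₀ hr₀))
    linarith
  have hpos : ∀ r, r₀ < r → 0 < y r := by
    by_contra hcon
    push Not at hcon
    obtain ⟨r', hr', hyr'⟩ := hcon
    have hev := (eventually_lt_of_hasDerivAt_pos (hy.hasDerivAt r₀ hr₀)
      (div_pos hY (h1.2.2.2 r₀ hr₀).1)).1
    rw [h0] at hev
    obtain ⟨r₂, hr₂, hr₂y⟩ := mem_nhdsGT_iff_exists_Ioo_subset.1 hev
    have hr₂0 : r₀ < r₂ := hr₂
    have hcl : IsClosed (Ici r₂ ∩ y ⁻¹' Iic 0) :=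
      ContinuousOn.preimage_isClosed_of_isClosed
        (fun r hr => (hy.hasDerivAt r ((hr₀.trans hr₂).trans_le hr)).continuousAt.continuousWithinAt)
        isClosed_Ici isClosed_Iic
    have hge (r : ℝ) (hr : r₀ < r) (hyr : y r ≤ 0) : r₂ ≤ r := by
      by_contra hlt
      exact absurd (hr₂y ⟨hr, not_le.1 hlt⟩ : 0 < y r) (not_lt.2 hyr)
    have hbdd : BddBelow (Ici r₂ ∩ y ⁻¹' Iic 0) := ⟨r₂, fun r hr => hr.1⟩
    have hmem := hcl.csInf_mem ⟨r', hge r' hr' hyr', hyr'⟩ hbdd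
    set r₁ := sInf (Ici r₂ ∩ y ⁻¹' Iic 0) with hr₁
    have hr₀₁ : r₀ < r₁ := hr₂0.trans_le hmem.1
    have hr₁0 : 0 < r₁ := hr₀.trans hr₀₁
    have hbetween (r : ℝ) (hr : r₀ < r) (hlt : r < r₁) : 0 < y r := by
      by_contra hc
      exact absurd (csInf_le hbdd ⟨hge r hr (not_lt.1 hc), not_lt.1 hc⟩) (not_le.2 hlt)
    have hy₁ : y r₁ = 0 := by
      refine le_antisymm hmem.2 ?_
      refine ge_of_tendsto ((hy.hasDerivAt r₁ hr₁0).continuousAt.tendsto.mono_left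
        (nhdsWithin_le_nhds (s := Iio r₁))) ?_
      filter_upwards [Ioo_mem_nhdsLT hr₀₁] with s hs' using (hbetween s hs'.1 hs'.2).le
    have hmono := monotoneOn_wronskian hs h1 h11 hneg hy (convex_Icc r₀ r₁)
      (fun r hr => hr₀.trans_le hr.1) (fun r hr => by
        rw [interior_Icc] at hr
        exact (hbetween r hr.1 hr.2).le)
    have hW1 := hW0.trans_le
      (hmono (left_mem_Icc.2 hr₀₁.le) (right_mem_Icc.2 hr₀₁.le) hr₀₁.le)
    rw [wronskian, hy₁] at hW1
    -- At a zero of $y$ the Wronskian is $-Y\phi'$. Its positivity at the next zero $r_1$ means that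
    -- $y$ increases through it, impossible when $y>0$ just before.
    have hY1 : 0 < Y r₁ := by
      have := hneg r₁ hr₁0
      by_contra hc
      nlinarith [mul_nonneg (neg_nonneg.2 (not_lt.1 hc)) (neg_nonneg.2 this.le)]
    have hev' := (eventually_lt_of_hasDerivAt_pos (hy.hasDerivAt r₁ hr₁0)
      (div_pos hY1 (h1.2.2.2 r₁ hr₁0).1)).2
    obtain ⟨s, hs1, hs2⟩ := (hev'.and (Ioo_mem_nhdsLT hr₀₁)).exists
    rw [hy₁] at hs1
    exact absurd (hbetween s hs2.1 hs2.2) (not_lt.2 hs1.le)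
  have hmono := monotoneOn_wronskian hs h1 h11 hneg hy (convex_Ici r₀)
    (fun r hr => hr₀.trans_le hr) (fun r hr => by
      rw [interior_Ici] at hr
      exact (hpos r hr).le)
  refine absurd hW0 (not_lt.2 (ge_of_tendsto hlim ?_))
  filter_upwards [Ici_mem_atTop r₀] with r hr using hmono self_mem_Ici hr hr

/-- Uniqueness for the first-order linear system in $(y,Y)$. On a compact interval of $(0,\infty)$
containing $r$ and $r_0$ the coefficients are bounded, hence the system is Lipschitz there. -/
lemma eq_zero_of_data_zero (hs : HalfLineSolution p f g h φ) (h1 : CoeffReg f g h)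
    (hy : HalfLineLinearized p f g h φ y Y) {r₀ : ℝ} (hr₀ : 0 < r₀) (h0 : y r₀ = 0)
    (hY0 : Y r₀ = 0) : ∀ r, 0 < r → y r = 0 := by
  intro r hr
  set a := min r r₀ / 2 with ha
  set b := max r r₀ + 1 with hb
  have ha0 : 0 < a := half_pos (lt_min hr hr₀)
  have hmin : min r r₀ ≤ r := min_le_left _ _
  have hmin' : min r r₀ ≤ r₀ := min_le_right _ _
  have hmax : r ≤ max r r₀ := le_max_left _ _
  have hmax' : r₀ ≤ max r r₀ := le_max_right _ _
  have hsub : Icc a b ⊆ Ioi 0 := fun t ht => ha0.trans_le ht.1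
  have hf : ContinuousOn f (Ioi 0) := h1.1.continuousOn
  have hg : ContinuousOn g (Ioi 0) := h1.2.2.1.continuousOn
  have hh : ContinuousOn h (Ioi 0) := h1.2.1.continuousOn
  have hφ : ContinuousOn φ (Ioi 0) := fun t ht => (hs.hasDerivAt t ht).continuousAt.continuousWithinAt
  set q : ℝ → ℝ := fun t => f t * (g t - p * h t * φ t ^ (p - 1)) with hq
  have hqc : ContinuousOn q (Ioi 0) := hf.mul (hg.sub ((continuousOn_const.mul hh).mul
    (hφ.rpow_const fun t ht => Or.inl (hs.pos t ht).ne')))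
  have hic : ContinuousOn (fun t => (f t)⁻¹) (Ioi 0) :=
    hf.inv₀ fun t ht => (h1.2.2.2 t ht).1.ne'
  obtain ⟨C₁, hC₁⟩ := isCompact_Icc.exists_bound_of_continuousOn (hic.mono hsub)
  obtain ⟨C₂, hC₂⟩ := isCompact_Icc.exists_bound_of_continuousOn (hqc.mono hsub)
  set K : ℝ≥0 := Real.toNNReal (max C₁ C₂) with hK
  have hKle : max C₁ C₂ ≤ K := Real.le_coe_toNNReal _
  let V : ℝ → ℝ × ℝ → ℝ × ℝ := fun t z => (z.2 / f t, q t * z.1)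
  have hmem : r₀ ∈ Ioo a b := ⟨by linarith, by linarith⟩
  have hd (t : ℝ) (ht : 0 < t) : HasDerivAt (fun t => (y t, Y t)) (V t (y t, Y t)) t :=
    (hy.hasDerivAt t ht).prodMk (hy.flux t ht)
  have key := ODE_solution_unique_of_mem_Icc (v := V) (s := fun _ => univ) (K := K)
    (f := fun t => (y t, Y t)) (g := fun _ => (0, 0)) (a := a) (b := b) (t₀ := r₀) ?_ hmem
    (fun t ht => (hd t (hsub ht)).continuousAt.continuousWithinAt)
    (fun t ht => hd t (ha0.trans ht.1)) (fun _ _ => mem_univ _) continuousOn_const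
    (fun t _ => by
      have : V t (0, 0) = 0 := by simp [V]
      rw [this]
      exact hasDerivAt_const t _) (fun _ _ => mem_univ _) (by simp [h0, hY0])
  · have := key (show r ∈ Icc a b from ⟨by linarith, by linarith⟩)
    exact (Prod.ext_iff.1 this).1
  · intro t ht
    refine LipschitzWith.lipschitzOnWith (LipschitzWith.of_dist_le_mul fun z w => ?_)
    have ht' := Ioo_subset_Icc_self ht
    rw [Prod.dist_eq]
    refine max_le ?_ ?_
    · have e : dist (V t z).1 (V t w).1 = ‖(f t)⁻¹‖ * dist z.2 w.2 := by
        simp only [V, Real.dist_eq, Real.norm_eq_abs]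
        rw [← abs_mul]
        congr 1
        ring
      rw [e]
      exact mul_le_mul ((hC₁ t ht').trans ((le_max_left _ _).trans hKle)) (le_max_right _ _)
        dist_nonneg K.2
    · have e : dist (V t z).2 (V t w).2 = ‖q t‖ * dist z.1 w.1 := by
        simp only [V, Real.dist_eq, Real.norm_eq_abs]
        rw [← abs_mul]
        congr 1
        ring
      rw [e]
      exact mul_le_mul ((hC₂ t ht').trans ((le_max_right _ _).trans hKle)) (le_max_left _ _)
        dist_nonneg K.2

/-- A decaying solution of the linearized equation vanishes identically or has a constant sign. -/
lemma eq_zero_or_sign (hs : HalfLineSolution p f g h φ) (h1 : CoeffReg f g h)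
    (h11 : CoeffMono f g h) (hneg : ∀ r, 0 < r → deriv φ r < 0)
    (hy : HalfLineLinearized p f g h φ y Y)
    (hlim : Tendsto (wronskian p f g h φ y Y) atTop (𝓝 0)) :
    (∀ r, 0 < r → y r = 0) ∨ (∀ r, 0 < r → 0 < y r) ∨ ∀ r, 0 < r → y r < 0 := by
  by_cases hz : ∃ r₀, 0 < r₀ ∧ y r₀ = 0
  · obtain ⟨r₀, hr₀, h0⟩ := hz
    left
    refine eq_zero_of_data_zero hs h1 hy hr₀ h0 (le_antisymm
      (flux_nonpos_of_eq_zero hs h1 h11 hneg hy hlim hr₀ h0) ?_)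
    have := flux_nonpos_of_eq_zero hs h1 h11 hneg hy.neg (by
      have := hlim.neg
      rw [neg_zero] at this
      exact this.congr fun r => (wronskian_neg r).symm) hr₀ (by simp [h0])
    simpa using this
  · push Not at hz
    right
    have hc : ContinuousOn y (Ioi 0) := fun t ht => (hy.hasDerivAt t ht).continuousAt.continuousWithinAt
    have himg : (y '' Ioi 0).OrdConnected :=
      (isPreconnected_Ioi.image y hc).ordConnected
    have h0 : (0 : ℝ) ∉ y '' Ioi 0 := by
      rintro ⟨r, hr, hyr⟩
      exact hz r hr hyr
    by_contra hcon
    push Not at hcon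
    obtain ⟨⟨r, hr, hr'⟩, s, hs1, hs2⟩ := hcon
    exact h0 (himg.out (mem_image_of_mem y hr) (mem_image_of_mem y hs1) ⟨hr', hs2⟩)

/-! ### Behaviour at the origin and exclusion of a signed odd part. -/

lemma HalfLineSolution.tendsto_deriv_zero (hs : HalfLineSolution p f g h φ)
    (cf : CoeffFacts f g h) : Tendsto (deriv φ) (𝓝[>] 0) (𝓝 0) := by
  obtain ⟨m, hm, hlow⟩ := cf.f_low
  have h1 : Tendsto (fun r => |f r * deriv φ r| / m) (𝓝[>] 0) (𝓝 0) := by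
    simpa using hs.flux_zero.abs.div_const m
  refine squeeze_zero_norm' ?_ h1
  filter_upwards [self_mem_nhdsWithin] with r hr
  have hmr := hlow r hr
  rw [le_div_iff₀ hm, abs_mul, abs_of_pos (hm.trans_le hmr), mul_comm]
  exact mul_le_mul_of_nonneg_right hmr (abs_nonneg _)

/-- Write $f'=(f'/f)f$: both factors are nonnegative and nondecreasing, so they are bounded by their
values at $1$. -/
lemma exists_deriv_le_near_zero (h1 : CoeffReg f g h) (h11 : CoeffMono f g h)
    (cf : CoeffFacts f g h) : ∃ K, ∀ r ∈ Ioo (0 : ℝ) 1, |deriv f r| ≤ K := by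
  refine ⟨deriv f 1 / f 1 * f 1, fun r hr => ?_⟩
  have a1 := monotoneOn_deriv_div h1 h11 hr.1 (mem_Ioi.2 one_pos) hr.2.le
  have a2 := cf.f_mono hr.1 (mem_Ioi.2 one_pos) hr.2.le
  have hf := cf.f_pos r hr.1
  have a3 : 0 ≤ deriv f 1 / f 1 := div_nonneg (h11.1 1 one_pos) (cf.f_pos 1 one_pos).le
  rw [abs_of_nonneg (h11.1 r hr.1)]
  calc deriv f r = deriv f r / f r * f r := by field_simp
    _ ≤ _ := mul_le_mul a1 a2 hf.le a3

/-- A solution of the linearized equation that vanishes at the origin is `O(r)`. -/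
lemma exists_abs_le_mul_near_zero (cf : CoeffFacts f g h) (hy : HalfLineLinearized p f g h φ y Y)
    (hy0 : Tendsto y (𝓝[>] 0) (𝓝 0)) {l : ℝ} (hY : Tendsto Y (𝓝[>] 0) (𝓝 l)) :
    ∃ C, 0 ≤ C ∧ ∀ᶠ r in 𝓝[>] (0 : ℝ), |y r| ≤ C * r := by
  obtain ⟨m, hm, hlow⟩ := cf.f_low
  have hb := hY.abs.eventually (gt_mem_nhds (lt_add_one |l|))
  obtain ⟨δ, hδ, hsub⟩ := mem_nhdsGT_iff_exists_Ioo_subset.1 hb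
  refine ⟨(|l| + 1) / m, by positivity, ?_⟩
  filter_upwards [Ioo_mem_nhdsGT (mem_Ioi.1 hδ)] with r hr
  have key : ∀ᶠ s in 𝓝[>] (0 : ℝ), |y r - y s| ≤ (|l| + 1) / m * r := by
    filter_upwards [Ioo_mem_nhdsGT hr.1] with s hs
    have := Convex.norm_image_sub_le_of_norm_hasDerivWithin_le (s := Icc s r) (f := y)
      (f' := fun t => Y t / f t) (C := (|l| + 1) / m)
      (fun t ht => (hy.hasDerivAt t (hs.1.trans_le ht.1)).hasDerivWithinAt) (fun t ht => by
        have ht0 := hs.1.trans_le ht.1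
        have hft := hlow t ht0
        have hYt : |Y t| < |l| + 1 := hsub ⟨ht0, ht.2.trans_lt hr.2⟩
        rw [norm_div, Real.norm_eq_abs, Real.norm_of_nonneg (hm.le.trans hft)]
        exact div_le_div₀ (by positivity) hYt.le hm hft) (convex_Icc s r)
      (left_mem_Icc.2 hs.2.le) (right_mem_Icc.2 hs.2.le)
    rw [Real.norm_eq_abs, Real.norm_eq_abs, abs_of_pos (sub_pos.2 hs.2)] at this
    exact this.trans (mul_le_mul_of_nonneg_left (by linarith [hs.1]) (by positivity))
  have hlim : Tendsto (fun s => |y r - y s|) (𝓝[>] 0) (𝓝 |y r|) := by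
    simpa using (hy0.const_sub (y r)).abs
  exact le_of_tendsto hlim key

/-- There is no positive decaying solution of the linearized equation that vanishes at the
origin. -/
lemma not_pos_of_tendsto_zero (hp : 1 < p) (hs : HalfLineSolution p f g h φ)
    (cf : CoeffFacts f g h) (h1 : CoeffReg f g h) (h11 : CoeffMono f g h)
    (hneg : ∀ r, 0 < r → deriv φ r < 0)
    (hy : HalfLineLinearized p f g h φ y Y)
    (hlim : Tendsto (wronskian p f g h φ y Y) atTop (𝓝 0)) (hpos : ∀ r, 0 < r → 0 < y r)
    (hy0 : Tendsto y (𝓝[>] 0) (𝓝 0)) {l : ℝ} (hY : Tendsto Y (𝓝[>] 0) (𝓝 l))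
    {c : ℝ} (hφ : Tendsto φ (𝓝[>] 0) (𝓝 c))
    (hor : (∃ M : ℝ, ∀ᶠ r in 𝓝[>] (0 : ℝ),
        M ≤ -deriv f r * deriv φ r + f r * g r * φ r - f r * h r * φ r ^ p) ∨
      (fun r => f r * |g r| + f r * h r) =o[𝓝[>] 0] (fun r : ℝ => r⁻¹)) : False := by
  obtain ⟨r₁, hr₁, hd₁⟩ := exists_defect_pos hs h11 hneg
  have hmono := monotoneOn_wronskian hs h1 h11 hneg hy (convex_Ioi 0) (fun r hr => hr)
    (fun r hr => (hpos r (interior_subset hr)).le)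
  -- The Wronskian is nondecreasing with limit $0$ and increases strictly at $r_1$, where the defect
  -- is positive.
  have hW₁ : wronskian p f g h φ y Y r₁ < 0 := by
    have hev := (eventually_lt_of_hasDerivAt_pos (hasDerivAt_wronskian hs h1 hy hr₁)
      (mul_pos (mul_pos (hpos r₁ hr₁) (cf.f_pos r₁ hr₁)) hd₁)).1
    obtain ⟨r₂, h2, h2'⟩ := (hev.and self_mem_nhdsWithin).exists
    have hr₂ : 0 < r₂ := hr₁.trans h2'
    refine h2.trans_le (ge_of_tendsto hlim ?_)
    filter_upwards [Ici_mem_atTop r₂] with r hr using hmono hr₂ (hr₂.trans_le hr) hr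
  -- Half the gap, so that each of the two terms of the Wronskian near the origin may lose
  -- $\varepsilon$.
  set ε := -wronskian p f g h φ y Y r₁ / 2 with hε
  have hεpos : 0 < ε := by rw [hε]; linarith
  have hφ' := hs.tendsto_deriv_zero cf
  have hYφ : ∀ᶠ r in 𝓝[>] (0 : ℝ), Y r * deriv φ r < ε := by
    have := hY.mul hφ'
    rw [mul_zero] at this
    exact this.eventually (gt_mem_nhds hεpos)
  have hmain : ∀ᶠ r in 𝓝[>] (0 : ℝ),
      -ε < y r * (-deriv f r * deriv φ r + f r * (g r * φ r - h r * φ r ^ p)) := by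
    -- If $f\phi''\ge M$, positivity of $y$ and $y\to0$ suffice. Otherwise $y=O(r)$ offsets
    -- $f(|g|+h)=o(r^{-1})$, while $f'$ is bounded and $\phi'\to0$.
    rcases hor with ⟨M, hM⟩ | ho
    · have h3 : Tendsto (fun r => y r * M) (𝓝[>] 0) (𝓝 0) := by
        simpa using hy0.mul_const M
      filter_upwards [hM, h3.eventually (lt_mem_nhds (neg_lt_zero.2 hεpos)),
        self_mem_nhdsWithin] with r a1 a2 a3
      refine a2.trans_le (mul_le_mul_of_nonneg_left ?_ (hpos r a3).le)
      linarith
    · obtain ⟨K, hK⟩ := exists_deriv_le_near_zero h1 h11 cf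
      obtain ⟨C, hC, hyC⟩ := exists_abs_le_mul_near_zero cf hy hy0 hY
      have ho' : Tendsto (fun r => (f r * |g r| + f r * h r) * r) (𝓝[>] 0) (𝓝 0) := by
        refine ho.tendsto_div_nhds_zero.congr fun r => ?_
        rw [div_inv_eq_mul]
      have hφp : Tendsto (fun r => φ r + φ r ^ p) (𝓝[>] 0) (𝓝 (c + c ^ p)) :=
        hφ.add (hφ.rpow_const (Or.inr (by linarith)))
      have hT : Tendsto (fun r => |y r| * (K * |deriv φ r|)
          + C * ((f r * |g r| + f r * h r) * r) * (φ r + φ r ^ p)) (𝓝[>] 0) (𝓝 0) := by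
        have := (hy0.abs.mul (hφ'.abs.const_mul K)).add ((ho'.const_mul C).mul hφp)
        simpa using this
      filter_upwards [hT.eventually (gt_mem_nhds hεpos), hyC, Ioo_mem_nhdsGT one_pos]
        with r a1 a2 a3
      have hf := cf.f_pos r a3.1
      have hh := cf.h_pos r a3.1
      have hφr := hs.pos r a3.1
      have b1 : |-deriv f r * deriv φ r| ≤ K * |deriv φ r| := by
        rw [abs_mul, abs_neg]
        exact mul_le_mul_of_nonneg_right (hK r a3) (abs_nonneg _)
      have b2 : |f r * (g r * φ r - h r * φ r ^ p)| ≤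
          (f r * |g r| + f r * h r) * (φ r + φ r ^ p) := by
        rw [abs_mul, abs_of_pos hf]
        have c1 : |g r * φ r - h r * φ r ^ p| ≤ |g r| * φ r + h r * φ r ^ p := by
          refine (abs_sub _ _).trans (le_of_eq ?_)
          rw [abs_mul, abs_mul, abs_of_pos hφr, abs_of_pos hh,
            abs_of_pos (Real.rpow_pos_of_pos hφr p)]
        have c2 : 0 ≤ |g r| * φ r ^ p := by positivity
        have c3 : 0 ≤ h r * φ r := by positivity
        calc _ ≤ f r * (|g r| * φ r + h r * φ r ^ p) := by gcongr
          _ ≤ f r * ((|g r| + h r) * (φ r + φ r ^ p)) := by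
              gcongr
              linarith
          _ = _ := by ring
      have b3 : |y r * (-deriv f r * deriv φ r + f r * (g r * φ r - h r * φ r ^ p))| < ε := by
        refine lt_of_le_of_lt ?_ a1
        rw [abs_mul]
        calc _ ≤ |y r| * (K * |deriv φ r| + (f r * |g r| + f r * h r) * (φ r + φ r ^ p)) := by
              gcongr
              exact (abs_add_le _ _).trans (add_le_add b1 b2)
          _ = |y r| * (K * |deriv φ r|)
              + |y r| * ((f r * |g r| + f r * h r) * (φ r + φ r ^ p)) := by ring
          _ ≤ |y r| * (K * |deriv φ r|)
              + C * r * ((f r * |g r| + f r * h r) * (φ r + φ r ^ p)) := by gcongr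
          _ = _ := by ring
      exact (abs_lt.1 b3).1
  obtain ⟨r, ⟨a1, a2⟩, a3⟩ := ((hmain.and hYφ).and (Ioo_mem_nhdsGT hr₁)).exists
  have hle := hmono a3.1 (mem_Ioi.2 hr₁) a3.2.le
  have : wronskian p f g h φ y Y r = y r * (-deriv f r * deriv φ r
    + f r * (g r * φ r - h r * φ r ^ p)) - Y r * deriv φ r := rfl
  linarith

/-! ### Passing from the line to the half-line -/

lemma deriv_neg_of_even (he : ∀ x, φ (-x) = φ x) (x : ℝ) : deriv φ (-x) = -deriv φ x := by
  have h1 : deriv (fun x => φ (-x)) x = -deriv φ (-x) := deriv_comp_neg φ x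
  rw [show (fun x => φ (-x)) = φ from funext he] at h1
  rw [h1, neg_neg]

/-- The weak equation across $x=0$ makes the flux $\rho\phi'$ continuous there; evenness of $\phi$
makes it odd, so it vanishes at the origin. -/
lemma IsPositiveRadialSolution.halfLineSolution {Φ : Xrho p f g h} (cf : CoeffFacts f g h)
    (hΦ : IsPositiveRadialSolution Φ φ) : HalfLineSolution p f g h φ := by
  have hC1 : ContDiffOn ℝ 1 φ {0}ᶜ := hΦ.smooth.of_le (by norm_num)
  obtain ⟨F, hF, hFd⟩ := cf.exists_flux (α := φ) (β := fun x => -φ x ^ p) hΦ.repr hC1 hΦ.cont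
    (hΦ.cont.rpow_const fun x => Or.inl (hΦ.pos x).ne').neg (by
      intro η hη
      rw [← hΦ.solves η hη (subset_univ _)]
      refine integral_congr_ae ?_
      filter_upwards [hΦ.repr] with x hx
      rw [hx, ← sgnPow_of_pos (hΦ.pos x), sgnPow]
      ring)
  have hFf (r : ℝ) (hr : 0 < r) : f r * deriv φ r = 2 * F r := by
    rw [(hFd r hr.ne').1, abs_of_pos hr, rho]
    ring
  have hF0 : F 0 = 0 := by
    have hodd : ∀ᶠ x in 𝓝[≠] (0 : ℝ), F (-x) = -F x := by
      filter_upwards [self_mem_nhdsWithin] with x hx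
      rw [(hFd x hx).1, (hFd (-x) (neg_ne_zero.2 hx)).1, abs_neg, deriv_neg_of_even hΦ.even]
      ring
    have t1 : Tendsto (fun x => F (-x)) (𝓝[≠] 0) (𝓝 (F 0)) := by
      have := (hF.comp continuous_neg).tendsto 0
      simp only [Function.comp_def, neg_zero] at this
      exact this.mono_left nhdsWithin_le_nhds
    have t2 : Tendsto (fun x => -F x) (𝓝[≠] 0) (𝓝 (-F 0)) :=
      (hF.neg.tendsto 0).mono_left nhdsWithin_le_nhds
    have := tendsto_nhds_unique (t1.congr' hodd) t2
    linarith
  refine ⟨fun r _ => hΦ.pos r, fun r hr => ContDiffOn.hasDerivAt_off_zero hC1 hr.ne',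
    fun r hr => ?_, ?_⟩
  · have e : (fun r => f r * deriv φ r) =ᶠ[𝓝 r] fun r => 2 * F r := by
      filter_upwards [Ioi_mem_nhds hr] with s hs using hFf s hs
    refine (((hFd r hr.ne').2.const_mul 2).congr_of_eventuallyEq e).congr_deriv ?_
    rw [abs_of_pos hr, rho]
    ring
  · have t : Tendsto (fun r => 2 * F r) (𝓝[>] 0) (𝓝 0) := by
      have := (hF.tendsto 0).const_mul 2
      rw [hF0, mul_zero] at this
      exact this.mono_left nhdsWithin_le_nhds
    refine t.congr' ?_
    filter_upwards [self_mem_nhdsWithin] with r hr using (hFf r hr).symm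

/-- The even and odd parts of a solution of the linearized equation, restricted to the
half-line. -/
lemma exists_halfLineLinearized {w : Xrho p f g h} {u : ℝ → ℝ} (cf : CoeffFacts f g h)
    (hp : 1 < p) (hφc : Continuous φ) (hφe : ∀ x, φ (-x) = φ x) (hw : SolvesLinearized φ w)
    (hu : val w =ᵐ[volume] u) (huc : Continuous u) (hu1 : ContDiffOn ℝ 1 u {0}ᶜ) (σ : ℝ) :
    ∃ Y, HalfLineLinearized p f g h φ (fun r => u r + σ * u (-r)) Y ∧
      (∃ l, Tendsto Y (𝓝[>] 0) (𝓝 l)) ∧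
      ∀ r, 0 < r → Y r = f r * (deriv u r - σ * deriv u (-r)) := by
  obtain ⟨F, hF, hFd⟩ := cf.exists_flux (α := u) (β := fun x => -(p * φ x ^ (p - 1) * u x)) hu hu1
    huc ((continuous_const.mul (hφc.rpow_const fun x => Or.inr (by linarith))).mul huc).neg (by
      intro η hη
      rw [← hw η hη]
      refine integral_congr_ae ?_
      filter_upwards [hu] with x hx
      rw [hx]
      ring)
  -- The factor $2$ undoes $\rho=f/2$, and reflection reverses the sign of the derivative.
  have hY (r : ℝ) (hr : 0 < r) :
      2 * (F r - σ * F (-r)) = f r * (deriv u r - σ * deriv u (-r)) := by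
    rw [(hFd r hr.ne').1, (hFd (-r) (neg_ne_zero.2 hr.ne')).1, abs_neg, abs_of_pos hr, rho]
    ring
  refine ⟨fun r => 2 * (F r - σ * F (-r)), ⟨fun r hr => ?_, fun r hr => ?_⟩,
    ⟨2 * (F 0 - σ * F (-0)), ?_⟩, hY⟩
  · have d1 := ContDiffOn.hasDerivAt_off_zero hu1 hr.ne'
    have d2 := (ContDiffOn.hasDerivAt_off_zero hu1 (neg_ne_zero.2 hr.ne')).comp r (hasDerivAt_neg r)
    refine (d1.add (d2.const_mul σ)).congr_deriv ?_
    rw [hY r hr, mul_div_cancel_left₀ _ (cf.f_pos r hr).ne']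
    ring
  · have d1 := (hFd r hr.ne').2
    have d2 := (hFd (-r) (neg_ne_zero.2 hr.ne')).2.comp r (hasDerivAt_neg r)
    refine ((d1.sub (d2.const_mul σ)).const_mul 2).congr_deriv ?_
    rw [abs_neg, abs_of_pos hr, hφe, rho]
    ring
  · exact ((continuous_const.mul (hF.sub (continuous_const.mul
      (hF.comp continuous_neg)))).tendsto 0).mono_left nhdsWithin_le_nhds

lemma exists_bound_atTop (hb : BoundedAtInfinity p f g h φ) (cf : CoeffFacts f g h)
    (h11 : CoeffMono f g h) (hpos : ∀ x, 0 < φ x) :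
    ∃ B, ∀ᶠ r in atTop,
      |-deriv f r * deriv φ r + f r * (g r * φ r - h r * φ r ^ p)| ≤ B ∧
        |f r * deriv φ r| ≤ B := by
  obtain ⟨B, hB, -⟩ := EReal.lt_iff_exists_real_btwn.1 hb
  refine ⟨B, ?_⟩
  filter_upwards [eventually_lt_of_limsup_lt hB, Ioi_mem_atTop 0] with r h2 hr
  rw [EReal.coe_lt_coe_iff] at h2
  have hf := cf.f_pos r hr
  have hh := cf.h_pos r hr
  have hφ := hpos r
  have a1 := mul_nonneg (h11.1 r hr) (abs_nonneg (deriv φ r))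
  have a2 : 0 ≤ f r * |g r| * φ r := by positivity
  have a3 : 0 ≤ f r * h r * φ r ^ p := by positivity
  have a4 : 0 ≤ f r * |deriv φ r| := by positivity
  constructor
  · have e1 : |-deriv f r * deriv φ r| = deriv f r * |deriv φ r| := by
      rw [abs_mul, abs_neg, abs_of_nonneg (h11.1 r hr)]
    have e2 : |f r * (g r * φ r - h r * φ r ^ p)| ≤ f r * |g r| * φ r + f r * h r * φ r ^ p := by
      rw [mul_sub]
      refine (abs_sub _ _).trans (le_of_eq ?_)
      rw [abs_mul, abs_mul, abs_mul, abs_mul, abs_of_pos hf, abs_of_pos hφ, abs_of_pos hh,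
        abs_of_pos (Real.rpow_pos_of_pos hφ p)]
      ring
    have := abs_add_le (-deriv f r * deriv φ r) (f r * (g r * φ r - h r * φ r ^ p))
    linarith
  · rw [abs_mul, abs_of_pos hf]
    linarith

/-- The Wronskian is $y\cdot f\phi''-y'\cdot f\phi'$, where $f\phi''$ and $f\phi'$ are bounded at
infinity and $y,y'$ decay. No bound on $f$ itself is needed. -/
lemma tendsto_wronskian_atTop {u : ℝ → ℝ} {σ : ℝ} (hb : BoundedAtInfinity p f g h φ)
    (cf : CoeffFacts f g h) (h11 : CoeffMono f g h) (hpos : ∀ x, 0 < φ x)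
    (hu : Tendsto (fun x => |u x| + |deriv u x|) (cocompact ℝ) (𝓝 0))
    (hY : ∀ r, 0 < r → Y r = f r * (deriv u r - σ * deriv u (-r))) :
    Tendsto (wronskian p f g h φ (fun r => u r + σ * u (-r)) Y) atTop (𝓝 0) := by
  obtain ⟨B, hB⟩ := exists_bound_atTop hb cf h11 hpos
  have hc1 : Tendsto u (cocompact ℝ) (𝓝 0) :=
    squeeze_zero_norm (fun x => le_add_of_nonneg_right (abs_nonneg _)) hu
  have hc2 : Tendsto (deriv u) (cocompact ℝ) (𝓝 0) :=
    squeeze_zero_norm (fun x => le_add_of_nonneg_left (abs_nonneg _)) hu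
  have top : Tendsto (fun r : ℝ => r) atTop (cocompact ℝ) := atTop_le_cocompact
  have bot : Tendsto (fun r : ℝ => -r) atTop (cocompact ℝ) :=
    tendsto_neg_atTop_atBot.mono_right atBot_le_cocompact
  have ty : Tendsto (fun r => |u r + σ * u (-r)|) atTop (𝓝 0) := by
    simpa using ((hc1.comp top).add ((hc1.comp bot).const_mul σ)).abs
  have ty' : Tendsto (fun r => |deriv u r - σ * deriv u (-r)|) atTop (𝓝 0) := by
    simpa using ((hc2.comp top).sub ((hc2.comp bot).const_mul σ)).abs
  have hT : Tendsto (fun r => |u r + σ * u (-r)| * B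
      + |deriv u r - σ * deriv u (-r)| * B) atTop (𝓝 0) := by
    simpa using (ty.mul_const B).add (ty'.mul_const B)
  refine squeeze_zero_norm' ?_ hT
  filter_upwards [hB, Ioi_mem_atTop 0] with r hr hr0
  rw [wronskian, hY r hr0, Real.norm_eq_abs]
  refine (abs_sub _ _).trans (add_le_add ?_ ?_)
  · rw [abs_mul]
    exact mul_le_mul_of_nonneg_left hr.1 (abs_nonneg _)
  · rw [show f r * (deriv u r - σ * deriv u (-r)) * deriv φ r =
      (deriv u r - σ * deriv u (-r)) * (f r * deriv φ r) by ring, abs_mul]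
    exact mul_le_mul_of_nonneg_left hr.2 (abs_nonneg _)

lemma OriginAlternative.lower_bound_or (h15 : OriginAlternative p f g h φ) :
    (∃ M : ℝ, ∀ᶠ r in 𝓝[>] (0 : ℝ),
        M ≤ -deriv f r * deriv φ r + f r * g r * φ r - f r * h r * φ r ^ p) ∨
      (fun r => f r * |g r| + f r * h r) =o[𝓝[>] 0] (fun r : ℝ => r⁻¹) := by
  rcases h15 with h | h
  · obtain ⟨M, -, hM⟩ := EReal.lt_iff_exists_real_btwn.1 h
    refine Or.inl ⟨M, ?_⟩
    filter_upwards [eventually_lt_of_lt_liminf hM] with r hr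
    exact (EReal.coe_lt_coe_iff.1 hr).le
  · exact Or.inr h.1

/-- A solution of the linearized equation orthogonal to `h φ^p` cannot have an even part of
constant sign. -/
lemma not_even_part_sign {w : Xrho p f g h} {u : ℝ → ℝ} (cf : CoeffFacts f g h)
    (hpos : ∀ x, 0 < φ x) (hφe : ∀ x, φ (-x) = φ x) (hu : val w =ᵐ[volume] u)
    (hi : Integrable fun x => h |x| * φ x ^ p * val w x * rho f |x|)
    (h0 : ∫ x, h |x| * φ x ^ p * val w x * rho f |x| = 0) (σ : ℝ)
    (hsgn : ∀ r, 0 < r → 0 < σ * (u r + u (-r))) : False := by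
  set Z : ℝ → ℝ := fun x => h |x| * φ x ^ p * u x * rho f |x| with hZ
  have hae : (fun x => h |x| * φ x ^ p * val w x * rho f |x|) =ᵐ[volume] Z := by
    filter_upwards [hu] with x hx
    simp only [hZ, hx]
  have hZi : Integrable Z := hi.congr hae
  have hZ0 : ∫ x, Z x = 0 := by rw [← integral_congr_ae hae, h0]
  -- The weight $h\phi^p\rho$ is even, so symmetrizing $Z$ replaces $u$ by $u(x)+u(-x)$, and the
  -- integrand becomes positive almost everywhere. The sign $\sigma$ treats both cases at once.
  have hsum : ∫ x, σ * (Z x + Z (-x)) = 0 := by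
    rw [integral_const_mul, integral_add hZi hZi.comp_neg, integral_neg_eq_self, hZ0, add_zero,
      mul_zero]
  have hp' : ∀ᵐ x, 0 < σ * (Z x + Z (-x)) := by
    filter_upwards [cf.ae_dH_pos, ae_ne_zero] with x h1 h2
    have h3 : 0 < σ * (u x + u (-x)) := by
      rcases lt_or_gt_of_ne h2 with h | h
      · have := hsgn (-x) (neg_pos.2 h)
        rwa [neg_neg, add_comm (u (-x))] at this
      · exact hsgn x h
    have h4 : σ * (Z x + Z (-x)) = (h |x| * rho f |x|) * φ x ^ p * (σ * (u x + u (-x))) := by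
      simp only [hZ, abs_neg, hφe]
      ring
    rw [h4]
    exact mul_pos (mul_pos h1 (Real.rpow_pos_of_pos (hpos x) p)) h3
  have hz := (integral_eq_zero_iff_of_nonneg_ae (hp'.mono fun x hx => hx.le)
    ((hZi.add hZi.comp_neg).const_mul σ)).1 hsum
  have hF : ∀ᵐ _ : ℝ, False := by
    filter_upwards [hz, hp'] with x a b
    simp only [Pi.zero_apply] at a
    linarith
  obtain ⟨_, hx⟩ := hF.exists
  exact hx

end EvenNLS
end
-- Nondegeneracy of the positive even solution.
open EvenNLS
theorem mainTheorem7 (p : ℝ) (hp : 1 < p) (f g h : ℝ → ℝ)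
    (h1 : CoeffReg f g h) (h2 : OriginIntegrable f g h) (h3 : OriginUV p f g h)
    (h4 : OriginJ p f g h) (h5 : SignG p f g h) (h6 : NormBoundRad p f g h)
    (h7 : CompactEmbedding p f g h ∨ ComparisonPotential p f g h)
    (h8 : RegularAtOrigin p f g h) (h9 : PohozaevAtInfinity p f g h)
    (h10 : NormBound p f g h) (h11 : CoeffMono f g h)
    (Φ : Xrho p f g h) (φ : ℝ → ℝ) (hΦ : IsPositiveRadialSolution Φ φ)
    (h12 : LinearizedRegular p f g h φ) (h13 : BoundedAtInfinity p f g h φ)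
    (h14 : PositiveNearOrigin p g h φ) (h15 : OriginAlternative p f g h φ) :
    ContDiff ℝ 2 (energy : Xrho p f g h → ℝ) ∧
      fderiv ℝ (energy : Xrho p f g h → ℝ) Φ = 0 ∧
      {w : Xrho p f g h | fderiv ℝ (fderiv ℝ (energy : Xrho p f g h → ℝ)) Φ w = 0} = {0} := by
  have cf := coeffFacts h1 h2 h11
  have hs := hΦ.halfLineSolution cf
  have hneg : ∀ r, 0 < r → deriv φ r < 0 := by
    refine hs.deriv_neg h1 cf hp h11 h14 ?_
    refine (cf.integrable_abs_g_val_mul_val Φ Φ).integrableOn.congr ?_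
    filter_upwards [ae_restrict_of_ae hΦ.repr, ae_restrict_mem measurableSet_Ioi] with r hr hr0
    rw [hr, abs_of_pos (mem_Ioi.1 hr0)]
  refine ⟨cf.contDiff_energy hp h10, ?_, ?_⟩
  · rw [cf.fderiv_energy hp h10]
    exact cf.energyD_eq_zero hp hΦ.solves
  rw [cf.fderiv_energy hp h10]
  refine Subset.antisymm (fun w hw => ?_) (by simp)
  have hwl := cf.solvesLinearized_of_fderiv hp hΦ.repr hΦ.pos hw
  obtain ⟨hi, h0⟩ := cf.integral_rpow_mul_eq_zero hp hΦ.repr hΦ.pos hΦ.solves hw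
  obtain ⟨u, hu, huc, hu1, hud⟩ := h12 w hwl
  -- A constant sign of the even part contradicts orthogonality to $h\phi^p$.
  have heven : ∀ r, 0 < r → u r + u (-r) = 0 := by
    obtain ⟨Y, hy, -, hY⟩ := exists_halfLineLinearized cf hp hΦ.cont hΦ.even hwl hu huc hu1 1
    have hlim := tendsto_wronskian_atTop h13 cf h11 hΦ.pos hud hY
    have hno := not_even_part_sign cf hΦ.pos hΦ.even hu hi h0
    rcases eq_zero_or_sign hs h1 h11 hneg hy hlim with h | h | h
    · simpa using h
    · exact (hno 1 (by simpa using h)).elim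
    · exact (hno (-1) fun r hr => by have := h r hr; linarith).elim
  -- Orthogonality says nothing about the odd part; instead, its vanishing at the origin, by
  -- continuity of $u$, excludes a sign.
  have hodd : ∀ r, 0 < r → u r + -1 * u (-r) = 0 := by
    obtain ⟨Y, hy, ⟨l, hl⟩, hY⟩ :=
      exists_halfLineLinearized cf hp hΦ.cont hΦ.even hwl hu huc hu1 (-1)
    have hlim := tendsto_wronskian_atTop h13 cf h11 hΦ.pos hud hY
    have hy0 : Tendsto (fun r => u r + -1 * u (-r)) (𝓝[>] 0) (𝓝 0) := by
      have hc : Continuous fun r => u r + -1 * u (-r) :=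
        huc.add (continuous_const.mul (huc.comp continuous_neg))
      have := hc.tendsto 0
      simp only [neg_zero, neg_one_mul, add_neg_cancel] at this
      simpa using this.mono_left nhdsWithin_le_nhds
    have hφ0 : Tendsto φ (𝓝[>] 0) (𝓝 (φ 0)) := (hΦ.cont.tendsto 0).mono_left nhdsWithin_le_nhds
    have hor := h15.lower_bound_or
    rcases eq_zero_or_sign hs h1 h11 hneg hy hlim with h | h | h
    · exact h
    · exact (not_pos_of_tendsto_zero hp hs cf h1 h11 hneg hy hlim h hy0 hl hφ0 hor).elim
    · refine (not_pos_of_tendsto_zero hp hs cf h1 h11 hneg hy.neg ?_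
        (fun r hr => neg_pos.2 (h r hr)) (by have := hy0.neg; rw [neg_zero] at this; exact this) hl.neg hφ0 hor).elim
      have := hlim.neg
      rw [neg_zero] at this
      exact this.congr fun r => (wronskian_neg r).symm
  refine cf.eq_zero_of_val_ae (hu.trans ?_)
  filter_upwards [ae_ne_zero] with x hx
  rcases lt_or_gt_of_ne hx with h | h
  · have a1 := heven (-x) (neg_pos.2 h)
    have a2 := hodd (-x) (neg_pos.2 h)
    rw [neg_neg] at a1 a2
    rw [Pi.zero_apply]
    linarith
  · have a1 := heven x h
    have a2 := hodd x h
    rw [Pi.zero_apply]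
    linarith
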